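/- Let $Y$ be a smooth projective variety over $\mathbb C$ (integral), $\mathscr L$ a very ample invertible sheaf on $Y$, and $f\in\Gamma(Y,\mathscr L)$. For a section $\sigma$ of an invertible sheaf write $V_\sigma=\{\sigma=0\}$ for its zero scheme. Let $m\ge 2$. Assume that the singular locus $\mathrm{Sing}\,V_f$ (with its reduced structure) is a curve, i.e. nonempty and purely one-dimensional, and that the transversal slices of $V_f$ at general singular points are ordinary $m$-ple points. That is, there is an open $U\subset Y$, with $U\cap\mathrm{Sing}\,V_f$ dense in $\mathrm{Sing}\,V_f$, such that at every closed point $x\in U\cap\mathrm{Sing}\,V_f$ the curve $\mathrm{Sing}\,V_f$ is smooth, and for every smooth hypersurface germ $H\subset Y$ at $x$ transversal to $\mathrm{Sing}\,V_f$ the germ $V_f\cap H\subset H$ is an ordinary $m$-ple point, meaning a hypersurface germ of multiplicity $m$ whose projectivized tangent cone is a smooth hypersurface (possibly empty). Assume further that there are an ample invertible sheaf $\mathscr L'$ on $Y$ with an isomorphism $\mathscr L'^{\otimes m}\cong\mathscr L$ and a section $h\in\Gamma(Y,\mathscr L')$ such that $V_h\subset Y$ is reduced and smooth and intersects $\mathrm{Sing}\,V_f$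 transversally at general points. That is, $V_h\cap\mathrm{Sing}\,V_f\subset U$, and at each closed point of $V_h\cap \mathrm{Sing}\,V_f$ the scheme-theoretic intersection of $V_h$ with the reduced curve $\mathrm{Sing}\,V_f$ is a reduced point. Set $g:=h^m\in\Gamma(Y,\mathscr L)$ and $V_{f+sg}:=\{f+sg=0\}\subset Y\times\mathbb C$, where $s$ is the coordinate of $\mathbb C$. Let $\pi:\widetilde Y\to Y$ be the blow-up of $Y$ with reduced center $V_h\cap\mathrm{Sing}\,V_f$. Let $\widetilde V_f\subset\widetilde Y$ and $\widetilde V_{f+sg}\subset\widetilde Y\times\mathbb C$ be the proper transforms of $V_f$ and $V_{f+sg}$, i.e. the scheme-theoretic closures of their inverse images outside the inverse image of the center. Then: 1. $\widetilde V_{f+sg}$ is smooth over $\mathbb C$. 2. $\widetilde V_f=\widetilde V_{f+sg}\cap\{s=0\}$ as closed subschemes of $\widetilde Y=\widetilde Y\times\{0\}$. 3. The transversal slices of $\widetilde V_f$ at general singular points are ordinary $m$-ple points: there is an open $\widetilde U\subset\widetilde Y$, with $\widetilde U\cap\mathrm{Sing}\,\widetilde V_f$ dense in $\mathrm{Sing}\,\widetilde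 V_f$, such that at every closed point of $\widetilde U\cap\mathrm{Sing}\,\widetilde V_f$ the reduced singular locus is a smooth curve and every slice of $\widetilde V_f$ by a smooth hypersurface germ transversal to it is an ordinary $m$-ple point. -/

import Mathlib

open AlgebraicGeometry CategoryTheory TopologicalSpace

namespace PencilBlowup

noncomputable section

universe u

/-! ### Invertible sheaves, sections and tensor powers -/

/-- Restriction of a section of a sheaf of modules to a smaller open set. -/
def restrictSection {Y : Scheme.{u}} (L : Y.Modules) {U V : Y.Opens} (hVU : V ≤ U)
    (s : Γ(L, U)) : Γ(L, V) :=
  L.presheaf.map (homOfLE hVU).op s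

/-- Restriction of a regular function to a smaller open set, as a ring homomorphism. -/
def restrictFun {X : Scheme.{u}} {U V : X.Opens} (hVU : V ≤ U) : Γ(X, U) →+* Γ(X, V) :=
  (X.presheaf.map (homOfLE hVU).op).hom

/-- `e` is a free generator of `L` over `V`: multiplication by `e` is an isomorphism of sheaves
from the structure sheaf of `V` to the restriction of `L` to `V`. -/
def IsLocalGenerator {Y : Scheme.{u}} (L : Y.Modules) {V : Y.Opens} (e : Γ(L, V)) : Prop :=
  ∀ (W : Y.Opens) (hWV : W ≤ V),
    Function.Bijective (fun a : Γ(Y, W) ↦ a • restrictSection L hWV e)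

/-- An invertible sheaf: a sheaf of modules that is locally free of rank one. -/
def IsInvertible {Y : Scheme.{u}} (L : Y.Modules) : Prop :=
  ∀ x : Y, ∃ (V : Y.Opens) (e : Γ(L, V)), x ∈ V ∧ IsLocalGenerator L e

/-- An isomorphism of the `m`-th tensor power of `L'` with `L`, for invertible sheaves.
The tensor power is the sheaf associated with the presheaf sending `U` to the `m`-th tensor power
of `Γ(L', U)` over `Γ(Y, U)`; hence a morphism from it to `L` is the same as a family of
multilinear maps that commutes with restriction, and it is an isomorphism as soon as the maps
`Γ(L', V)^{⊗ m} → Γ(L, V)` are bijective for all `V` in a basis of the topology (for an invertible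
sheaf `L'`, the small enough open sets, on which `L'` is trivial).
`mul U (s₁, …, s_m)` is the product `s₁ ⊗ ⋯ ⊗ s_m`, seen as a section of `L`. -/
structure TensorPowerIso {Y : Scheme.{u}} (m : ℕ) (L' L : Y.Modules) where
  mul : ∀ U : Y.Opens, MultilinearMap Γ(Y, U) (fun _ : Fin m ↦ Γ(L', U)) Γ(L, U)
  restrict_mul : ∀ (U V : Y.Opens) (hVU : V ≤ U) (s : Fin m → Γ(L', U)),
    restrictSection L hVU (mul U s) = mul V (fun i ↦ restrictSection L' hVU (s i))
  bijective : ∀ (U : Y.Opens) (x : Y), x ∈ U → ∃ V : Y.Opens, V ≤ U ∧ x ∈ V ∧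
    Function.Bijective (PiTensorProduct.lift (mul V))

/-- The power `h ^ m`, a global section of `L ≅ L'^{⊗ m}`. -/
def TensorPowerIso.pow {Y : Scheme.{u}} {m : ℕ} {L' L : Y.Modules} (T : TensorPowerIso m L' L)
    (h : Γ(L', ⊤)) : Γ(L, ⊤) :=
  T.mul ⊤ (fun _ ↦ h)

/-- The open set of points where the section `s` of an invertible sheaf does not vanish, i.e. the
largest open set on which `s` is a generator. -/
def nonvanishingLocus {Y : Scheme.{u}} (L : Y.Modules) (s : Γ(L, ⊤)) : Y.Opens :=
  sSup {V | IsLocalGenerator L (restrictSection L (le_top : V ≤ ⊤) s)}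

/-- An invertible sheaf `L` on a quasi-compact scheme is ample if every point has an affine
neighbourhood of the form `Y_s`, where `s` is a global section of some positive tensor power
of `L`. -/
def IsAmple {Y : Scheme.{u}} (L : Y.Modules) : Prop :=
  CompactSpace Y ∧ ∀ x : Y, ∃ (k : ℕ) (M : Y.Modules) (_ : TensorPowerIso k L M) (s : Γ(M, ⊤)),
    1 ≤ k ∧ x ∈ nonvanishingLocus M s ∧ IsAffineOpen (nonvanishingLocus M s)

/-! ### Projective space over the complex numbers -/

/-- The graded pieces of the polynomial ring `ℂ[x_0, …, x_N]`. -/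
abbrev grading (N : ℕ) : ℕ → Submodule ℂ (MvPolynomial (Fin (N + 1)) ℂ) :=
  MvPolynomial.homogeneousSubmodule (Fin (N + 1)) ℂ

instance gradingGraded (N : ℕ) : GradedAlgebra (grading N) := MvPolynomial.gradedAlgebra

/-- The projective space of dimension `N` over `ℂ`. -/
abbrev projSpace (N : ℕ) : Scheme.{0} := Proj (grading N)

/-- The structure morphism of projective space. -/
def projSpaceToSpec (N : ℕ) : projSpace N ⟶ Spec (CommRingCat.of ℂ) :=
  Proj.toSpecZero (grading N) ≫ Spec.map (CommRingCat.ofHom (algebraMap ℂ (grading N 0)))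

/-- The regular function `x_k / x_j` on the standard open set `x_j ≠ 0` of projective space. -/
def coordRatio (N : ℕ) (j k : Fin (N + 1)) :
    Γ(projSpace N, Proj.basicOpen (grading N) (MvPolynomial.X j)) :=
  Proj.awayToSection (grading N) (MvPolynomial.X j)
    (HomogeneousLocalization.Away.mk (grading N) (d := 1)
      (MvPolynomial.isHomogeneous_X ℂ j) 1 (MvPolynomial.X k)
      (by simpa using MvPolynomial.isHomogeneous_X ℂ k))

/-- `Y` is projective over `ℂ`. -/
def IsProjective {Y : Scheme.{0}} (p : Y ⟶ Spec (CommRingCat.of ℂ)) : Prop :=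
  ∃ (N : ℕ) (i : Y ⟶ projSpace N), IsClosedImmersion i ∧ i ≫ projSpaceToSpec N = p

/-- `L` is very ample: it is the pullback of `𝒪(1)` under an immersion `i` of `Y` into a projective
space. An isomorphism of `i^* 𝒪(1)` with `L` is given by the images `s_0, …, s_N` of the
coordinates `x_0, …, x_N`: over `i⁻¹ {x_j ≠ 0}` the section `s_j` is a generator and
`s_k = i^* (x_k / x_j) s_j` for all `k`. -/
def IsVeryAmple {Y : Scheme.{0}} (p : Y ⟶ Spec (CommRingCat.of ℂ)) (L : Y.Modules) : Prop :=
  ∃ (N : ℕ) (i : Y ⟶ projSpace N) (s : Fin (N + 1) → Γ(L, ⊤)),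
    IsImmersion i ∧ i ≫ projSpaceToSpec N = p ∧
    ∀ j : Fin (N + 1),
      IsLocalGenerator L (restrictSection L
        (le_top : i ⁻¹ᵁ Proj.basicOpen (grading N) (MvPolynomial.X j) ≤ ⊤) (s j)) ∧
      ∀ k : Fin (N + 1),
        restrictSection L
            (le_top : i ⁻¹ᵁ Proj.basicOpen (grading N) (MvPolynomial.X j) ≤ ⊤) (s k) =
          (i.app (Proj.basicOpen (grading N) (MvPolynomial.X j))).hom (coordRatio N j k) •
            restrictSection L
              (le_top : i ⁻¹ᵁ Proj.basicOpen (grading N) (MvPolynomial.X j) ≤ ⊤) (s j)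

/-! ### Zero schemes of sections -/

/-- The ideal sheaf with prescribed local equations: a function on `U` belongs to it if on every
affine open `W ≤ U` that has a local equation `a ∈ E W` it is a multiple of `a`. It is used for
families `E` such that every point has an affine neighbourhood with a local equation, the local
equations restrict to local equations, and any two of them on the same `W` are associated. -/
def ofLocalEquations {X : Scheme.{u}} (E : ∀ W : X.affineOpens, Set Γ(X, W)) : X.IdealSheafData :=
  Scheme.IdealSheafData.ofIdeals fun U ↦
    ⨅ (W : X.affineOpens) (hWU : (W : X.Opens) ≤ U) (a : Γ(X, W)) (_ : a ∈ E W),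
      (Ideal.span {a}).comap (restrictFun hWU)

/-- The ideal sheaf of the zero scheme `V_f` of a section `f` of an invertible sheaf `L`: if
`f = a e` with a generator `e` of `L`, then `a` is a local equation. -/
def zeroIdeal {Y : Scheme.{u}} {L : Y.Modules} (f : Γ(L, ⊤)) : Y.IdealSheafData :=
  ofLocalEquations fun W ↦ {a | ∃ e : Γ(L, (W : Y.Opens)),
    IsLocalGenerator L e ∧ restrictSection L le_top f = a • e}

/-- The product of `X` with the affine line. -/
abbrev timesLine (X : Scheme.{u}) : Scheme.{u} := AffineSpace PUnit.{u + 1} X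

/-- The projection from the product with the affine line. -/
def proj (X : Scheme.{u}) : timesLine X ⟶ X := timesLine X ↘ X

/-- The coordinate `s` of the affine line. -/
def lineCoord (X : Scheme.{u}) : Γ(timesLine X, ⊤) := AffineSpace.coord X PUnit.unit

/-- The embedding of `X` as `{s = 0}` in its product with the affine line. -/
def zeroSection (X : Scheme.{u}) : X ⟶ timesLine X :=
  AffineSpace.homOfVector (𝟙 X) (fun _ ↦ 0)

/-- The ideal sheaf of `V_{f + s g} = {f + s g = 0}` in the product of `Y` with the affine line
with coordinate `s`: if `f = a e` and `g = b e` with a generator `e` of `L` over `V`, then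
`a + s b` is a local equation over `V`. -/
def pencilIdeal {Y : Scheme.{u}} {L : Y.Modules} (f g : Γ(L, ⊤)) :
    (timesLine Y).IdealSheafData :=
  ofLocalEquations fun W ↦ {c | ∃ (V : Y.Opens) (hWV : (W : (timesLine Y).Opens) ≤ proj Y ⁻¹ᵁ V)
    (e : Γ(L, V)) (a b : Γ(Y, V)), IsLocalGenerator L e ∧
      restrictSection L le_top f = a • e ∧ restrictSection L le_top g = b • e ∧
      c = restrictFun hWV ((proj Y).app V a) +
        restrictFun le_top (lineCoord Y) * restrictFun hWV ((proj Y).app V b)}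

/-! ### Singular loci, transversal slices and ordinary multiple points -/

/-- The singular locus of the closed subscheme of `X` with ideal sheaf `I`, as a subset of `X`:
the points where the subscheme is not smooth over the base. -/
def singularLocus {X S : Scheme.{u}} (p : X ⟶ S) (I : X.IdealSheafData) : Set X :=
  {x | ∃ y : I.subscheme, I.subschemeι y = x ∧
    ¬ ((I.subschemeι ≫ p).stalkMap y).hom.FormallySmooth}

/-- The ideal sheaf of the reduced closed subscheme supported on (the closure of) `Z`. -/
def reducedIdeal {X : Scheme.{u}} (Z : Set X) : X.IdealSheafData :=
  Scheme.IdealSheafData.vanishingIdeal (Closeds.closure Z)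

/-- A curve: nonempty, and every irreducible component has dimension one. -/
def IsCurve {X : Scheme.{u}} (Z : Set X) : Prop :=
  Z.Nonempty ∧ ∀ T : Set Z, T ∈ irreducibleComponents Z → topologicalKrullDim T = 1

/-- The stalk at `x` of an ideal sheaf. -/
def stalkIdeal {X : Scheme.{u}} (I : X.IdealSheafData) (x : X) : Ideal (X.presheaf.stalk x) :=
  ⨆ (U : X.affineOpens) (hx : x ∈ (U : X.Opens)),
    (I.ideal U).map (X.presheaf.germ (U : X.Opens) x hx).hom

/-- The closed subschemes with ideal sheaves `I` and `J` intersect at `x` in the reduced point `x`,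
that is, their ideals at `x` generate the maximal ideal of the local ring. For a smooth curve and a
smooth hypersurface through a closed point of a smooth variety this is transversality (the tangent
spaces meet in `0`). -/
def MeetsTransversallyAt {X : Scheme.{u}} (I J : X.IdealSheafData) (x : X) : Prop :=
  IsLocalRing.maximalIdeal (X.presheaf.stalk x) = stalkIdeal I x ⊔ stalkIdeal J x

/-- The hypersurface germ with ideal `K` in the smooth germ with local ring `S` (having an
algebraically closed residue field) is an ordinary `m`-ple point: for a regular system of
parameters `x_1, …, x_d`, the ideal `K` is generated by `P(x_1, …, x_d)` with `P` a homogeneous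
polynomial of degree `m` over `S`, and the reduction of `P` to the residue field (the equation of
the tangent cone) is nonzero and defines a smooth hypersurface in projective space, that is, it has
no common zero with its partial derivatives other than the origin. -/
def IsOrdinaryMultiplePoint (m : ℕ) (S : Type u) [CommRing S] (K : Ideal S) : Prop :=
  ∃ (_ : IsRegularLocalRing S) (d : ℕ) (x : Fin d → S) (P : MvPolynomial (Fin d) S),
    ringKrullDim S = d ∧ Ideal.span (Set.range x) = IsLocalRing.maximalIdeal S ∧
    P.IsHomogeneous m ∧ K = Ideal.span {MvPolynomial.eval x P} ∧
    MvPolynomial.map (IsLocalRing.residue S) P ≠ 0 ∧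
    ∀ y : Fin d → IsLocalRing.ResidueField S, y ≠ 0 →
      MvPolynomial.eval y (MvPolynomial.map (IsLocalRing.residue S) P) = 0 →
      ∃ i : Fin d,
        MvPolynomial.eval y
          (MvPolynomial.pderiv i (MvPolynomial.map (IsLocalRing.residue S) P)) ≠ 0

/-- Let `V` be the hypersurface with ideal sheaf `I` in `X`. At the point `x` of `X`, the reduced
singular locus of `V` is a smooth curve, and the transversal slices of `V` are ordinary `m`-ple
points: for every smooth hypersurface germ `{t = 0}` of `X` at `x` that is transversal to this
curve, the intersection of `V` with `{t = 0}` is an ordinary `m`-ple point of `{t = 0}`. -/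
def HasOrdinarySlicesAt {X S : Scheme.{u}} (p : X ⟶ S) (I : X.IdealSheafData) (m : ℕ)
    (x : X) : Prop :=
  IsRegularLocalRing (X.presheaf.stalk x ⧸ stalkIdeal (reducedIdeal (singularLocus p I)) x) ∧
  ringKrullDim (X.presheaf.stalk x ⧸ stalkIdeal (reducedIdeal (singularLocus p I)) x) = 1 ∧
  ∀ t : X.presheaf.stalk x,
    IsLocalRing.maximalIdeal (X.presheaf.stalk x) =
      stalkIdeal (reducedIdeal (singularLocus p I)) x ⊔ Ideal.span {t} →
    IsOrdinaryMultiplePoint m (X.presheaf.stalk x ⧸ Ideal.span {t})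
      ((stalkIdeal I x).map (Ideal.Quotient.mk (Ideal.span {t})))

/-- The open subset `U` meets the singular locus of the hypersurface with ideal sheaf `I` in a
dense subset of it, and at all closed points of the singular locus lying in `U` the transversal
slices are ordinary `m`-ple points. -/
def OrdinarySlicesOn {X S : Scheme.{u}} (p : X ⟶ S) (I : X.IdealSheafData) (m : ℕ)
    (U : X.Opens) : Prop :=
  singularLocus p I ⊆ closure (singularLocus p I ∩ U) ∧
  ∀ x ∈ singularLocus p I ∩ U, IsClosed {x} → HasOrdinarySlicesAt p I m x

/-! ### Blow-ups and proper transforms -/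

/-- The ideal sheaf defines an effective Cartier divisor: it is locally generated by one
nonzerodivisor. -/
def IsEffectiveCartier {X : Scheme.{u}} (I : X.IdealSheafData) : Prop :=
  ∀ x : X, ∃ U : X.affineOpens, x ∈ (U : X.Opens) ∧
    ∃ a ∈ nonZeroDivisors Γ(X, U), I.ideal U = Ideal.span {a}

/-- `π` is the blow-up of `X` along the closed subscheme with ideal sheaf `I`: the inverse image
of the center is an effective Cartier divisor, and `π` is universal with this property. -/
def IsBlowup {X' X : Scheme.{u}} (π : X' ⟶ X) (I : X.IdealSheafData) : Prop :=
  IsEffectiveCartier (I.comap π) ∧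
  ∀ (W : Scheme.{u}) (q : W ⟶ X), IsEffectiveCartier (I.comap q) → ∃! r : W ⟶ X', r ≫ π = q

/-- The ideal sheaf of the proper transform, under `φ : X' ⟶ X`, of the closed subscheme `V` of `X`
with ideal sheaf `I`, with respect to the closed subset `Z` of `X` (the center): the
scheme-theoretic closure in `X'` of the part of the inverse image of `V` that lies outside the
inverse image of `Z`. -/
def properTransform {X' X : Scheme.{u}} (φ : X' ⟶ X) (Z : Set X) (I : X.IdealSheafData) :
    X'.IdealSheafData :=
  Scheme.Hom.ker
    (((I.comap φ).subschemeι ⁻¹ᵁ φ ⁻¹ᵁ (Closeds.closure Z).compl).ι ≫ (I.comap φ).subschemeι)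

/-- The intersection of `V_h` with the singular locus of `V_f`. -/
def center {Y S : Scheme.{u}} (p : Y ⟶ S) {L L' : Y.Modules} (f : Γ(L, ⊤)) (h : Γ(L', ⊤)) :
    Set Y :=
  (zeroIdeal h).support ∩ singularLocus p (zeroIdeal f)

/-- The ideal sheaf of the proper transform of `V_f` in `X'`, for `π : X' ⟶ Y` with center `Z`. -/
def fiberTransform {X' Y : Scheme.{u}} (π : X' ⟶ Y) (Z : Set Y) {L : Y.Modules}
    (f : Γ(L, ⊤)) : X'.IdealSheafData :=
  properTransform π Z (zeroIdeal f)

/-- The ideal sheaf of the proper transform of `V_{f + s g}` in the product of `X'` with the affine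
line, for `π : X' ⟶ Y` with center `Z`. -/
def pencilTransform {X' Y : Scheme.{u}} (π : X' ⟶ Y) (Z : Set Y) {L : Y.Modules}
    (f g : Γ(L, ⊤)) : (timesLine X').IdealSheafData :=
  properTransform (AffineSpace.map PUnit.{u + 1} π) (proj Y ⁻¹' Z) (pencilIdeal f g)

end

end PencilBlowup

open PencilBlowup

/-!
Write `C` for the singular curve of `V_f` and `Z = C ∩ V_h` for the center. The statement is local on
the blow-up `Y'`, so it is enough to find affine charts of `Y'` together with equations of the two
proper transforms. Off the exceptional divisor `π` is an isomorphism; there `f + s h ^ m` is smooth,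
by the Jacobian criterion: at a point outside `C` because `f` has nonzero differential or `h` does not
vanish, and at a point of `C` because `h` does not vanish, so that the derivative with respect to `s`
is a unit (`exists_equationChart_off_center`).

At a point `x` of `Z` the transversality hypothesis says that the ideal of `C` and the equation `z` of
`V_h` generate the maximal ideal. Hence there are étale coordinates `x_i, z` near `x` such that the
`x_i` generate the ideal of `C` (`exists_etale_coordinates`). Slicing by `z` and using that all the
transversal slices along `C` are ordinary `m`-ple points, one finds that `f = F(x)` for a form `F` of
degree `m` in the `x_i`, with coefficients in the ring of the chart, whose reduction at `x` defines a
smooth projective hypersurface (`exists_smoothForm`, `exists_center_chart`). The blow-up of `x` is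
covered by the charts in which one coordinate `c_k` divides all the others, `c_i = c_k w_i`
(`exists_blowupChart`, `exists_blowup_openImmersion`), and there

`f + s h ^ m = c_k ^ m (F(w) + s w_z ^ m)`.

In the chart of `z` we have `w_z = 1`, and the derivative with respect to `s` is a unit. In the chart
of some `x_k` one has `w_k = 1`, and on the exceptional divisor `F(w) + s w_z ^ m` is the sum of a
smooth form, taken at `w_k = 1`, and of `s w_z ^ m`. At a singular point `w_z` would vanish, hence so
would the form and its derivatives with respect to the other coordinates; by Euler's relation the
derivative with respect to the `k`-th coordinate would vanish too, and the form would not be smooth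
(`exists_transformChart`). So the transform of the pencil is smooth along the exceptional divisor.
Moreover `c_k` is a non-zero-divisor modulo `F(w)` and modulo `F(w) + s w_z ^ m`, so that these are the
equations of the proper transforms (`comap_properTransform`), and the second one reduces to the first
at `s = 0`.

The same computation shows that the transform of `V_f` can be singular on the exceptional divisor only
where all the `w_i` belonging to the `x_i` vanish, that is on the proper transform of `C`, which is the
closure of its part outside the exceptional divisor. There the slices are those of `V_f` itself
(`ordinarySlicesOn_fiberTransform`).
-/

namespace PencilBlowup

noncomputable section

/-! ### Derivations and quasi-regular systems -/

section

open MvPolynomial TensorProduct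

/-- Derivations extend uniquely along formally étale algebras; only existence is needed here. -/
theorem exists_derivation_extension (k S T : Type*) [CommRing k] [CommRing S] [CommRing T]
    [Algebra k S] [Algebra S T] [Algebra k T] [IsScalarTower k S T] [Algebra.FormallyEtale S T]
    (D : Derivation k S S) :
    ∃ D' : Derivation k T T, ∀ s, D' (algebraMap S T s) = algebraMap S T (D s) := by
  let ψ : Ω[S⁄k] →ₗ[S] T := (Algebra.linearMap S T).comp D.liftKaehlerDifferential
  let e := KaehlerDifferential.tensorKaehlerEquivOfFormallyEtale k S T
  refine ⟨((ψ.liftBaseChange T).comp e.symm.toLinearMap).compDer (KaehlerDifferential.D k T),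
    fun s ↦ ?_⟩
  simp [e, ψ, KaehlerDifferential.tensorKaehlerEquivOfFormallyEtale_symm_D_algebraMap]

/-- The chain rule for the value of a polynomial whose coefficients lie in the ring on which the
derivation acts; `G'` is obtained from `G` by applying the derivation to the coefficients. -/
theorem exists_derivation_eval {k R σ : Type*} [CommRing k] [CommRing R] [Algebra k R] [Fintype σ]
    (D : Derivation k R R) (y : σ → R) (G : MvPolynomial σ R) :
    ∃ G' : MvPolynomial σ R, (∀ α, G'.coeff α = D (G.coeff α)) ∧
      D (eval y G) = eval y G' + ∑ j, eval y (pderiv j G) * D (y j) := by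
  classical
  induction G using MvPolynomial.induction_on with
  | C a =>
    refine ⟨C (D a), fun α ↦ ?_, by simp⟩
    simp only [coeff_C]
    split_ifs <;> simp
  | add p q hp hq =>
    obtain ⟨p', hp1, hp2⟩ := hp
    obtain ⟨q', hq1, hq2⟩ := hq
    refine ⟨p' + q', fun α ↦ by simp [hp1, hq1], ?_⟩
    simp only [map_add, hp2, hq2, add_mul, Finset.sum_add_distrib]
    ring
  | mul_X p i hp =>
    obtain ⟨p', hp1, hp2⟩ := hp
    refine ⟨p' * X i, fun α ↦ ?_, ?_⟩
    · simp only [coeff_mul_X', hp1]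
      split_ifs <;> simp
    · have : ∑ j, eval y (pderiv j (p * X i)) * D (y j) =
          (∑ j, eval y (pderiv j p) * D (y j)) * y i + eval y p * D (y i) := by
        rw [Finset.sum_mul, ← Finset.sum_erase_add (a := i) _ _ (Finset.mem_univ i),
          ← Finset.sum_erase_add (a := i) (f := fun j ↦ eval y (pderiv j p) * D (y j) * y i) _
            (Finset.mem_univ i)]
        have : ∀ j ∈ Finset.univ.erase i, eval y (pderiv j (p * X i)) * D (y j) =
            eval y (pderiv j p) * D (y j) * y i := by
          intro j hj
          rw [pderiv_mul, pderiv_X_of_ne (Finset.ne_of_mem_erase hj).symm]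
          simp
          ring
        rw [Finset.sum_congr rfl this]
        simp
        ring
      rw [this]
      simp only [map_mul, eval_X, Derivation.leibniz, hp2, smul_eq_mul]
      ring

theorem isHomogeneous_of_coeff_eq {R σ : Type*} [CommRing R] {G G' : MvPolynomial σ R} {n : ℕ}
    {D : R → R} (hD : D 0 = 0) (h : ∀ α, G'.coeff α = D (G.coeff α)) (hG : G.IsHomogeneous n) :
    G'.IsHomogeneous n := by
  intro α hα
  refine hG (d := α) fun h0 ↦ hα ?_
  rw [h, h0, hD]

theorem eval_mem_pow_of_isHomogeneous {R σ : Type*} [CommRing R] {G : MvPolynomial σ R} {n : ℕ}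
    (hG : G.IsHomogeneous n) {y : σ → R} {I : Ideal R} (hy : ∀ i, y i ∈ I) :
    eval y G ∈ I ^ n := by
  refine Ideal.pow_right_mono (Ideal.span_le.mpr (Set.range_subset_iff.mpr hy)) n ?_
  exact (Ideal.mem_span_pow_iff_exists_isHomogeneous y _).mpr ⟨G, hG, rfl⟩

theorem eval_mem_of_coeff_mem {R σ : Type*} [CommRing R] {G : MvPolynomial σ R} {I : Ideal R}
    (hG : ∀ α, G.coeff α ∈ I) (y : σ → R) : eval y G ∈ I := by
  rw [eval_eq]
  exact Ideal.sum_mem _ fun α _ ↦ I.mul_mem_right _ (hG α)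

/-- A derivation lowers the order of vanishing by at most one. -/
theorem derivation_mem_pow {k R : Type*} [CommRing k] [CommRing R] [Algebra k R]
    (D : Derivation k R R) (I : Ideal R) (n : ℕ) {a : R} (ha : a ∈ I ^ (n + 1)) :
    D a ∈ I ^ n := by
  induction n generalizing a with
  | zero => simp
  | succ n ih =>
    rw [pow_succ] at ha
    refine Submodule.mul_induction_on ha (fun b hb c hc ↦ ?_) fun b c hb hc ↦ ?_
    · rw [Derivation.leibniz, smul_eq_mul, smul_eq_mul]
      refine add_mem (Ideal.mul_mem_right _ _ hb) ?_
      rw [pow_succ, mul_comm]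
      exact Ideal.mul_mem_mul hc (ih hb)
    · rw [map_add]
      exact add_mem hb hc

/-- Elements `y` with dual derivations in characteristic zero are quasi-regular: a form of degree
`n` in `y` can lie in the `(n + 1)`-st power of an ideal containing `y` only if all its coefficients
lie in that ideal. The ideal `N` allows to work modulo equations killed by the derivations. -/
theorem coeff_mem_of_eval_mem {k R σ : Type*} [Field k] [CharZero k] [CommRing R] [Algebra k R]
    [Fintype σ] [DecidableEq σ] (y : σ → R) (D : σ → Derivation k R R)
    (hD : ∀ i j, D i (y j) = if i = j then 1 else 0) (I N : Ideal R)
    (hN : ∀ i, ∀ t ∈ N, D i t ∈ N) (hNI : N ≤ I) (hy : ∀ i, y i ∈ I) (n : ℕ)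
    (G : MvPolynomial σ R) (hG : G.IsHomogeneous n) (h : eval y G ∈ I ^ (n + 1) ⊔ N)
    (α : σ →₀ ℕ) : G.coeff α ∈ I := by
  induction n generalizing G α with
  | zero =>
    rw [zero_add, pow_one, sup_eq_left.mpr hNI] at h
    have h0 := totalDegree_eq_zero_iff_eq_C.mp (Nat.le_zero.mp hG.totalDegree_le)
    rw [h0, eval_C] at h
    rw [h0, coeff_C]
    split_ifs
    exacts [h, zero_mem _]
  | succ n ih =>
    by_cases hα : α = 0
    · subst hα
      rw [hG.coeff_eq_zero (by simp)]
      exact zero_mem _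
    obtain ⟨i, hi⟩ : ∃ i, α i ≠ 0 := by
      by_contra! h0
      exact hα (Finsupp.ext h0)
    have key : eval y (pderiv i G) ∈ I ^ (n + 1) ⊔ N := by
      obtain ⟨G', hG', e⟩ := exists_derivation_eval (D i) y G
      have e' : eval y (pderiv i G) = D i (eval y G) - eval y G' := by
        rw [e]
        simp [hD]
      rw [e']
      refine sub_mem ?_ ?_
      · obtain ⟨u, hu, v, hv, huv⟩ := Submodule.mem_sup.mp h
        rw [← huv, map_add]
        exact Submodule.add_mem_sup (derivation_mem_pow _ _ _ hu) (hN i v hv)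
      · refine Ideal.mem_sup_left ?_
        exact eval_mem_pow_of_isHomogeneous
          (isHomogeneous_of_coeff_eq (D := D i) (map_zero _) hG' hG) hy
    have h1 := ih (pderiv i G) (by simpa using hG.pderiv) key (α - Finsupp.single i 1)
    have hle : Finsupp.single i 1 ≤ α := by
      rw [Finsupp.single_le_iff]
      omega
    rw [coeff_pderiv, tsub_add_cancel_of_le hle] at h1
    have hu : IsUnit (((α - Finsupp.single i 1 : σ →₀ ℕ) i : R) + 1) := by
      have : (((α - Finsupp.single i 1 : σ →₀ ℕ) i : R) + 1) =
          algebraMap k R (((α - Finsupp.single i 1 : σ →₀ ℕ) i : k) + 1) := by simp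
      rw [this]
      exact (IsUnit.mk0 _ (Nat.cast_add_one_ne_zero _)).map _
    exact (Ideal.mul_unit_mem_iff_mem I hu).mp h1

/-! ### The Jacobian criterion for a hypersurface, in terms of derivations -/

/-- If some derivation sends `a` to a unit modulo `a`, then the quotient by `a` is formally smooth:
the derivation splits the conormal sequence. -/
theorem formallySmooth_quotient_span_singleton {k B : Type*} [CommRing k] [CommRing B]
    [Algebra k B] [Algebra.FormallySmooth k B] (a : B) (D : Derivation k B B)
    (h : D a - 1 ∈ Ideal.span {a}) : Algebra.FormallySmooth k (B ⧸ Ideal.span {a}) := by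
  have hsurj : Function.Surjective (algebraMap B (B ⧸ Ideal.span {a})) := Ideal.Quotient.mk_surjective
  have hmem : ∀ x, x ∈ RingHom.ker (algebraMap B (B ⧸ Ideal.span {a})) ↔ x ∈ Ideal.span {a} :=
    fun x ↦ by rw [RingHom.mem_ker]; exact Ideal.Quotient.eq_zero_iff_mem
  have ha : a ∈ RingHom.ker (algebraMap B (B ⧸ Ideal.span {a})) :=
    (hmem a).mpr (Ideal.mem_span_singleton_self a)
  rw [Algebra.FormallySmooth.iff_split_injection (P := B) hsurj]
  set I := RingHom.ker (algebraMap B (B ⧸ Ideal.span {a})) with hI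
  have hkill : ∀ c ∈ Ideal.span {a}, c • I.toCotangent ⟨a, ha⟩ = 0 := by
    intro c hc
    rw [← map_smul, Ideal.toCotangent_eq_zero, pow_two]
    exact Ideal.mul_mem_mul ((hmem c).mpr hc) ha
  let ψ : (B ⧸ Ideal.span {a}) →ₗ[B] I.Cotangent :=
    Submodule.liftQ (Ideal.span {a}) (LinearMap.toSpanSingleton B _ (I.toCotangent ⟨a, ha⟩))
      fun c hc ↦ by simpa using hkill c hc
  let χ : Ω[B⁄k] →ₗ[B] (B ⧸ Ideal.span {a}) :=
    (Algebra.linearMap B (B ⧸ Ideal.span {a})).comp D.liftKaehlerDifferential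
  refine ⟨ψ.comp ((χ.liftBaseChange (B ⧸ Ideal.span {a})).restrictScalars B), ?_⟩
  ext x
  obtain ⟨⟨x, hx⟩, rfl⟩ := Ideal.toCotangent_surjective _ x
  obtain ⟨b, rfl⟩ := Ideal.mem_span_singleton'.mp ((hmem x).mp hx)
  have e1 : ψ (Ideal.Quotient.mk _ (D (b * a))) = D (b * a) • I.toCotangent ⟨a, ha⟩ := rfl
  have e2 : I.toCotangent ⟨b * a, hx⟩ = b • I.toCotangent ⟨a, ha⟩ := by
    rw [← map_smul]; rfl
  change ψ (χ.liftBaseChange (B ⧸ Ideal.span {a}) (1 ⊗ₜ KaehlerDifferential.D k B (b * a))) = _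
  rw [LinearMap.liftBaseChange_tmul, one_smul]
  have e3 : χ (KaehlerDifferential.D k B (b * a)) = Ideal.Quotient.mk _ (D (b * a)) := by
    simp only [χ, LinearMap.comp_apply, Derivation.liftKaehlerDifferential_comp_D]
    rfl
  refine (congrArg ψ e3).trans (e1.trans ?_)
  change _ = I.toCotangent ⟨b * a, hx⟩
  rw [e2]
  rw [← sub_eq_zero, ← sub_smul]
  refine hkill _ ?_
  have : D (b * a) - b = b * (D a - 1) + D b * a := by
    rw [Derivation.leibniz]; simp; ring
  rw [this]
  exact add_mem (Ideal.mul_mem_left _ _ h) (Ideal.mul_mem_left _ _ (Ideal.mem_span_singleton_self a))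

/-- Conversely, if the quotient by a nonzerodivisor `a` is formally smooth, then some derivation
sends `a` to a unit modulo `a`. -/
theorem exists_derivation_of_formallySmooth {k B : Type*} [CommRing k] [CommRing B]
    [Algebra k B] [Algebra.FormallySmooth k B] (a : B) (hreg : a ∈ nonZeroDivisors B)
    (h : Algebra.FormallySmooth k (B ⧸ Ideal.span {a})) :
    ∃ D : Derivation k B B, D a - 1 ∈ Ideal.span {a} := by
  have hsurj : Function.Surjective (algebraMap B (B ⧸ Ideal.span {a})) := Ideal.Quotient.mk_surjective
  have hmem : ∀ x, x ∈ RingHom.ker (algebraMap B (B ⧸ Ideal.span {a})) ↔ x ∈ Ideal.span {a} :=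
    fun x ↦ by rw [RingHom.mem_ker]; exact Ideal.Quotient.eq_zero_iff_mem
  have ha : a ∈ RingHom.ker (algebraMap B (B ⧸ Ideal.span {a})) :=
    (hmem a).mpr (Ideal.mem_span_singleton_self a)
  let I := RingHom.ker (algebraMap B (B ⧸ Ideal.span {a}))
  obtain ⟨l, hl⟩ : ∃ l : TensorProduct B (B ⧸ Ideal.span {a}) (Ω[B⁄k]) →ₗ[B] I.Cotangent, _ :=
    (Algebra.FormallySmooth.iff_split_injection (P := B) hsurj).mp h
  have hIspan : I = Ideal.span {a} := Ideal.ext hmem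
  let ψ : B →ₗ[B] I.Cotangent := LinearMap.toSpanSingleton B _ (I.toCotangent ⟨a, ha⟩)
  have hψ : Function.Surjective ψ := by
    intro x
    obtain ⟨⟨x, hx⟩, rfl⟩ := Ideal.toCotangent_surjective _ x
    obtain ⟨b, rfl⟩ := Ideal.mem_span_singleton'.mp ((hmem x).mp hx)
    refine ⟨b, ?_⟩
    simp only [ψ, LinearMap.toSpanSingleton_apply]
    rw [← map_smul]; rfl
  let χ : Ω[B⁄k] →ₗ[B] I.Cotangent :=
    l.comp (TensorProduct.mk B (B ⧸ Ideal.span {a}) (Ω[B⁄k]) 1)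
  obtain ⟨E, hE⟩ := Module.projective_lifting_property ψ χ hψ
  refine ⟨E.compDer (KaehlerDifferential.D k B), ?_⟩
  have e1 : ψ (E (KaehlerDifferential.D k B a)) = I.toCotangent ⟨a, ha⟩ := by
    have := LinearMap.congr_fun hE (KaehlerDifferential.D k B a)
    rw [LinearMap.comp_apply] at this
    rw [this]
    exact LinearMap.congr_fun hl (I.toCotangent ⟨a, ha⟩)
  have e2 : (E (KaehlerDifferential.D k B a) - 1) • I.toCotangent ⟨a, ha⟩ = 0 := by
    rw [sub_smul, one_smul, sub_eq_zero]
    exact e1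
  rw [← map_smul, Ideal.toCotangent_eq_zero] at e2
  replace e2 : (E (KaehlerDifferential.D k B a) - 1) * a ∈ I ^ 2 := e2
  rw [hIspan, Ideal.span_singleton_pow, Ideal.mem_span_singleton'] at e2
  obtain ⟨c, hc⟩ := e2
  refine Ideal.mem_span_singleton'.mpr ⟨c, ?_⟩
  refine (mul_cancel_right_mem_nonZeroDivisors hreg).mp ?_
  rw [mul_assoc, ← pow_two, hc]
  rfl

end

/-! ### Smooth forms -/

section

open MvPolynomial

/-- A nonzero form without common zeros with its partial derivatives other than the origin; for a
homogeneous polynomial this says that it defines a smooth hypersurface in projective space. -/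
def IsSmoothForm {K σ : Type*} [CommRing K] (P : MvPolynomial σ K) : Prop :=
  P ≠ 0 ∧ ∀ v : σ → K, v ≠ 0 → eval v P = 0 → ∃ i, eval v (pderiv i P) ≠ 0

theorem IsSmoothForm.map_ringEquiv {K L σ : Type*} [CommRing K] [CommRing L]
    {P : MvPolynomial σ K} (hP : IsSmoothForm P) (e : K ≃+* L) :
    IsSmoothForm (MvPolynomial.map (e : K →+* L) P) := by
  refine ⟨fun h ↦ hP.1 (MvPolynomial.map_injective _ e.injective (by simpa using h)), ?_⟩
  intro v hv h
  have key : ∀ Q : MvPolynomial σ K, eval v (MvPolynomial.map (e : K →+* L) Q) =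
      e (eval (fun i ↦ e.symm (v i)) Q) := by
    intro Q
    rw [MvPolynomial.eval_map, ← RingEquiv.coe_toRingHom e, ← coe_eval₂Hom]
    change _ = ((e : K →+* L).comp (eval fun i ↦ e.symm (v i))) Q
    congr 1
    ext <;> simp
  obtain ⟨i, hi⟩ := hP.2 (fun i ↦ e.symm (v i))
    (fun h0 ↦ hv (funext fun i ↦ by simpa using congrFun h0 i)) (by simpa [key] using h)
  refine ⟨i, ?_⟩
  rw [pderiv_map, key]
  simpa using hi

/-- Substitution of linear forms, with coefficient matrix `a`, into a polynomial. -/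
def linearSubst {R σ τ : Type*} [CommRing R] [Fintype τ] (a : Matrix σ τ R) :
    MvPolynomial σ R →ₐ[R] MvPolynomial τ R :=
  aeval fun i ↦ ∑ j, C (a i j) * X j

theorem eval_linearSubst {R σ τ : Type*} [CommRing R] [Fintype τ] (a : Matrix σ τ R)
    (P : MvPolynomial σ R) (v : τ → R) :
    eval v (linearSubst a P) = eval (a.mulVec v) P := by
  change ((eval v).comp (linearSubst a).toRingHom) P = _
  congr 1
  ext <;> simp [linearSubst, Matrix.mulVec, dotProduct]

theorem isHomogeneous_linearSubst {R σ τ : Type*} [CommRing R] [Fintype τ] (a : Matrix σ τ R)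
    {P : MvPolynomial σ R} {n : ℕ} (hP : P.IsHomogeneous n) :
    (linearSubst a P).IsHomogeneous n := by
  have := hP.aeval (fun i ↦ ∑ j, C (a i j) * X j)
    (fun i ↦ IsHomogeneous.sum _ _ _ fun j _ ↦ (isHomogeneous_X R j).C_mul _)
  simpa [linearSubst] using this

theorem map_linearSubst {R S σ τ : Type*} [CommRing R] [CommRing S] [Fintype τ] (a : Matrix σ τ R)
    (φ : R →+* S) (P : MvPolynomial σ R) :
    MvPolynomial.map φ (linearSubst a P) = linearSubst (a.map φ) (MvPolynomial.map φ P) := by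
  change ((MvPolynomial.map φ).comp (linearSubst a).toRingHom) P =
    ((linearSubst (a.map φ)).toRingHom.comp (MvPolynomial.map φ)) P
  congr 1
  ext <;> simp [linearSubst]

theorem linearSubst_linearSubst_of_mul_eq_one {R σ τ : Type*} [CommRing R] [Fintype σ] [Fintype τ]
    [DecidableEq σ] (a : Matrix σ τ R) (b : Matrix τ σ R) (h : a * b = 1) (P : MvPolynomial σ R) :
    linearSubst b (linearSubst a P) = P := by
  change ((linearSubst b).comp (linearSubst a)) P = AlgHom.id R _ P
  congr 1
  ext1 i
  have : ∑ j, C (a i j) * ∑ l, C (b j l) * X l = (X i : MvPolynomial σ R) := by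
    simp_rw [Finset.mul_sum]
    rw [Finset.sum_comm]
    have h2 : ∀ l, ∑ j, C (a i j) * (C (b j l) * X l) =
        (C ((a * b) i l) * X l : MvPolynomial σ R) := by
      intro l
      simp [Matrix.mul_apply, Finset.sum_mul, mul_assoc]
    simp_rw [h2, h]
    simp [Matrix.one_apply]
  simpa [linearSubst] using this

theorem eval_pderiv_linearSubst {R σ τ : Type*} [CommRing R] [Fintype σ] [Fintype τ]
    (a : Matrix σ τ R) (P : MvPolynomial σ R) (v : τ → R) (j : τ) :
    eval v (pderiv j (linearSubst a P)) = ∑ i, eval (a.mulVec v) (pderiv i P) * a i j := by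
  classical
  induction P using MvPolynomial.induction_on with
  | C r => simp [linearSubst]
  | add p q hp hq => simp [hp, hq, add_mul, Finset.sum_add_distrib]
  | mul_X p i hp =>
    rw [map_mul, pderiv_mul, map_add, map_mul, map_mul, hp, eval_linearSubst, eval_linearSubst]
    have e1 : eval v (pderiv j (linearSubst a (X i))) = a i j := by
      simp [linearSubst, pderiv_X, Pi.single_apply]
    simp only [eval_X, e1]
    simp only [pderiv_mul, map_add, map_mul, eval_X, pderiv_X, add_mul, Finset.sum_add_distrib]
    rw [Finset.sum_mul]
    congr 1
    · exact Finset.sum_congr rfl fun l _ ↦ by ring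
    · rw [Finset.sum_eq_single i]
      · simp
      · intro l _ hl
        simp [hl.symm]
      · simp

theorem IsSmoothForm.linearSubst {K σ τ : Type*} [Field K] [Fintype σ] [Fintype τ] [DecidableEq σ]
    [DecidableEq τ] {P : MvPolynomial σ K} (hP : IsSmoothForm P) (a : Matrix σ τ K)
    (b : Matrix τ σ K) (hab : a * b = 1) (hba : b * a = 1) {u : K} (hu : u ≠ 0) :
    IsSmoothForm (C u * PencilBlowup.linearSubst a P) := by
  refine ⟨fun h ↦ ?_, fun v hv h ↦ ?_⟩
  · have h1 : PencilBlowup.linearSubst a P = 0 := by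
      rcases mul_eq_zero.mp h with h0 | h0
      · exact absurd (C_eq_zero.mp h0) hu
      · exact h0
    apply hP.1
    rw [← linearSubst_linearSubst_of_mul_eq_one a b hab P, h1, map_zero]
  · have h1 : eval (a.mulVec v) P = 0 := by
      rw [map_mul, eval_C, eval_linearSubst] at h
      exact (mul_eq_zero.mp h).resolve_left hu
    have h2 : a.mulVec v ≠ 0 := by
      intro h0
      apply hv
      have : b.mulVec (a.mulVec v) = v := by rw [Matrix.mulVec_mulVec, hba, Matrix.one_mulVec]
      rw [← this, h0, Matrix.mulVec_zero]
    obtain ⟨i, hi⟩ := hP.2 _ h2 h1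
    by_contra! hcon
    apply hi
    have h3 : Matrix.vecMul (fun l ↦ eval (a.mulVec v) (pderiv l P)) a = 0 := by
      funext j
      have := hcon j
      rw [pderiv_C_mul, map_mul, eval_C, eval_pderiv_linearSubst] at this
      exact (mul_eq_zero.mp this).resolve_left hu
    have h4 : (fun l ↦ eval (a.mulVec v) (pderiv l P)) = 0 := by
      rw [← Matrix.vecMul_one (fun l ↦ eval (a.mulVec v) (pderiv l P)), ← hab,
        ← Matrix.vecMul_vecMul, h3, Matrix.zero_vecMul]
    exact congrFun h4 i

/-- By the Nullstellensatz, a common zero of a smooth form and its derivatives in any domain over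
the algebraically closed base field is the origin. -/
theorem IsSmoothForm.eq_zero_of_eval₂_eq_zero {K L σ : Type*} [Field K] [IsAlgClosed K]
    [CommRing L] [IsDomain L] [Finite σ] {P : MvPolynomial σ K} (hP : IsSmoothForm P) (η : K →+* L)
    (w : σ → L) (h0 : eval₂ η w P = 0) (h1 : ∀ i, eval₂ η w (pderiv i P) = 0) (i : σ) :
    w i = 0 := by
  let I : Ideal (MvPolynomial σ K) := Ideal.span (insert P (Set.range fun i ↦ pderiv i P))
  have hI : I ≤ RingHom.ker (eval₂Hom η w) := by
    rw [Ideal.span_le]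
    rintro _ (rfl | ⟨i, rfl⟩)
    exacts [h0, h1 i]
  have hX : (X i : MvPolynomial σ K) ∈ I.radical := by
    rw [← vanishingIdeal_zeroLocus_eq_radical (K := K)]
    intro v hv
    have hv' : ∀ Q ∈ I, eval v Q = 0 := fun Q hQ ↦ by simpa using hv Q hQ
    have : v = 0 := by
      by_contra hne
      obtain ⟨j, hj⟩ := hP.2 v hne (hv' _ (Ideal.subset_span (Set.mem_insert _ _)))
      exact hj (hv' _ (Ideal.subset_span (Set.mem_insert_of_mem _ ⟨j, rfl⟩)))
    simp [this]
  obtain ⟨n, hn⟩ := hX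
  have := hI hn
  rw [RingHom.mem_ker, map_pow] at this
  simpa using eq_zero_of_pow_eq_zero this

theorem eval_mul_of_isHomogeneous {R σ : Type*} [CommRing R] {P : MvPolynomial σ R} {n : ℕ}
    (hP : P.IsHomogeneous n) (c : R) (v : σ → R) :
    eval (fun i ↦ c * v i) P = c ^ n * eval v P := by
  rw [eval_eq, eval_eq, Finset.mul_sum]
  refine Finset.sum_congr rfl fun α hα ↦ ?_
  have : ∏ i ∈ α.support, c ^ α i = c ^ n := by
    rw [Finset.prod_pow_eq_pow_sum, ← hP (mem_support_iff.mp hα)]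
    exact congrArg _ (DFunLike.congr_fun Finsupp.degree_eq_weight_one α)
  simp only [mul_pow, Finset.prod_mul_distrib, this]
  ring

/-- A nonzero form does not vanish identically on the affine chart `v k = 1`. -/
theorem exists_eval_ne_zero_of_isHomogeneous {K σ : Type*} [Field K] [Infinite K]
    {P : MvPolynomial σ K} {n : ℕ} (hP : P.IsHomogeneous n) (h0 : P ≠ 0) (k : σ) :
    ∃ v : σ → K, v k = 1 ∧ eval v P ≠ 0 := by
  have : P * X k ≠ 0 := mul_ne_zero h0 (X_ne_zero k)
  obtain ⟨v, hv⟩ : ∃ v, eval v (P * X k) ≠ 0 := by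
    by_contra! h
    exact this (MvPolynomial.funext fun v ↦ by simpa using h v)
  rw [map_mul, eval_X] at hv
  have hk : v k ≠ 0 := right_ne_zero_of_mul hv
  refine ⟨fun i ↦ (v k)⁻¹ * v i, inv_mul_cancel₀ hk, ?_⟩
  rw [eval_mul_of_isHomogeneous hP]
  exact mul_ne_zero (pow_ne_zero _ (inv_ne_zero hk)) (left_ne_zero_of_mul hv)

/-- If `y` is a quasi-regular system of generators of the maximal ideal and the equation `F(y)`
defines an ordinary multiple point, then the tangent cone read off from `F` is smooth: the form
does not depend on the system of parameters, up to a linear change of coordinates. -/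
theorem isSmoothForm_of_isOrdinaryMultiplePoint {S ι : Type*} [CommRing S] [IsLocalRing S]
    [Fintype ι] [DecidableEq ι] (y : ι → S)
    (hy : Ideal.span (Set.range y) = IsLocalRing.maximalIdeal S)
    (hqr : ∀ (n : ℕ) (G : MvPolynomial ι S), G.IsHomogeneous n → eval y G = 0 →
      MvPolynomial.map (IsLocalRing.residue S) G = 0)
    (m : ℕ) (F : MvPolynomial ι S) (hF : F.IsHomogeneous m)
    (h : IsOrdinaryMultiplePoint m S (Ideal.span {eval y F})) :
    IsSmoothForm (MvPolynomial.map (IsLocalRing.residue S) F) := by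
  classical
  obtain ⟨hreg, d, x, P, hd, hx, hP, hK, hP0, hPs⟩ := h
  set φ := IsLocalRing.residue S with hφ
  have hxmem : ∀ j, x j ∈ Ideal.span (Set.range y) := fun j ↦ by
    rw [hy, ← hx]; exact Ideal.subset_span ⟨j, rfl⟩
  have hymem : ∀ i, y i ∈ Ideal.span (Set.range x) := fun i ↦ by
    rw [hx, ← hy]; exact Ideal.subset_span ⟨i, rfl⟩
  obtain ⟨A, hax⟩ : ∃ A : Matrix (Fin d) ι S, A.mulVec y = x := by
    choose a ha using fun j ↦ (Submodule.mem_span_range_iff_exists_fun S).mp (hxmem j)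
    exact ⟨Matrix.of a, funext fun j ↦ by simpa [Matrix.mulVec, dotProduct] using ha j⟩
  obtain ⟨B, hbx⟩ : ∃ B : Matrix ι (Fin d) S, B.mulVec x = y := by
    choose b hb using fun i ↦ (Submodule.mem_span_range_iff_exists_fun S).mp (hymem i)
    exact ⟨Matrix.of b, funext fun i ↦ by simpa [Matrix.mulVec, dotProduct] using hb i⟩
  -- quasi-regularity in degree one: the transition matrices are inverse to each other over the
  -- residue field
  have hBA : B.map φ * A.map φ = 1 := by
    obtain ⟨M, hM⟩ : ∃ M : Matrix ι ι S, M = B * A - 1 := ⟨_, rfl⟩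
    have hMy : M.mulVec y = 0 := by
      rw [hM, Matrix.sub_mulVec, ← Matrix.mulVec_mulVec, hax, hbx, Matrix.one_mulVec, sub_self]
    have hM0 : M.map φ = 0 := by
      ext i l
      have h1 : (∑ l, C (M i l) * X l : MvPolynomial ι S).IsHomogeneous 1 :=
        IsHomogeneous.sum _ _ _ fun l _ ↦ (isHomogeneous_X S l).C_mul _
      have h2 : eval y (∑ l, C (M i l) * X l : MvPolynomial ι S) = 0 := by
        simpa [Matrix.mulVec, dotProduct] using congrFun hMy i
      have h3 := congrArg (fun Q ↦ eval (Pi.single l 1) Q) (hqr 1 _ h1 h2)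
      simp only [map_sum, map_mul, map_C, map_X, eval_C, eval_X, map_zero] at h3
      rw [Finset.sum_eq_single l (fun j _ hj ↦ by rw [Pi.single_eq_of_ne hj, mul_zero])
        (by simp), Pi.single_eq_same, mul_one] at h3
      exact h3
    have h4 : B * A = M + 1 := by rw [hM, sub_add_cancel]
    rw [← Matrix.map_mul, h4, Matrix.map_add _ (map_add φ), hM0, zero_add,
      Matrix.map_one _ (map_zero φ) (map_one φ)]
  have hcard : Fintype.card ι = d := by
    refine le_antisymm ?_ ?_
    · have hinj : Function.Injective (Matrix.toLin' (A.map φ)) := by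
        refine Function.LeftInverse.injective (g := Matrix.toLin' (B.map φ)) fun v ↦ ?_
        rw [← Matrix.toLin'_mul_apply, hBA, Matrix.toLin'_one, LinearMap.id_apply]
      simpa using LinearMap.finrank_le_finrank_of_injective hinj
    · have h1 := ringKrullDim_le_spanFinrank_maximalIdeal S
      rw [hd, ← hy] at h1
      have h2 := Submodule.spanFinrank_span_le_ncard_of_finite (R := S) (Set.finite_range y)
      have h3 : (Set.range y).ncard ≤ Fintype.card ι := by
        rw [← Set.image_univ, ← Nat.card_eq_fintype_card, ← Set.ncard_univ]
        exact Set.ncard_image_le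
      exact (Nat.cast_le.mp h1).trans (h2.trans h3)
  have hAB : A.map φ * B.map φ = 1 :=
    (Matrix.mul_eq_one_comm_of_card_eq _ _ _ (by simpa using hcard)).mp hBA
  have hQ := isHomogeneous_linearSubst A hP
  have hQy : eval y (linearSubst A P) = eval x P := by rw [eval_linearSubst, hax]
  obtain ⟨u, hu⟩ : ∃ u, u * eval x P = eval y F := Ideal.mem_span_singleton'.mp <| by
    rw [← hK]; exact Ideal.mem_span_singleton_self _
  obtain ⟨v, hv⟩ : ∃ v, v * eval y F = eval x P := Ideal.mem_span_singleton'.mp <| by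
    rw [hK]; exact Ideal.mem_span_singleton_self _
  have hu0 : φ u ≠ 0 := by
    intro h0
    have hunit : IsUnit (1 - v * u) := by
      refine (IsLocalRing.notMem_maximalIdeal).mp fun hmem ↦ ?_
      have h1 : φ (1 - v * u) = 0 := (IsLocalRing.residue_eq_zero_iff _).mpr hmem
      simp [h0] at h1
    have h1 : eval x P = 0 := by
      have : (1 - v * u) * eval x P = 0 := by
        linear_combination (-v) * hu - hv
      exact (hunit.mul_right_eq_zero).mp this
    have h2 := hqr m _ hQ (by rw [hQy, h1])
    rw [map_linearSubst] at h2
    apply hP0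
    rw [← linearSubst_linearSubst_of_mul_eq_one _ _ hAB (MvPolynomial.map φ P), h2, map_zero]
  have hFQ : MvPolynomial.map φ F = C (φ u) * linearSubst (A.map φ) (MvPolynomial.map φ P) := by
    have h1 := hqr m (F - C u * linearSubst A P) (hF.sub (hQ.C_mul u)) (by
      rw [map_sub, map_mul, eval_C, hQy, hu, sub_self])
    rw [map_sub, map_mul, map_C, map_linearSubst, sub_eq_zero] at h1
    exact h1
  rw [hFQ]
  exact IsSmoothForm.linearSubst ⟨hP0, hPs⟩ _ _ hAB hBA hu0

theorem exists_isHomogeneous_map_eq {R S σ : Type*} [CommRing R] [CommRing S] (φ : R →+* S)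
    (hφ : Function.Surjective φ) {n : ℕ} (P : MvPolynomial σ S) (hP : P.IsHomogeneous n) :
    ∃ Q : MvPolynomial σ R, Q.IsHomogeneous n ∧ MvPolynomial.map φ Q = P := by
  choose ψ hψ using hφ
  refine ⟨∑ α ∈ P.support, monomial α (ψ (P.coeff α)), ?_, ?_⟩
  · refine IsHomogeneous.sum _ _ _ fun α hα ↦ isHomogeneous_monomial _ ?_
    rw [← hP (mem_support_iff.mp hα)]
    exact DFunLike.congr_fun Finsupp.degree_eq_weight_one α
  · rw [map_sum]
    simp only [map_monomial, hψ]
    exact P.support_sum_monomial_coeff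

/-- The leading form of a hypersurface germ whose slice `{t = 0}` is an ordinary multiple point,
when the hypersurface is given by a form `F` in coordinates `y` of the slice that admit dual
derivations killing `t`. -/
theorem isSmoothForm_of_slice {k R K ι : Type*} [Field k] [CharZero k] [CommRing R] [IsLocalRing R]
    [Algebra k R] [Field K] [Fintype ι] [DecidableEq ι] (y : ι → R) (t : R)
    (D : ι → Derivation k R R) (hD : ∀ i j, D i (y j) = if i = j then 1 else 0)
    (hDt : ∀ i, D i t = 0)
    (hmax : IsLocalRing.maximalIdeal R = Ideal.span (Set.range y) ⊔ Ideal.span {t})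
    (θ : R →+* K) (hθ : Function.Surjective θ)
    (m : ℕ) (F : MvPolynomial ι R) (hF : F.IsHomogeneous m)
    (h : IsOrdinaryMultiplePoint m (R ⧸ Ideal.span {t})
      ((Ideal.span {eval y F}).map (Ideal.Quotient.mk (Ideal.span {t})))) :
    IsSmoothForm (MvPolynomial.map θ F) := by
  classical
  have hkerθ : RingHom.ker θ = IsLocalRing.maximalIdeal R :=
    IsLocalRing.eq_maximalIdeal (RingHom.ker_isMaximal_of_surjective θ hθ)
  set π := Ideal.Quotient.mk (Ideal.span {t}) with hπ
  have hπs : Function.Surjective π := Ideal.Quotient.mk_surjective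
  have htmem : t ∈ IsLocalRing.maximalIdeal R := by
    rw [hmax]; exact Ideal.mem_sup_right (Ideal.mem_span_singleton_self t)
  have hymem : ∀ i, y i ∈ IsLocalRing.maximalIdeal R := fun i ↦ by
    rw [hmax]; exact Ideal.mem_sup_left (Ideal.subset_span ⟨i, rfl⟩)
  have hle : Ideal.span {t} ≤ IsLocalRing.maximalIdeal R := by
    rwa [Ideal.span_singleton_le_iff_mem]
  have : Nontrivial (R ⧸ Ideal.span {t}) := Ideal.Quotient.nontrivial_iff.mpr fun h0 ↦
    (IsLocalRing.maximalIdeal.isMaximal R).ne_top (top_le_iff.mp (h0 ▸ hle))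
  have : IsLocalRing (R ⧸ Ideal.span {t}) := IsLocalRing.of_surjective' π hπs
  have hloc : IsLocalHom π := IsLocalHom.of_surjective π hπs
  have hmaxS : Ideal.span (Set.range (π ∘ y)) = IsLocalRing.maximalIdeal (R ⧸ Ideal.span {t}) := by
    have h1 : (IsLocalRing.maximalIdeal R).map π = IsLocalRing.maximalIdeal _ :=
      IsLocalRing.map_maximalIdeal_of_surjective π hπs
    rw [← h1, hmax, Ideal.map_sup, Ideal.map_span, Ideal.map_span, ← Set.range_comp,
      Set.image_singleton]
    have : π t = 0 := Ideal.Quotient.eq_zero_iff_mem.mpr (Ideal.mem_span_singleton_self t)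
    simp [this]
  have hev : ∀ G : MvPolynomial ι R, eval (π ∘ y) (MvPolynomial.map π G) = π (eval y G) := by
    intro G
    rw [MvPolynomial.eval_map, ← eval₂_comp]
  have hqr : ∀ (n : ℕ) (G : MvPolynomial ι (R ⧸ Ideal.span {t})), G.IsHomogeneous n →
      eval (π ∘ y) G = 0 → MvPolynomial.map (IsLocalRing.residue _) G = 0 := by
    intro n G hG hG0
    obtain ⟨G, hG', rfl⟩ := exists_isHomogeneous_map_eq π hπs G hG
    rw [hev] at hG0
    have h1 := coeff_mem_of_eval_mem y D hD (IsLocalRing.maximalIdeal R) (Ideal.span {t})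
      (fun i s hs ↦ by
        obtain ⟨c, rfl⟩ := Ideal.mem_span_singleton'.mp hs
        rw [Derivation.leibniz, hDt, smul_zero, zero_add, smul_eq_mul, mul_comm]
        exact Ideal.mul_mem_left _ _ (Ideal.mem_span_singleton_self t)) hle hymem n G hG'
      (Ideal.mem_sup_right (Ideal.Quotient.eq_zero_iff_mem.mp hG0))
    ext α
    rw [coeff_map, coeff_map, coeff_zero, IsLocalRing.residue_eq_zero_iff]
    exact (IsLocalRing.mem_maximalIdeal _).mpr fun hu ↦
      (IsLocalRing.mem_maximalIdeal _).mp (h1 α) (isUnit_of_map_unit π _ hu)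
  have key := isSmoothForm_of_isOrdinaryMultiplePoint (π ∘ y) hmaxS hqr m (MvPolynomial.map π F)
    (hF.map π) (by
      rw [hev]
      rwa [Ideal.map_span, Set.image_singleton] at h)
  set ρ := (IsLocalRing.residue (R ⧸ Ideal.span {t})).comp π with hρ
  have hρs : Function.Surjective ρ := IsLocalRing.residue_surjective.comp hπs
  have hkerρ : RingHom.ker ρ = IsLocalRing.maximalIdeal R :=
    IsLocalRing.eq_maximalIdeal (RingHom.ker_isMaximal_of_surjective ρ hρs)
  let e : IsLocalRing.ResidueField (R ⧸ Ideal.span {t}) ≃+* K :=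
    (RingHom.quotientKerEquivOfSurjective hρs).symm.trans
      ((Ideal.quotEquivOfEq (hkerρ.trans hkerθ.symm)).trans
        (RingHom.quotientKerEquivOfSurjective hθ))
  have he : (e : _ →+* K).comp ρ = θ := by
    ext r
    have : (RingHom.quotientKerEquivOfSurjective hρs).symm (ρ r) = Ideal.Quotient.mk _ r := by
      rw [RingEquiv.symm_apply_eq]; rfl
    simp [e, this]
  have := key.map_ringEquiv e
  rwa [MvPolynomial.map_map, MvPolynomial.map_map, RingHom.comp_assoc, ← hρ, he] at this

theorem mem_pow_sup_of_isOrdinaryMultiplePoint {R : Type*} [CommRing R] [IsLocalRing R] (m : ℕ)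
    (f t : R)
    (h : IsOrdinaryMultiplePoint m (R ⧸ Ideal.span {t})
      ((Ideal.span {f}).map (Ideal.Quotient.mk (Ideal.span {t})))) :
    f ∈ IsLocalRing.maximalIdeal R ^ m ⊔ Ideal.span {t} := by
  obtain ⟨hreg, d, x, P, hd, hx, hP, hK, -⟩ := h
  set π := Ideal.Quotient.mk (Ideal.span {t}) with hπ
  have hπs : Function.Surjective π := Ideal.Quotient.mk_surjective
  have h1 : (IsLocalRing.maximalIdeal R).map π = IsLocalRing.maximalIdeal _ :=
    IsLocalRing.map_maximalIdeal_of_surjective π hπs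
  have h2 : π f ∈ (IsLocalRing.maximalIdeal R ^ m).map π := by
    rw [Ideal.map_pow, h1]
    have : π f ∈ Ideal.span {eval x P} := by
      rw [← hK]; exact Ideal.mem_map_of_mem _ (Ideal.mem_span_singleton_self f)
    refine (Ideal.span_singleton_le_iff_mem _).mpr ?_ this
    refine eval_mem_pow_of_isHomogeneous hP fun i ↦ ?_
    rw [← hx]
    exact Ideal.subset_span ⟨i, rfl⟩
  rw [Ideal.mem_map_iff_of_surjective π hπs] at h2
  obtain ⟨g, hg, hgf⟩ := h2
  rw [← sub_eq_zero, ← map_sub, Ideal.Quotient.eq_zero_iff_mem] at hgf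
  have : f = g - (g - f) := by ring
  rw [this]
  exact sub_mem (Ideal.mem_sup_left hg) (Ideal.mem_sup_right hgf)

end

/-! ### The affine charts of the blow-up of a point, in étale coordinates -/

section

open MvPolynomial TensorProduct

/-- The coordinate ring of the `k`-th standard chart of the blow-up of affine space at the origin.
It is a polynomial ring; as an algebra over the coordinate ring of affine space it is given by
`X k ↦ X k` and `X i ↦ X k * X i` for `i ≠ k`. -/
def BlowupChart {τ : Type} (_ : τ) : Type := MvPolynomial τ ℂ

namespace BlowupChart

variable {τ : Type} [DecidableEq τ] (k : τ)

instance : CommRing (BlowupChart k) := inferInstanceAs (CommRing (MvPolynomial τ ℂ))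

instance : IsDomain (BlowupChart k) := inferInstanceAs (IsDomain (MvPolynomial τ ℂ))

instance : Algebra ℂ (BlowupChart k) :=
  inferInstanceAs (Algebra ℂ (MvPolynomial τ ℂ))

instance : Algebra.FormallySmooth ℂ (BlowupChart k) :=
  inferInstanceAs (Algebra.FormallySmooth ℂ (MvPolynomial τ ℂ))

instance [Finite τ] : Algebra.FinitePresentation ℂ (BlowupChart k) :=
  inferInstanceAs (Algebra.FinitePresentation ℂ (MvPolynomial τ ℂ))

/-- The coordinates of the chart. -/
def coord (i : τ) : BlowupChart k := (X i : MvPolynomial τ ℂ)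

/-- The affine coordinates on the exceptional divisor, normalised by `ratio k k = 1`. -/
def ratio (i : τ) : BlowupChart k := if i = k then 1 else coord k i

/-- The derivation with respect to the `i`-th coordinate of the chart. -/
def partialDeriv (i : τ) : Derivation ℂ (BlowupChart k) (BlowupChart k) :=
  (pderiv i : Derivation ℂ (MvPolynomial τ ℂ) (MvPolynomial τ ℂ))

theorem partialDeriv_ratio {i : τ} (hi : i ≠ k) (j : τ) :
    partialDeriv k i (ratio k j) = if i = j then 1 else 0 := by
  by_cases hj : j = k
  · subst hj
    rw [ratio, if_pos rfl, if_neg hi, Derivation.map_one_eq_zero]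
  · rw [ratio, if_neg hj]
    split_ifs with h
    · subst h
      exact pderiv_X_self (R := ℂ) i
    · exact pderiv_X_of_ne (R := ℂ) (Ne.symm h)

instance : Algebra (MvPolynomial τ ℂ) (BlowupChart k) :=
  (aeval (R := ℂ) fun i ↦ coord k k * ratio k i).toAlgebra

theorem algebraMap_X (i : τ) :
    algebraMap (MvPolynomial τ ℂ) (BlowupChart k) (X i) = coord k k * ratio k i :=
  aeval_X (R := ℂ) (fun i ↦ coord k k * ratio k i) i

instance : IsScalarTower ℂ (MvPolynomial τ ℂ) (BlowupChart k) :=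
  IsScalarTower.of_algebraMap_eq fun r ↦
    (AlgHom.commutes (aeval (R := ℂ) fun i ↦ coord k k * ratio k i) r).symm

theorem coord_ne_zero {τ : Type} (k i : τ) : coord k i ≠ 0 := X_ne_zero (R := ℂ) i

end BlowupChart

open BlowupChart

variable {τ : Type} [Fintype τ] [DecidableEq τ] (A : Type) [CommRing A] [Algebra ℂ A]
  [Algebra (MvPolynomial τ ℂ) A] [IsScalarTower ℂ (MvPolynomial τ ℂ) A]
  [Algebra.Etale (MvPolynomial τ ℂ) A]

/-- The base change of the `k`-th chart to a ring that is étale over affine space. -/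
def EtaleChart (k : τ) : Type := BlowupChart k ⊗[MvPolynomial τ ℂ] A

namespace EtaleChart

variable (k : τ)

instance : CommRing (EtaleChart A k) :=
  inferInstanceAs (CommRing (BlowupChart k ⊗[MvPolynomial τ ℂ] A))

instance : Algebra (BlowupChart k) (EtaleChart A k) :=
  inferInstanceAs (Algebra (BlowupChart k) (BlowupChart k ⊗[MvPolynomial τ ℂ] A))

instance : Algebra.Etale (BlowupChart k) (EtaleChart A k) :=
  inferInstanceAs (Algebra.Etale (BlowupChart k) (BlowupChart k ⊗[MvPolynomial τ ℂ] A))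

instance : Algebra ℂ (EtaleChart A k) :=
  ((algebraMap (BlowupChart k) (EtaleChart A k)).comp (algebraMap ℂ (BlowupChart k))).toAlgebra

instance : IsScalarTower ℂ (BlowupChart k) (EtaleChart A k) :=
  IsScalarTower.of_algebraMap_eq fun _ ↦ rfl

/-- The inclusion of the base of the étale base change. -/
def incl : A →+* EtaleChart A k :=
  (Algebra.TensorProduct.includeRight :
    A →ₐ[MvPolynomial τ ℂ] BlowupChart k ⊗[MvPolynomial τ ℂ] A).toRingHom

set_option linter.unusedSectionVars false in
theorem incl_algebraMap (s : MvPolynomial τ ℂ) :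
    incl A k (algebraMap _ A s) =
      algebraMap (BlowupChart k) (EtaleChart A k) (algebraMap _ (BlowupChart k) s) :=
  (Algebra.TensorProduct.includeRight :
    A →ₐ[MvPolynomial τ ℂ] BlowupChart k ⊗[MvPolynomial τ ℂ] A).commutes s

end EtaleChart

/-- The coordinate ring `B` of the `k`-th chart of the blow-up of `Spec A` in the zero locus of a
system `c` of étale coordinates: it is generated over `A` by elements `w` with `c i = c k * w i`,
and it is universal with this property. It is obtained from the chart of the blow-up of affine space
by étale base change, hence carries the derivations dual to its coordinates. -/
theorem exists_blowupChart (k : τ) :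
    ∃ (B : Type) (_ : CommRing B) (_ : Algebra ℂ B) (ρ : A →ₐ[ℂ] B) (w : τ → B)
      (D : τ → Derivation ℂ B B),
      Algebra.FormallySmooth ℂ B ∧ Algebra.FinitePresentation ℂ B ∧ w k = 1 ∧
      (∀ i, ρ (algebraMap (MvPolynomial τ ℂ) A (X i)) =
        ρ (algebraMap (MvPolynomial τ ℂ) A (X k)) * w i) ∧
      ρ (algebraMap (MvPolynomial τ ℂ) A (X k)) ∈ nonZeroDivisors B ∧
      (∀ i, i ≠ k → D i (ρ (algebraMap (MvPolynomial τ ℂ) A (X k))) = 0) ∧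
      (∀ i, i ≠ k → ∀ j, D i (w j) = if i = j then 1 else 0) ∧
      Function.Surjective (eval₂Hom (ρ : A →+* B) w) ∧
      ∀ (R : Type) [CommRing R] (φ : A →+* R) (t : τ → R),
        (∀ i, φ (algebraMap (MvPolynomial τ ℂ) A (X i)) =
          φ (algebraMap (MvPolynomial τ ℂ) A (X k)) * t i) → t k = 1 →
        ∃ φ' : B →+* R, φ'.comp (ρ : A →+* B) = φ ∧ ∀ i, φ' (w i) = t i := by
  have hinc := EtaleChart.incl_algebraMap A k
  let ρ : A →ₐ[ℂ] (EtaleChart A k) :=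
    { EtaleChart.incl A k with
      commutes' := fun r ↦ by
        have := hinc (algebraMap ℂ _ r)
        rw [← IsScalarTower.algebraMap_apply ℂ (MvPolynomial τ ℂ) A,
          ← IsScalarTower.algebraMap_apply ℂ (MvPolynomial τ ℂ) (BlowupChart k)] at this
        exact this }
  let w : τ → (EtaleChart A k) := fun i ↦ algebraMap (BlowupChart k) (EtaleChart A k) (ratio k i)
  have hρ : ∀ i, ρ (algebraMap (MvPolynomial τ ℂ) A (X i)) =
      algebraMap (BlowupChart k) (EtaleChart A k) (coord k k * ratio k i) := by
    intro i
    rw [← algebraMap_X]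
    exact hinc (X i)
  have hwk : w k = 1 := by simp [w, ratio]
  have hk : ρ (algebraMap (MvPolynomial τ ℂ) A (X k)) =
      algebraMap (BlowupChart k) (EtaleChart A k) (coord k k) := by
    rw [hρ]; simp [ratio]
  have hD : ∀ i, ∃ D : Derivation ℂ (EtaleChart A k) (EtaleChart A k), ∀ s : BlowupChart k, D (algebraMap _ (EtaleChart A k) s) =
      algebraMap _ (EtaleChart A k) (partialDeriv k i s) :=
    fun i ↦ exists_derivation_extension ℂ (BlowupChart k) (EtaleChart A k)
      (partialDeriv k i)
  choose D hD using hD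
  have : Algebra.FormallySmooth ℂ (EtaleChart A k) := Algebra.FormallySmooth.comp ℂ (BlowupChart k) (EtaleChart A k)
  have : Algebra.FinitePresentation ℂ (EtaleChart A k) := Algebra.FinitePresentation.trans ℂ (BlowupChart k) (EtaleChart A k)
  refine ⟨EtaleChart A k, inferInstance, inferInstance, ρ, w, D, inferInstance, inferInstance, hwk, ?_, ?_, ?_,
    ?_, ?_, ?_⟩
  · intro i
    rw [hρ, hk, map_mul]
  · rw [hk]
    have : Module.Flat (BlowupChart k) (EtaleChart A k) := inferInstance
    have h1 : IsSMulRegular (EtaleChart A k) (coord k k) := Module.Flat.isSMulRegular_of_nonZeroDivisors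
      (mem_nonZeroDivisors_of_ne_zero (coord_ne_zero k k))
    refine mem_nonZeroDivisors_iff_right.mpr fun x hx ↦ h1 ?_
    simpa [Algebra.smul_def, mul_comm] using hx
  · intro i hi
    rw [hk, hD]
    have : partialDeriv k i (coord k k) = 0 := pderiv_X_of_ne (R := ℂ) hi.symm
    rw [this, map_zero]
  · intro i hi j
    rw [hD]
    rw [partialDeriv_ratio k hi]
    split_ifs
    exacts [map_one _, map_zero _]
  · intro b
    induction b using TensorProduct.induction_on with
    | zero => exact ⟨0, map_zero _⟩
    | add x y hx hy =>
      obtain ⟨p, rfl⟩ := hx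
      obtain ⟨q, rfl⟩ := hy
      exact ⟨p + q, map_add _ _ _⟩
    | tmul s a =>
      have key : ∀ s : MvPolynomial τ ℂ, ∃ G, eval₂Hom (ρ : A →+* EtaleChart A k) w G =
          algebraMap (BlowupChart k) (EtaleChart A k) s := by
        intro s
        induction s using MvPolynomial.induction_on with
        | C r =>
          refine ⟨C (algebraMap ℂ A r), ?_⟩
          rw [eval₂Hom_C]
          change ρ (algebraMap ℂ A r) = algebraMap (BlowupChart k) (EtaleChart A k) (algebraMap ℂ (BlowupChart k) r)
          rw [AlgHom.commutes, ← IsScalarTower.algebraMap_apply]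
        | add p q hp hq =>
          obtain ⟨p', hp⟩ := hp
          obtain ⟨q', hq⟩ := hq
          exact ⟨p' + q', by rw [map_add, hp, hq]; exact (map_add _ _ _).symm⟩
        | mul_X p i hp =>
          obtain ⟨p', hp⟩ := hp
          by_cases hi : i = k
          · refine ⟨p' * C (algebraMap (MvPolynomial τ ℂ) A (X i)), ?_⟩
            rw [map_mul, hp, eval₂Hom_C, hi]
            exact (congrArg _ hk).trans (map_mul (algebraMap (BlowupChart k) (EtaleChart A k)) p _).symm
          · refine ⟨p' * X i, ?_⟩
            rw [map_mul, hp, eval₂Hom_X']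
            simp only [w, ratio, if_neg hi]
            exact (map_mul (algebraMap (BlowupChart k) (EtaleChart A k)) p _).symm
      obtain ⟨G, hG⟩ := key s
      refine ⟨G * C a, ?_⟩
      rw [map_mul, hG, eval₂Hom_C]
      change (s ⊗ₜ[MvPolynomial τ ℂ] (1 : A)) * ((1 : BlowupChart k) ⊗ₜ[MvPolynomial τ ℂ] a) = _
      rw [Algebra.TensorProduct.tmul_mul_tmul, mul_one, one_mul]
  · intro R _ φ t ht htk
    let _ : Algebra (MvPolynomial τ ℂ) R :=
      (φ.comp (algebraMap (MvPolynomial τ ℂ) A)).toAlgebra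
    let g : A →ₐ[MvPolynomial τ ℂ] R := { φ with commutes' := fun _ ↦ rfl }
    let f₀ : BlowupChart k →+* R :=
      eval₂Hom (φ.comp (algebraMap ℂ A))
        fun i ↦ if i = k then φ (algebraMap (MvPolynomial τ ℂ) A (X k)) else t i
    have hf₀ : ∀ i, f₀ (ratio k i) = t i := by
      intro i
      by_cases hi : i = k
      · simp [ratio, hi, htk]
      · simp only [ratio, if_neg hi, f₀]
        refine (eval₂Hom_X' _ _ i).trans ?_
        rw [if_neg hi]
    have hf₀k : f₀ (coord k k) = φ (algebraMap (MvPolynomial τ ℂ) A (X k)) :=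
      (eval₂Hom_X' _ _ k).trans (if_pos rfl)
    let f : BlowupChart k →ₐ[MvPolynomial τ ℂ] R :=
      { f₀ with
        commutes' := fun s ↦ by
          change (f₀.comp (algebraMap (MvPolynomial τ ℂ) (BlowupChart k))) s =
            (φ.comp (algebraMap (MvPolynomial τ ℂ) A)) s
          congr 1
          apply MvPolynomial.ringHom_ext
          · intro r
            have : (C r : MvPolynomial τ ℂ) = algebraMap ℂ _ r := rfl
            simp only [RingHom.comp_apply, this, ← IsScalarTower.algebraMap_apply]
            exact eval₂Hom_C _ _ _
          · intro i
            simp only [RingHom.comp_apply, algebraMap_X, map_mul, hf₀, hf₀k, ht i] }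
    refine ⟨(Algebra.TensorProduct.productMap f g).toRingHom, ?_, ?_⟩
    · ext a
      exact (Algebra.TensorProduct.productMap_right_apply f g a)
    · intro i
      exact (Algebra.TensorProduct.productMap_left_apply f g _).trans (hf₀ i)

end

/-! ### The equations of the transforms in a chart of the blow-up -/

section

open MvPolynomial

set_option linter.unusedSectionVars false

/-- A derivation acts on polynomials through their coefficients. -/
theorem exists_derivation_coeff {k B σ : Type*} [CommRing k] [CommRing B] [Algebra k B]
    (D : Derivation k B B) :
    ∃ D' : Derivation k (MvPolynomial σ B) (MvPolynomial σ B),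
      (∀ b, D' (C b) = C (D b)) ∧ ∀ i, D' (X i) = 0 := by
  classical
  let L : MvPolynomial σ B → MvPolynomial σ B :=
    fun p ↦ ∑ α ∈ p.support, monomial α (D (p.coeff α))
  have hL : ∀ p α, (L p).coeff α = D (p.coeff α) := by
    intro p α
    simp only [L, coeff_sum, coeff_monomial, Finset.sum_ite_eq', mem_support_iff]
    split_ifs with h
    · rfl
    · rw [not_not.mp h, map_zero]
  refine ⟨Derivation.mk' { toFun := L, map_add' := ?_, map_smul' := ?_ } ?_, ?_, ?_⟩
  · intro p q
    ext α
    simp [hL]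
  · intro r p
    ext α
    simp [hL]
  · intro p q
    ext α
    change (L (p * q)).coeff α = _
    simp only [LinearMap.coe_mk, AddHom.coe_mk, smul_eq_mul, coeff_add, hL]
    rw [coeff_mul, coeff_mul, mul_comm q, coeff_mul, map_sum, ← Finset.sum_add_distrib]
    refine Finset.sum_congr rfl fun x _ ↦ ?_
    rw [D.leibniz, hL, hL, smul_eq_mul, smul_eq_mul]
    ring
  · intro b
    change L (C b) = _
    ext α
    rw [hL, coeff_C, coeff_C]
    split_ifs
    exacts [rfl, map_zero _]
  · intro i
    change L (X i) = _
    ext α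
    rw [hL, coeff_X, coeff_zero]
    split_ifs
    exacts [D.map_one_eq_zero, map_zero _]

/-- If the prime element `e` does not divide `F`, then `(F)` is saturated with respect to `e`.
That `e` is prime is expressed by a map to a domain with kernel `(e)`. -/
theorem mem_span_of_mul_mem_span {B L : Type*} [CommRing B] [CommRing L] [IsDomain L] (ν : B →+* L)
    {e F : B} (he : e ∈ nonZeroDivisors B) (hker : ∀ b, ν b = 0 → b ∈ Ideal.span {e})
    (he0 : ν e = 0) (hF : ν F ≠ 0) {b : B} (h : e * b ∈ Ideal.span {F}) : b ∈ Ideal.span {F} := by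
  obtain ⟨t, ht⟩ := Ideal.mem_span_singleton'.mp h
  have h1 : ν t * ν F = 0 := by rw [← map_mul, ht, map_mul, he0, zero_mul]
  obtain ⟨t', rfl⟩ := Ideal.mem_span_singleton'.mp (hker t ((mul_eq_zero.mp h1).resolve_right hF))
  refine Ideal.mem_span_singleton'.mpr ⟨t', ?_⟩
  have h2 : e * (t' * F - b) = 0 := by rw [mul_sub, ← ht]; ring
  exact sub_eq_zero.mp ((mul_left_mem_nonZeroDivisors_eq_zero_iff he).mp h2)

/-- Let `F` and `F + s G` be the equations, in a chart with coordinate ring `B`, of the transforms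
of a hypersurface and of the total space of a pencil, and `e` that of the exceptional divisor. Both
equations are those of proper transforms (they are saturated with respect to `e`), and the total
space is smooth along the exceptional divisor. -/
structure IsTransformChart {B : Type} [CommRing B] [Algebra ℂ B] (e F G : B) : Prop where
  saturated : ∀ b, e * b ∈ Ideal.span {F} → b ∈ Ideal.span {F}
  saturated_pencil : ∀ b : MvPolynomial PUnit.{1} B,
    C e * b ∈ Ideal.span {C F + X PUnit.unit * C G} →
      b ∈ Ideal.span {C F + X PUnit.unit * C G}
  smooth : ∀ q : Ideal (MvPolynomial PUnit.{1} B), q.IsPrime → C e ∈ q →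
    C F + X PUnit.unit * C G ∈ q →
      ∃ D : Derivation ℂ (MvPolynomial PUnit.{1} B) (MvPolynomial PUnit.{1} B),
        D (C F + X PUnit.unit * C G) ∉ q

theorem mul_mem_nonZeroDivisors_C {B σ : Type*} [CommRing B] {e : B} (he : e ∈ nonZeroDivisors B) :
    (C e : MvPolynomial σ B) ∈ nonZeroDivisors (MvPolynomial σ B) := by
  refine mem_nonZeroDivisors_iff_right.mpr fun p hp ↦ ?_
  ext α
  have := congrArg (coeff α) hp
  rw [mul_comm, coeff_C_mul, coeff_zero] at this
  rw [coeff_zero]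
  exact (mul_left_mem_nonZeroDivisors_eq_zero_iff he).mp this

section

variable {ι : Type} [Fintype ι] [DecidableEq ι] {A : Type} [CommRing A] [Algebra ℂ A]
  (c : Option ι → A) (θ : A →ₐ[ℂ] ℂ) {B : Type} [CommRing B] [Algebra ℂ B] (ρ : A →ₐ[ℂ] B)
  (w : Option ι → B) {k : Option ι}

theorem sub_algebraMap_mem_exceptional
    (hθ : ∀ a, θ a = 0 → a ∈ Ideal.span (Set.range c)) (hρ : ∀ i, ρ (c i) = ρ (c k) * w i)
    (a : A) : ρ a - algebraMap ℂ B (θ a) ∈ Ideal.span {ρ (c k)} := by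
  have h1 : a - algebraMap ℂ A (θ a) ∈ Ideal.span (Set.range c) := hθ _ (by rw [map_sub, AlgHom.commutes]; exact sub_self _)
  have h2 : Ideal.span (Set.range c) ≤ (Ideal.span {ρ (c k)}).comap (ρ : A →+* B) := by
    rw [Ideal.span_le]
    rintro _ ⟨i, rfl⟩
    change ρ (c i) ∈ Ideal.span {ρ (c k)}
    rw [hρ i]
    exact (Ideal.span {ρ (c k)}).mul_mem_right _ (Ideal.mem_span_singleton_self _)
  have h3 : ρ (a - algebraMap ℂ A (θ a)) ∈ Ideal.span {ρ (c k)} := h2 h1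
  rwa [map_sub, AlgHom.commutes] at h3

/-- The exceptional divisor of a chart is an affine space; hence its equation is prime. -/
theorem mem_span_of_exceptional_eq_zero
    (hθ : ∀ a, θ a = 0 → a ∈ Ideal.span (Set.range c)) (hρ : ∀ i, ρ (c i) = ρ (c k) * w i)
    (hsurj : Function.Surjective (eval₂Hom (ρ : A →+* B) w))
    (v : Option ι → MvPolynomial (Option ι) ℂ) (hv : ∀ i, aeval (R := ℂ) w (v i) = w i)
    (ν : B →+* MvPolynomial (Option ι) ℂ) (hνρ : ∀ a, ν (ρ a) = C (θ a)) (hνw : ∀ i, ν (w i) = v i)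
    (b : B) (hb : ν b = 0) : b ∈ Ideal.span {ρ (c k)} := by
  have key : ∀ b, b - aeval (R := ℂ) w (ν b) ∈ Ideal.span {ρ (c k)} := by
    intro b
    obtain ⟨P, rfl⟩ := hsurj b
    induction P using MvPolynomial.induction_on with
    | C a =>
      rw [eval₂Hom_C]
      change ρ a - aeval (R := ℂ) w (ν (ρ a)) ∈ _
      rw [hνρ, aeval_C]
      exact sub_algebraMap_mem_exceptional c θ ρ w hθ hρ a
    | add p q hp hq =>
      rw [map_add, map_add, map_add, add_sub_add_comm]
      exact add_mem hp hq
    | mul_X p i hp =>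
      rw [map_mul, map_mul, map_mul, eval₂Hom_X', hνw, hv, ← sub_mul]
      exact Ideal.mul_mem_right _ _ hp
  simpa [hb] using key b

variable {m : ℕ} (F : MvPolynomial ι A)

theorem map_eval_eq_pow_mul (hF : F.IsHomogeneous m) (hρ : ∀ i, ρ (c i) = ρ (c k) * w i) :
    ρ (eval (fun i ↦ c (some i)) F) =
      ρ (c k) ^ m * eval₂ (ρ : A →+* B) (fun i ↦ w (some i)) F := by
  have h1 := eval_mul_of_isHomogeneous (hF.map (ρ : A →+* B)) (ρ (c k)) (fun i ↦ w (some i))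
  rw [MvPolynomial.eval_map] at h1
  rw [MvPolynomial.eval_map] at h1
  rw [← h1]
  have h2 := eval₂_comp_left (ρ : A →+* B) (RingHom.id A) (fun i ↦ c (some i)) F
  rw [RingHom.comp_id, eval₂_id] at h2
  refine h2.trans ?_
  congr 1
  funext i
  exact hρ (some i)

/-- Along the exceptional divisor the transform is the cone over the smooth projective hypersurface
defined by the leading form, so it can be singular only where all the homogeneous coordinates
`w (some i)` of the tangent cone vanish. -/
theorem mem_of_transform_singular (hF : F.IsHomogeneous m)
    (hsm : IsSmoothForm (MvPolynomial.map (θ : A →+* ℂ) F)) (D : Option ι → Derivation ℂ B B)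
    (hθ : ∀ a, θ a = 0 → a ∈ Ideal.span (Set.range c)) (hρ : ∀ i, ρ (c i) = ρ (c k) * w i)
    (hw : w k = 1) (hDk : ∀ i, i ≠ k → D i (ρ (c k)) = 0)
    (hD : ∀ i, i ≠ k → ∀ j, D i (w j) = if i = j then 1 else 0)
    (q : Ideal B) [q.IsPrime] (hk : ρ (c k) ∈ q)
    (hFq : eval₂ (ρ : A →+* B) (fun i ↦ w (some i)) F ∈ q)
    (hDF : ∀ i, some i ≠ k → D (some i) (eval₂ (ρ : A →+* B) (fun i ↦ w (some i)) F) ∈ q) (i : ι) :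
    w (some i) ∈ q := by
  have hle : Ideal.span {ρ (c k)} ≤ q := (Ideal.span_singleton_le_iff_mem _).mpr hk
  have hsub := sub_algebraMap_mem_exceptional c θ ρ w hθ hρ
  let mk := Ideal.Quotient.mk q
  let η : ℂ →+* B ⧸ q := mk.comp (algebraMap ℂ B)
  have hη : mk.comp (ρ : A →+* B) = η.comp (θ : A →+* ℂ) := by
    ext a
    exact Ideal.Quotient.eq.mpr (hle (hsub a))
  have hmk : ∀ P : MvPolynomial ι A, mk (eval₂ (ρ : A →+* B) (fun i ↦ w (some i)) P) =
      eval₂ η (fun i ↦ mk (w (some i))) (MvPolynomial.map (θ : A →+* ℂ) P) := by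
    intro P
    rw [eval₂_map, ← hη]
    exact eval₂_comp_left mk _ _ P
  have h0 : eval₂ η (fun i ↦ mk (w (some i))) (MvPolynomial.map (θ : A →+* ℂ) F) = 0 := by
    rw [← hmk]
    exact Ideal.Quotient.eq_zero_iff_mem.mpr hFq
  have h1 : ∀ i, some i ≠ k → eval₂ η (fun i ↦ mk (w (some i)))
      (pderiv i (MvPolynomial.map (θ : A →+* ℂ) F)) = 0 := by
    intro i hi
    obtain ⟨G', hG', hDG⟩ := exists_derivation_eval (D (some i)) (fun i ↦ w (some i))
      (MvPolynomial.map (ρ : A →+* B) F)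
    rw [MvPolynomial.eval_map] at hDG
    have h2 : eval (fun i ↦ w (some i)) G' ∈ q := by
      refine eval_mem_of_coeff_mem (fun α ↦ ?_) _
      rw [hG', coeff_map]
      obtain ⟨b, hb⟩ := Ideal.mem_span_singleton'.mp (hsub (F.coeff α))
      have h3 : (ρ : A →+* B) (F.coeff α) = b * ρ (c k) + algebraMap ℂ B (θ (F.coeff α)) := by
        rw [hb]; simp
      rw [h3, map_add, Derivation.leibniz, hDk _ hi, Derivation.map_algebraMap, smul_zero,
        zero_add, add_zero, smul_eq_mul]
      exact q.mul_mem_right _ hk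
    have h4 : eval₂ (ρ : A →+* B) (fun i ↦ w (some i)) (pderiv i F) ∈ q := by
      have h5 := hDF i hi
      rw [hDG] at h5
      have h6 := (Ideal.add_mem_iff_right q h2).mp h5
      rw [Finset.sum_eq_single i] at h6
      · rwa [hD _ hi, if_pos rfl, mul_one, pderiv_map, MvPolynomial.eval_map] at h6
      · intro j _ hj
        rw [hD _ hi, if_neg (by simpa using hj.symm), mul_zero]
      · simp
    rw [pderiv_map, ← hmk]
    exact Ideal.Quotient.eq_zero_iff_mem.mpr h4
  refine Ideal.Quotient.eq_zero_iff_mem.mp (hsm.eq_zero_of_eval₂_eq_zero η _ h0 (fun i ↦ ?_) i)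
  by_cases hi : some i ≠ k
  · exact h1 i hi
  · -- Euler's identity gives the derivative in the direction of the normalised coordinate.
    have hik := not_not.mp hi
    have h2 := congrArg (eval₂Hom η (fun i ↦ mk (w (some i))))
      (hF.map (θ : A →+* ℂ)).sum_X_mul_pderiv
    rw [map_sum, map_nsmul, coe_eval₂Hom, h0, smul_zero, Finset.sum_eq_single i] at h2
    · rw [eval₂_mul, eval₂_X, hik, hw, map_one, one_mul] at h2
      exact h2
    · intro j _ hj
      rw [eval₂_mul, h1 j (by rw [← hik]; simpa using hj), mul_zero]
    · simp

theorem exceptional_ne_zero (hF : F.IsHomogeneous m)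
    (hsm : IsSmoothForm (MvPolynomial.map (θ : A →+* ℂ) F))
    (ν : B →+* MvPolynomial (Option ι) ℂ) (hνρ : ∀ a, ν (ρ a) = C (θ a))
    (hνw : ∀ i, ν (w i) = if i = k then 1 else X i) :
    ν (eval₂ (ρ : A →+* B) (fun i ↦ w (some i)) F) ≠ 0 := by
  have h1 : ∃ u : Option ι → ℂ, (∀ i, i = k → u i = 1) ∧
      eval (fun i ↦ u (some i)) (MvPolynomial.map (θ : A →+* ℂ) F) ≠ 0 := by
    rcases k with _ | j
    · by_contra! h
      refine hsm.1 (MvPolynomial.funext fun u ↦ ?_)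
      rw [map_zero]
      refine h (fun i ↦ i.elim 1 u) fun i hi ↦ ?_
      rw [hi]
      rfl
    · obtain ⟨u, hu, hu'⟩ := exists_eval_ne_zero_of_isHomogeneous (hF.map (θ : A →+* ℂ)) hsm.1 j
      refine ⟨fun i ↦ i.elim 1 u, ?_, hu'⟩
      rintro i rfl
      exact hu
  obtain ⟨u, hu, hu'⟩ := h1
  intro h0
  apply hu'
  rw [MvPolynomial.eval_map]
  have h2 := eval₂_comp_left ((eval u).comp ν) (ρ : A →+* B) (fun i ↦ w (some i)) F
  rw [RingHom.comp_apply, h0, map_zero] at h2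
  rw [h2]
  congr 1
  · ext a
    simp [hνρ]
  · funext i
    change _ = eval u (ν (w (some i)))
    rw [hνw]
    split_ifs with hi
    · rw [hu _ hi, map_one]
    · rw [eval_X]

end

section

variable {ι : Type} [Fintype ι] [DecidableEq ι] {A : Type} [CommRing A] [Algebra ℂ A]
  (c : Option ι → A) (θ : A →ₐ[ℂ] ℂ) {B : Type} [CommRing B] [Algebra ℂ B] (ρ : A →ₐ[ℂ] B)
  (w : Option ι → B) {k : Option ι} {m : ℕ} (F : MvPolynomial ι A)

theorem isTransformChart (hF : F.IsHomogeneous m)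
    (hsm : IsSmoothForm (MvPolynomial.map (θ : A →+* ℂ) F)) (D : Option ι → Derivation ℂ B B)
    (hθ : ∀ a, θ a = 0 → a ∈ Ideal.span (Set.range c)) (hρ : ∀ i, ρ (c i) = ρ (c k) * w i)
    (hw : w k = 1) (hDk : ∀ i, i ≠ k → D i (ρ (c k)) = 0)
    (hD : ∀ i, i ≠ k → ∀ j, D i (w j) = if i = j then 1 else 0)
    (hreg : ρ (c k) ∈ nonZeroDivisors B)
    (hsurj : Function.Surjective (eval₂Hom (ρ : A →+* B) w))
    (ν : B →+* MvPolynomial (Option ι) ℂ) (hνρ : ∀ a, ν (ρ a) = C (θ a))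
    (hνw : ∀ i, ν (w i) = if i = k then 1 else X i) (hck : θ (c k) = 0) :
    IsTransformChart (ρ (c k)) (eval₂ (ρ : A →+* B) (fun i ↦ w (some i)) F) (w none ^ m) := by
  have hker : ∀ b, ν b = 0 → b ∈ Ideal.span {ρ (c k)} :=
    mem_span_of_exceptional_eq_zero c θ ρ w hθ hρ hsurj (fun i ↦ if i = k then 1 else X i)
      (fun i ↦ by split_ifs with h <;> simp [h, hw]) ν hνρ hνw
  have hν0 : ν (ρ (c k)) = 0 := by rw [hνρ, hck, C_0]
  have hνF := exceptional_ne_zero θ ρ w (k := k) F hF hsm ν hνρ hνw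
  refine ⟨fun b ↦ mem_span_of_mul_mem_span ν hreg hker hν0 hνF, fun b ↦
    mem_span_of_mul_mem_span (MvPolynomial.map ν) (mul_mem_nonZeroDivisors_C hreg) ?_ ?_ ?_, ?_⟩
  · intro p hp
    rw [Ideal.mem_span_singleton, C_dvd_iff_dvd_coeff]
    intro α
    rw [← Ideal.mem_span_singleton]
    apply hker
    rw [← coeff_map, hp, coeff_zero]
  · rw [map_C, hν0, C_0]
  · intro h
    apply hνF
    have := congrArg constantCoeff h
    simpa using this
  · intro q hq hkq hFq
    by_contra! hDq
    rcases k with _ | j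
    · -- On this chart `G = 1`, so the derivative with respect to `s` is a unit.
      have h1 := hDq ((pderiv PUnit.unit).restrictScalars ℂ)
      refine hq.ne_top ((Ideal.eq_top_iff_one q).mpr ?_)
      simpa [hw, Derivation.leibniz] using h1
    · have h1 := hDq ((pderiv PUnit.unit).restrictScalars ℂ)
      have h2 : C (w none ^ m) ∈ q := by simpa [Derivation.leibniz] using h1
      have hFq' : C (eval₂ (ρ : A →+* B) (fun i ↦ w (some i)) F) ∈ q :=
        (Ideal.add_mem_iff_left q (q.mul_mem_left _ h2)).mp hFq
      have h3 : ∀ i, some i ≠ some j →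
          D (some i) (eval₂ (ρ : A →+* B) (fun i ↦ w (some i)) F) ∈ q.comap C := by
        intro i hi
        obtain ⟨D', hD', hD'X⟩ := exists_derivation_coeff (σ := PUnit.{1}) (D (some i))
        have h4 := hDq D'
        rw [map_add, Derivation.leibniz, hD', hD'X, hD', Derivation.leibniz_pow, hD _ hi,
          if_neg (by simp)] at h4
        simpa using h4
      have h5 := mem_of_transform_singular c θ ρ w F hF hsm D hθ hρ hw hDk hD (q.comap C) hkq hFq'
        h3 j
      rw [hw] at h5
      exact (Ideal.ne_top_iff_one _).mp (Ideal.IsPrime.ne_top inferInstance) h5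

/-- The singular points of the transform on the exceptional divisor are limits of points of the
transform of the curve `{c (some i) = 0}` outside the exceptional divisor. -/
theorem exists_prime_of_transform_singular (hF : F.IsHomogeneous m)
    (hsm : IsSmoothForm (MvPolynomial.map (θ : A →+* ℂ) F)) (D : Option ι → Derivation ℂ B B)
    (hθ : ∀ a, θ a = 0 → a ∈ Ideal.span (Set.range c)) (hρ : ∀ i, ρ (c i) = ρ (c k) * w i)
    (hw : w k = 1) (hDk : ∀ i, i ≠ k → D i (ρ (c k)) = 0)
    (hD : ∀ i, i ≠ k → ∀ j, D i (w j) = if i = j then 1 else 0)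
    (hsurj : Function.Surjective (eval₂Hom (ρ : A →+* B) w))
    (huniv : ∀ (R : Type) [CommRing R] (φ : A →+* R) (t : Option ι → R),
      (∀ i, φ (c i) = φ (c k) * t i) → t k = 1 →
        ∃ φ' : B →+* R, φ'.comp (ρ : A →+* B) = φ ∧ ∀ i, φ' (w i) = t i)
    (hJ : ∀ a, θ a ≠ 0 → ∀ N : ℕ, a * c none ^ N ∉ Ideal.span (Set.range fun i ↦ c (some i)))
    (q : Ideal B) [q.IsPrime] (hk : ρ (c k) ∈ q)
    (hFq : eval₂ (ρ : A →+* B) (fun i ↦ w (some i)) F ∈ q)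
    (hDF : ∀ D : Derivation ℂ B B, D (eval₂ (ρ : A →+* B) (fun i ↦ w (some i)) F) ∈ q)
    (b : B) (hb : b ∉ q) :
    ∃ q' : Ideal B, q'.IsPrime ∧ b ∉ q' ∧ ρ (c k) ∉ q' ∧ ∀ i, ρ (c (some i)) ∈ q' := by
  have hwq := mem_of_transform_singular c θ ρ w F hF hsm D hθ hρ hw hDk hD q hk hFq
    fun i _ ↦ hDF _
  rcases k with _ | j
  swap
  · have := hwq j
    rw [hw] at this
    exact absurd this ((Ideal.ne_top_iff_one _).mp (Ideal.IsPrime.ne_top inferInstance))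
  set J := Ideal.span (Set.range fun i ↦ c (some i)) with hJdef
  have hJmem : ∀ i, c (some i) ∈ J := fun i ↦ Ideal.subset_span ⟨i, rfl⟩
  obtain ⟨ψ, hψρ, hψw⟩ := huniv (A ⧸ J) (Ideal.Quotient.mk J) (fun i ↦ i.elim 1 fun _ ↦ 0)
    (by
      rintro (_ | i)
      · simp
      · simpa using Ideal.Quotient.eq_zero_iff_mem.mpr (hJmem i)) rfl
  have hψ : ∀ a, ψ (ρ a) = Ideal.Quotient.mk J a := fun a ↦ RingHom.congr_fun hψρ a
  have key : ∀ b : B, ∃ a : A, b - ρ a ∈ q ∧ ψ b = Ideal.Quotient.mk J a := by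
    intro b
    obtain ⟨P, rfl⟩ := hsurj b
    induction P using MvPolynomial.induction_on with
    | C a => exact ⟨a, by simp, by rw [eval₂Hom_C]; exact hψ a⟩
    | add p p' hp hp' =>
      obtain ⟨a, ha, ha'⟩ := hp
      obtain ⟨a₁, ha₁, ha₁'⟩ := hp'
      refine ⟨a + a₁, ?_, by rw [map_add, map_add, ha', ha₁', map_add]⟩
      rw [map_add, map_add, add_sub_add_comm]
      exact add_mem ha ha₁
    | mul_X p i hp =>
      obtain ⟨a, ha, ha'⟩ := hp
      rcases i with _ | i
      · exact ⟨a, by rwa [map_mul, eval₂Hom_X', hw, mul_one],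
          by rw [map_mul, eval₂Hom_X', hw, mul_one, ha']⟩
      · refine ⟨0, ?_, ?_⟩
        · rw [map_mul, eval₂Hom_X', map_zero, sub_zero]
          exact q.mul_mem_left _ (hwq i)
        · rw [map_mul, map_mul, eval₂Hom_X', hψw, map_zero]
          exact mul_zero _
  obtain ⟨a, ha, ha'⟩ := key b
  have hθa : θ a ≠ 0 := by
    intro h0
    have h1 := sub_algebraMap_mem_exceptional c θ ρ w hθ hρ a
    rw [h0, map_zero, sub_zero] at h1
    have h2 := (Ideal.span_singleton_le_iff_mem _).mpr hk h1
    exact hb (by simpa using add_mem ha h2)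
  have hnil : ¬ IsNilpotent (Ideal.Quotient.mk J (a * c none)) := by
    rintro ⟨N, hN⟩
    rw [← map_pow, Ideal.Quotient.eq_zero_iff_mem, mul_pow] at hN
    exact hJ (a ^ N) (by rw [map_pow]; exact pow_ne_zero _ hθa) N hN
  have hnil' : Ideal.Quotient.mk J (a * c none) ∉ nilradical (A ⧸ J) := hnil
  rw [nilradical_eq_sInf, Ideal.mem_sInf] at hnil'
  push Not at hnil'
  obtain ⟨p, hp, hap⟩ := hnil'
  have hp' : p.IsPrime := hp
  refine ⟨p.comap ψ, inferInstance, fun h ↦ hap ?_, fun h ↦ hap ?_, fun i ↦ ?_⟩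
  · rw [Ideal.mem_comap, ha'] at h
    rw [map_mul]
    exact p.mul_mem_right _ h
  · rw [Ideal.mem_comap, hψ] at h
    rw [map_mul]
    exact p.mul_mem_left _ h
  · rw [Ideal.mem_comap, hψ, Ideal.Quotient.eq_zero_iff_mem.mpr (hJmem i)]
    exact p.zero_mem

end

/-- The charts of the blow-up of a point, in étale coordinates `c` adapted to the curve
`{c (some i) = 0}` and to the hypersurface `{c none = 0}`, together with the equations of the
transforms of the hypersurface `F(c) = 0` and of the pencil `F(c) + s (c none) ^ m = 0`. -/
theorem exists_transformChart {ι : Type} [Fintype ι] [DecidableEq ι] {A : Type} [CommRing A]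
    [Algebra ℂ A] [Algebra (MvPolynomial (Option ι) ℂ) A]
    [IsScalarTower ℂ (MvPolynomial (Option ι) ℂ) A] [Algebra.Etale (MvPolynomial (Option ι) ℂ) A]
    (c : Option ι → A) (hc : ∀ i, c i = algebraMap (MvPolynomial (Option ι) ℂ) A (X i))
    (θ : A →ₐ[ℂ] ℂ) (hθ : ∀ a, θ a = 0 ↔ a ∈ Ideal.span (Set.range c)) {m : ℕ}
    (F : MvPolynomial ι A) (hF : F.IsHomogeneous m)
    (hsm : IsSmoothForm (MvPolynomial.map (θ : A →+* ℂ) F))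
    (hJ : ∀ a, θ a ≠ 0 → ∀ N : ℕ, a * c none ^ N ∉ Ideal.span (Set.range fun i ↦ c (some i)))
    (k : Option ι) :
    ∃ (B : Type) (_ : CommRing B) (_ : Algebra ℂ B) (ρ : A →ₐ[ℂ] B) (w : Option ι → B) (F' : B),
      Algebra.FormallySmooth ℂ B ∧ Algebra.FinitePresentation ℂ B ∧ w k = 1 ∧
      (∀ i, ρ (c i) = ρ (c k) * w i) ∧ ρ (c k) ∈ nonZeroDivisors B ∧
      (∀ (R : Type) [CommRing R] (φ : A →+* R) (t : Option ι → R),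
        (∀ i, φ (c i) = φ (c k) * t i) → t k = 1 →
          ∃ φ' : B →+* R, φ'.comp (ρ : A →+* B) = φ ∧ ∀ i, φ' (w i) = t i) ∧
      Function.Surjective (eval₂Hom (ρ : A →+* B) w) ∧
      ρ (eval (fun i ↦ c (some i)) F) = ρ (c k) ^ m * F' ∧
      IsTransformChart (ρ (c k)) F' (w none ^ m) ∧
      ∀ q : Ideal B, q.IsPrime → ρ (c k) ∈ q → F' ∈ q → (∀ D : Derivation ℂ B B, D F' ∈ q) →
        ∀ b ∉ q, ∃ q' : Ideal B,
          q'.IsPrime ∧ b ∉ q' ∧ ρ (c k) ∉ q' ∧ ∀ i, ρ (c (some i)) ∈ q' := by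
  obtain ⟨B, _, _, ρ, w, D, hfs, hfp, hw, hρ, hreg, hDk, hD, hsurj, huniv⟩ :=
    exists_blowupChart A k
  simp only [← hc] at hρ hreg hDk huniv
  have hck : ∀ i, θ (c i) = 0 := fun i ↦ (hθ _).mpr (Ideal.subset_span ⟨i, rfl⟩)
  obtain ⟨ν, hνρ, hνw⟩ := huniv (MvPolynomial (Option ι) ℂ) (C.comp (θ : A →+* ℂ))
    (fun i ↦ if i = k then 1 else X i) (fun i ↦ by simp [hck]) (if_pos rfl)
  refine ⟨B, inferInstance, inferInstance, ρ, w,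
    eval₂ (ρ : A →+* B) (fun i ↦ w (some i)) F, hfs, hfp, hw, hρ, hreg,
    fun R _ ↦ huniv R, hsurj, map_eval_eq_pow_mul c ρ w F hF hρ,
    isTransformChart c θ ρ w F hF hsm D (fun a ↦ (hθ a).mp) hρ hw hDk hD hreg hsurj ν
      (fun a ↦ RingHom.congr_fun hνρ a) hνw (hck k), ?_⟩
  intro q hq hkq hFq hDq b hb
  exact exists_prime_of_transform_singular c θ ρ w F hF hsm D (fun a ↦ (hθ a).mp) hρ hw hDk hD
    hsurj (fun R _ ↦ huniv R) hJ q hkq hFq hDq b hb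

end

/-! ### Étale coordinates at a point of a curve -/

section

open MvPolynomial TensorProduct

theorem exists_algHom_ker_eq (A : Type*) [CommRing A] [Algebra ℂ A] [Algebra.FiniteType ℂ A]
    (q : Ideal A) [q.IsMaximal] : ∃ θ : A →ₐ[ℂ] ℂ, ∀ a, θ a = 0 ↔ a ∈ q := by
  let _ : Field (A ⧸ q) := Ideal.Quotient.field q
  have : Algebra.FiniteType ℂ (A ⧸ q) :=
    Algebra.FiniteType.of_surjective (Ideal.Quotient.mkₐ ℂ q) Ideal.Quotient.mk_surjective
  have : Module.Finite ℂ (A ⧸ q) := finite_of_finite_type_of_isJacobsonRing ℂ (A ⧸ q)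
  let e : ℂ ≃ₐ[ℂ] (A ⧸ q) := AlgEquiv.ofBijective (Algebra.ofId ℂ (A ⧸ q))
    (IsAlgClosed.algebraMap_bijective_of_isIntegral)
  refine ⟨(e.symm : (A ⧸ q) →ₐ[ℂ] ℂ).comp (Ideal.Quotient.mkₐ ℂ q), fun a ↦ ?_⟩
  rw [← Ideal.Quotient.eq_zero_iff_mem]
  exact map_eq_zero_iff _ e.symm.injective

/-- Functions on a smooth scheme whose differentials form a basis of the module of differentials
define an étale map to affine space. -/
theorem formallyEtale_of_basis {k τ O : Type*} [CommRing k] [CommRing O] [Algebra k O]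
    [Algebra (MvPolynomial τ k) O] [IsScalarTower k (MvPolynomial τ k) O]
    [Algebra.FormallySmooth k O] (b : Module.Basis τ O (Ω[O⁄k]))
    (hb : ∀ i, b i = KaehlerDifferential.D k O (algebraMap (MvPolynomial τ k) O (X i))) :
    Algebra.FormallyEtale (MvPolynomial τ k) O := by
  have hbij : Function.Bijective (KaehlerDifferential.mapBaseChange k (MvPolynomial τ k) O) := by
    let e := ((KaehlerDifferential.mvPolynomialBasis k τ).baseChange O).equiv b (Equiv.refl τ)
    have : KaehlerDifferential.mapBaseChange k (MvPolynomial τ k) O = e.toLinearMap := by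
      refine ((KaehlerDifferential.mvPolynomialBasis k τ).baseChange O).ext fun i ↦ ?_
      rw [LinearEquiv.coe_coe, Module.Basis.equiv_apply, Equiv.refl_apply, hb,
        Module.Basis.baseChange_apply, KaehlerDifferential.mvPolynomialBasis_apply,
        KaehlerDifferential.mapBaseChange_tmul, one_smul, KaehlerDifferential.map_D]
    rw [this]
    exact e.bijective
  refine ⟨?_, ?_⟩
  · refine subsingleton_of_forall_eq 0 fun x ↦ ?_
    obtain ⟨x, rfl⟩ := KaehlerDifferential.map_surjective_of_surjective k (MvPolynomial τ k) O O
      (fun x ↦ ⟨x, rfl⟩) x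
    obtain ⟨y, rfl⟩ := hbij.2 x
    exact (KaehlerDifferential.exact_mapBaseChange_map k (MvPolynomial τ k) O).apply_apply_eq_zero y
  · refine subsingleton_of_forall_eq 0 fun x ↦ ?_
    have h1 : Algebra.H1Cotangent.δ k (MvPolynomial τ k) O x = 0 := by
      apply hbij.1
      rw [map_zero]
      exact (Algebra.H1Cotangent.exact_δ_mapBaseChange k (MvPolynomial τ k) O).apply_apply_eq_zero x
    obtain ⟨y, rfl⟩ := (Algebra.H1Cotangent.exact_map_δ k (MvPolynomial τ k) O x).mp h1
    rw [Subsingleton.elim y 0, map_zero]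

/-- Unramified coordinates, shifted by their values, generate the maximal ideal. -/
theorem maximalIdeal_eq_span_of_formallyUnramified {k τ O : Type*} [Field k] [CommRing O]
    [IsLocalRing O] [IsNoetherianRing O] [Algebra k O]
    [Algebra (MvPolynomial τ k) O] [IsScalarTower k (MvPolynomial τ k) O]
    [Algebra.FormallyUnramified (MvPolynomial τ k) O] (θ : O →ₐ[k] k) :
    IsLocalRing.maximalIdeal O = Ideal.span (Set.range fun i ↦
      algebraMap (MvPolynomial τ k) O (X i) -
        algebraMap k O (θ (algebraMap (MvPolynomial τ k) O (X i)))) := by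
  set 𝔪 := IsLocalRing.maximalIdeal O
  have hker : ∀ a, θ a = 0 ↔ a ∈ 𝔪 := by
    intro a
    rw [IsLocalRing.mem_maximalIdeal, mem_nonunits_iff]
    constructor
    · intro h hu
      exact (hu.map θ).ne_zero h
    · intro h
      by_contra h0
      have h1 : a - algebraMap k O (θ a) ∈ 𝔪 := by
        rw [IsLocalRing.mem_maximalIdeal, mem_nonunits_iff]
        intro hu
        exact (hu.map θ).ne_zero (by rw [map_sub, AlgHom.commutes]; exact sub_self _)
      have h2 : algebraMap k O (θ a) ∈ 𝔪 := by
        have := sub_mem (show a ∈ 𝔪 from h) h1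
        rwa [sub_sub_cancel] at this
      exact h2 ((isUnit_iff_ne_zero.mpr h0).map (algebraMap k O))
  set S := Ideal.span (Set.range fun i ↦ algebraMap (MvPolynomial τ k) O (X i) -
        algebraMap k O (θ (algebraMap (MvPolynomial τ k) O (X i))))
  have hS : S ≤ 𝔪 := by
    rw [Ideal.span_le]
    rintro _ ⟨i, rfl⟩
    refine (hker _).mp ?_
    rw [map_sub, AlgHom.commutes]
    exact sub_self _
  refine le_antisymm ?_ hS
  refine Submodule.le_of_le_smul_of_le_jacobson_bot (I := 𝔪) (IsNoetherian.noetherian _)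
    (IsLocalRing.maximalIdeal_le_jacobson _) ?_
  let K := S ⊔ 𝔪 ^ 2
  have hK : K ≤ 𝔪 := sup_le hS (Ideal.pow_le_self two_ne_zero)
  -- Modulo `S + 𝔪²`, the identity of `O` and the evaluation `θ` are two lifts of the same map.
  let g₁ : O →ₐ[MvPolynomial τ k] O ⧸ K := Ideal.Quotient.mkₐ _ K
  let g : O →+* O ⧸ K := (Ideal.Quotient.mk K).comp ((algebraMap k O).comp (θ : O →+* k))
  have hg : ∀ p : MvPolynomial τ k,
      g (algebraMap _ O p) = Ideal.Quotient.mk K (algebraMap _ O p) := by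
    intro p
    induction p using MvPolynomial.induction_on with
    | C r =>
      have : algebraMap (MvPolynomial τ k) O (C r) = algebraMap k O r :=
        (IsScalarTower.algebraMap_apply k (MvPolynomial τ k) O r).symm
      rw [this]
      change Ideal.Quotient.mk K (algebraMap k O (θ (algebraMap k O r))) = _
      rw [AlgHom.commutes]
      rfl
    | add p q hp hq => rw [map_add, map_add, map_add, hp, hq]
    | mul_X p i hp =>
      rw [map_mul, map_mul, map_mul, hp]
      congr 1
      refine (Ideal.Quotient.eq.mpr ?_).symm
      exact (le_sup_left : S ≤ K) (Ideal.subset_span ⟨i, rfl⟩)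
  let g₂ : O →ₐ[MvPolynomial τ k] O ⧸ K := { g with commutes' := hg }
  have hnil : IsNilpotent (𝔪.map (Ideal.Quotient.mk K)) := by
    refine ⟨2, ?_⟩
    rw [← Ideal.map_pow]
    exact (Ideal.map_eq_bot_iff_le_ker _).mpr (by rw [Ideal.mk_ker]; exact le_sup_right)
  have heq : g₁ = g₂ := by
    refine Algebra.FormallyUnramified.ext _ hnil fun a ↦ ?_
    rw [Ideal.Quotient.eq]
    change Ideal.Quotient.mk K a - Ideal.Quotient.mk K (algebraMap k O (θ a)) ∈ _
    rw [← map_sub]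
    refine Ideal.mem_map_of_mem _ ((hker _).mp ?_)
    rw [map_sub, AlgHom.commutes]
    exact sub_self _
  intro a ha
  have h1 : g₁ a = g₂ a := by rw [heq]
  have h2 : Ideal.Quotient.mk K a = Ideal.Quotient.mk K (algebraMap k O (θ a)) := h1
  rw [(hker a).mpr ha, map_zero, map_zero, Ideal.Quotient.eq_zero_iff_mem] at h2
  rw [smul_eq_mul, ← pow_two]
  exact h2

/-- In a noetherian local ring whose maximal ideal is generated by an ideal `S` and an element `z`,
an ideal containing `S` but no power of `z` is equal to `S`. -/
theorem le_of_pow_notMem {O : Type*} [CommRing O] [IsLocalRing O] [IsNoetherianRing O]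
    (S J : Ideal O) (z : O) (hmax : IsLocalRing.maximalIdeal O = S ⊔ Ideal.span {z}) (hSJ : S ≤ J)
    (hz : ∀ N : ℕ, z ^ N ∉ J) : J ≤ S := by
  have hS : S ≤ IsLocalRing.maximalIdeal O := hmax ▸ le_sup_left
  have hpow : ∀ N, ∀ j ∈ J, j ∈ S ⊔ Ideal.span {z ^ N} := by
    intro N
    induction N with
    | zero => intro j _; simp
    | succ N ih =>
      intro j hj
      obtain ⟨s, hs, t, ht, rfl⟩ := Submodule.mem_sup.mp (ih j hj)
      obtain ⟨u, rfl⟩ := Ideal.mem_span_singleton'.mp ht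
      have hu : u ∈ IsLocalRing.maximalIdeal O := by
        rw [IsLocalRing.mem_maximalIdeal, mem_nonunits_iff]
        intro hu
        have h1 : u * z ^ N ∈ J := by
          have := sub_mem hj (hSJ hs)
          rwa [add_sub_cancel_left] at this
        exact hz N ((Ideal.unit_mul_mem_iff_mem _ hu).mp h1)
      rw [hmax] at hu
      obtain ⟨s', hs', t', ht', rfl⟩ := Submodule.mem_sup.mp hu
      obtain ⟨v, rfl⟩ := Ideal.mem_span_singleton'.mp ht'
      refine Submodule.mem_sup.mpr ⟨s + s' * z ^ N, add_mem hs (S.mul_mem_right _ hs'),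
        v * z ^ (N + 1), Ideal.mul_mem_left _ _ (Ideal.mem_span_singleton_self _), by ring⟩
  intro j hj
  have hne : S ≠ ⊤ := fun h ↦ (IsLocalRing.maximalIdeal.isMaximal O).ne_top (top_le_iff.mp (h ▸ hS))
  have : Nontrivial (O ⧸ S) := Ideal.Quotient.nontrivial_iff.mpr hne
  have : IsLocalRing (O ⧸ S) := IsLocalRing.of_surjective' (Ideal.Quotient.mk S) Ideal.Quotient.mk_surjective
  have hz' : Ideal.span {Ideal.Quotient.mk S z} ≠ ⊤ := by
    intro h
    rw [Ideal.span_singleton_eq_top] at h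
    obtain ⟨u, hu⟩ := h.exists_left_inv
    obtain ⟨u, rfl⟩ := Ideal.Quotient.mk_surjective u
    rw [← map_mul, ← map_one (Ideal.Quotient.mk S), Ideal.Quotient.eq] at hu
    have h1 : z ∈ IsLocalRing.maximalIdeal O := hmax ▸ Ideal.mem_sup_right (Ideal.mem_span_singleton_self z)
    have h2 := sub_mem (Ideal.mul_mem_left _ u h1) (hS hu)
    rw [sub_sub_cancel] at h2
    exact (Ideal.ne_top_iff_one _).mp (IsLocalRing.maximalIdeal.isMaximal O).ne_top h2
  have hbot := Ideal.iInf_pow_eq_bot_of_isLocalRing _ hz'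
  rw [← Ideal.Quotient.eq_zero_iff_mem, ← Ideal.mem_bot, ← hbot, Ideal.mem_iInf]
  intro N
  obtain ⟨s, hs, t, ht, rfl⟩ := Submodule.mem_sup.mp (hpow N j hj)
  obtain ⟨u, rfl⟩ := Ideal.mem_span_singleton'.mp ht
  rw [map_add, Ideal.Quotient.eq_zero_iff_mem.mpr hs, zero_add, map_mul, map_pow,
    Ideal.span_singleton_pow]
  exact Ideal.mul_mem_left _ _ (Ideal.mem_span_singleton_self _)

/-- If an ideal becomes contained in another one after localization at a prime, then this is already
so after inverting one element. -/
theorem exists_notMem_mul_mem {A : Type*} [CommRing A] [IsNoetherianRing A] (q : Ideal A) [q.IsPrime]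
    (I K : Ideal A)
    (h : I.map (algebraMap A (Localization.AtPrime q)) ≤ K.map (algebraMap A (Localization.AtPrime q))) :
    ∃ a ∉ q, ∀ j ∈ I, a * j ∈ K := by
  have hstep : ∀ j ∈ I, ∃ s ∉ q, s * j ∈ K := by
    intro j hj
    have h1 := h (Ideal.mem_map_of_mem _ hj)
    rw [IsLocalization.algebraMap_mem_map_algebraMap_iff q.primeCompl] at h1
    obtain ⟨s, hs, hs'⟩ := h1
    exact ⟨s, hs, hs'⟩
  obtain ⟨T, hT⟩ := (IsNoetherian.noetherian I : I.FG)
  have hT' : ∀ j ∈ T, ∃ s ∉ q, s * j ∈ K := fun j hj ↦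
    hstep j (by rw [← hT]; exact Ideal.subset_span hj)
  choose! s hs hs' using hT'
  refine ⟨∏ j ∈ T, s j, fun h ↦ ?_, fun j hj ↦ ?_⟩
  · obtain ⟨j, hj, hj'⟩ := (Ideal.IsPrime.prod_mem_iff).mp h
    exact hs j hj hj'
  · have h2 : I ≤ K.colon {∏ j ∈ T, s j} := by
      rw [← hT]
      refine Submodule.span_le.mpr fun i hi ↦ ?_
      rw [SetLike.mem_coe, Submodule.mem_colon_singleton, smul_eq_mul]
      obtain ⟨t, ht⟩ := Finset.dvd_prod_of_mem s hi
      rw [ht, ← mul_assoc, mul_comm i]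
      exact K.mul_mem_right _ (hs' i hi)
    have := h2 hj
    rwa [Submodule.mem_colon_singleton, smul_eq_mul, mul_comm] at this

/-- The differentials of elements which generate the maximal ideal of a local ring with residue
field `k` generate the module of differentials. -/
theorem span_D_eq_top {k O σ : Type*} [Field k] [CommRing O] [IsLocalRing O] [Algebra k O]
    [Module.Finite O (Ω[O⁄k])] (θ : O →ₐ[k] k) (v : σ → O)
    (hv : IsLocalRing.maximalIdeal O = Ideal.span (Set.range v)) :
    Submodule.span O (Set.range fun i ↦ KaehlerDifferential.D k O (v i)) = ⊤ := by
  set N := Submodule.span O (Set.range fun i ↦ KaehlerDifferential.D k O (v i))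
  set 𝔪 := IsLocalRing.maximalIdeal O
  rw [eq_top_iff]
  refine Submodule.le_of_le_smul_of_le_jacobson_bot (I := 𝔪) Module.Finite.fg_top
    (IsLocalRing.maximalIdeal_le_jacobson _) ?_
  rw [← KaehlerDifferential.span_range_derivation k O, Submodule.span_le]
  rintro _ ⟨a, rfl⟩
  have ha : a - algebraMap k O (θ a) ∈ Ideal.span (Set.range v) := by
    rw [← hv, IsLocalRing.mem_maximalIdeal, mem_nonunits_iff]
    intro hu
    exact (hu.map θ).ne_zero (by rw [map_sub, AlgHom.commutes]; exact sub_self _)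
  have hD : KaehlerDifferential.D k O a = KaehlerDifferential.D k O (a - algebraMap k O (θ a)) := by
    rw [map_sub, Derivation.map_algebraMap, sub_zero]
  rw [SetLike.mem_coe, hD]
  rw [KaehlerDifferential.span_range_derivation k O]
  generalize a - algebraMap k O (θ a) = u at ha
  induction ha using Submodule.span_induction with
  | mem x hx =>
    obtain ⟨i, rfl⟩ := hx
    exact Submodule.mem_sup_left (Submodule.subset_span ⟨i, rfl⟩)
  | zero => rw [map_zero]; exact zero_mem _
  | add x y _ _ hx hy => rw [map_add]; exact add_mem hx hy
  | smul a x hx h =>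
    rw [smul_eq_mul, Derivation.leibniz]
    refine add_mem (Submodule.smul_mem _ _ h) (Submodule.mem_sup_right ?_)
    exact Submodule.smul_mem_smul (hv ▸ hx) trivial

/-- Let `J` be the ideal of a curve which is smooth at the point with maximal ideal `q`, and let
`{z = 0}` be a hypersurface through the point and transversal to the curve. Then `z`
is a member of a system of étale coordinates whose other members generate `J` near the point. -/
theorem exists_etale_coordinates (A : Type) [CommRing A] [Algebra ℂ A] [Algebra.FormallySmooth ℂ A]
    [Algebra.FiniteType ℂ A] (q : Ideal A) [q.IsPrime] (θ : A →ₐ[ℂ] ℂ) (hθ : ∀ a, θ a = 0 ↔ a ∈ q)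
    (J : Ideal A) (hJq : J ≤ q) (z : A) (hzq : z ∈ q)
    (hq : ∀ a ∈ q, ∃ s ∉ q, s * a ∈ J ⊔ Ideal.span {z})
    (hzJ : ∀ s ∉ q, ∀ N : ℕ, s * z ^ N ∉ J) :
    ∃ (ι : Type) (_ : Fintype ι) (_ : DecidableEq ι) (c : Option ι → A) (a : A), a ∉ q ∧
      c none = z ∧ (∀ i, c (some i) ∈ J) ∧
      ((algebraMap A (Localization.Away a)).comp
        (aeval c : MvPolynomial (Option ι) ℂ →ₐ[ℂ] A).toRingHom).Etale ∧
      (∀ j ∈ J, a * j ∈ Ideal.span (Set.range fun i ↦ c (some i))) ∧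
      ∀ j ∈ q, a * j ∈ Ideal.span (Set.range c) := by
  classical
  have : IsNoetherianRing A := Algebra.FiniteType.isNoetherianRing ℂ A
  let O := Localization.AtPrime q
  have : IsNoetherianRing O := IsLocalization.isNoetherianRing q.primeCompl O inferInstance
  have : Algebra.FormallySmooth ℂ O :=
    have := Algebra.FormallySmooth.of_isLocalization (Rₘ := O) q.primeCompl
    Algebra.FormallySmooth.comp ℂ A O
  have : Algebra.EssFiniteType ℂ O :=
    have := Algebra.EssFiniteType.of_isLocalization O q.primeCompl
    Algebra.EssFiniteType.comp ℂ A O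
  have : Module.FinitePresentation O (Ω[O⁄ℂ]) := Module.finitePresentation_of_finite O _
  let θO : O →ₐ[ℂ] ℂ := IsLocalization.liftAlgHom (M := q.primeCompl) (f := θ)
    fun s ↦ isUnit_iff_ne_zero.mpr fun h ↦ s.2 ((hθ _).mp h)
  let v : Option J → A := fun j ↦ j.elim z fun j ↦ j
  have hmap : IsLocalRing.maximalIdeal O = q.map (algebraMap A O) :=
    (Localization.AtPrime.map_eq_maximalIdeal).symm
  have hsat : ∀ I : Ideal A, (∀ a ∈ q, ∃ s ∉ q, s * a ∈ I) →
      q.map (algebraMap A O) ≤ I.map (algebraMap A O) := by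
    intro I hI
    rw [Ideal.map_le_iff_le_comap]
    intro a ha
    obtain ⟨s, hs, hsa⟩ := hI a ha
    rw [Ideal.mem_comap, IsLocalization.algebraMap_mem_map_algebraMap_iff q.primeCompl]
    exact ⟨s, hs, hsa⟩
  have hspan : J ⊔ Ideal.span {z} = Ideal.span (Set.range v) := by
    apply le_antisymm
    · refine sup_le (fun j hj ↦ Ideal.subset_span ⟨some ⟨j, hj⟩, rfl⟩) ?_
      rw [Ideal.span_singleton_le_iff_mem]
      exact Ideal.subset_span ⟨none, rfl⟩
    · rw [Ideal.span_le]
      rintro _ ⟨_ | j, rfl⟩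
      · exact Ideal.mem_sup_right (Ideal.mem_span_singleton_self z)
      · exact Ideal.mem_sup_left j.2
  have hmax : IsLocalRing.maximalIdeal O = Ideal.span (Set.range fun j ↦ algebraMap A O (v j)) := by
    have h1 : Ideal.span (Set.range fun j ↦ algebraMap A O (v j)) =
        (J ⊔ Ideal.span {z}).map (algebraMap A O) := by
      rw [hspan, Ideal.map_span, ← Set.range_comp]
      rfl
    rw [h1, hmap]
    refine le_antisymm (hsat _ hq) (Ideal.map_mono (sup_le hJq ?_))
    rwa [Ideal.span_singleton_le_iff_mem]
  obtain ⟨κ, e, b, hb⟩ := Module.exists_basis_of_span_of_flat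
    (fun j ↦ KaehlerDifferential.D ℂ O (algebraMap A O (v j))) (span_D_eq_top θO _ hmax)
  have hinj : Function.Injective e := fun i j hij ↦ b.injective (by rw [hb, hb, hij])
  -- Coordinates chosen among the elements of `J` and `z` generate the maximal ideal.
  have key : ∀ (τ : Type) (c : τ → A) (bτ : Module.Basis τ O (Ω[O⁄ℂ])),
      (∀ i, bτ i = KaehlerDifferential.D ℂ O (algebraMap A O (c i))) → (∀ i, c i ∈ q) →
      let _ : Algebra (MvPolynomial τ ℂ) A := (aeval c : MvPolynomial τ ℂ →ₐ[ℂ] A).toRingHom.toAlgebra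
      Algebra.IsEtaleAt (MvPolynomial τ ℂ) q ∧
        q.map (algebraMap A O) ≤ (Ideal.span (Set.range c)).map (algebraMap A O) := by
    intro τ c bτ hbτ hcq
    let _ : Algebra (MvPolynomial τ ℂ) A := (aeval c : MvPolynomial τ ℂ →ₐ[ℂ] A).toRingHom.toAlgebra
    have : IsScalarTower ℂ (MvPolynomial τ ℂ) A :=
      IsScalarTower.of_algebraMap_eq fun r ↦ ((aeval (R := ℂ) c).commutes r).symm
    have : IsScalarTower ℂ (MvPolynomial τ ℂ) O := IsScalarTower.of_algebraMap_eq fun r ↦ by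
      rw [IsScalarTower.algebraMap_apply (MvPolynomial τ ℂ) A O,
        ← IsScalarTower.algebraMap_apply ℂ (MvPolynomial τ ℂ) A,
        ← IsScalarTower.algebraMap_apply ℂ A O]
    have hX : ∀ i, algebraMap (MvPolynomial τ ℂ) O (X i) = algebraMap A O (c i) := fun i ↦ by
      rw [IsScalarTower.algebraMap_apply (MvPolynomial τ ℂ) A O]
      exact congrArg _ (aeval_X c i)
    have het : Algebra.FormallyEtale (MvPolynomial τ ℂ) O :=
      formallyEtale_of_basis bτ fun i ↦ by rw [hbτ, hX]
    refine ⟨het, ?_⟩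
    rw [← hmap, maximalIdeal_eq_span_of_formallyUnramified (τ := τ) θO, Ideal.span_le]
    rintro _ ⟨i, rfl⟩
    have h1 : θO (algebraMap A O (c i)) = 0 := by
      refine (IsLocalization.lift_eq _ _).trans ((hθ _).mpr (hcq i))
    simp only [hX, h1, map_zero, sub_zero]
    exact Ideal.mem_map_of_mem _ (Ideal.subset_span ⟨i, rfl⟩)
  have hvq : ∀ j, v j ∈ q := by
    rintro (_ | j)
    exacts [hzq, hJq j.2]
  have hzJ' : ∀ N : ℕ, algebraMap A O z ^ N ∉ J.map (algebraMap A O) := by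
    intro N h
    rw [← map_pow, IsLocalization.algebraMap_mem_map_algebraMap_iff q.primeCompl] at h
    obtain ⟨s, hs, hs'⟩ := h
    exact hzJ s hs N hs'
  have hk : ∃ k, e k = none := by
    by_contra! h
    have h1 := (key κ (fun i ↦ v (e i)) b hb fun i ↦ hvq _).2
    have h2 : Ideal.span (Set.range fun i ↦ v (e i)) ≤ J := by
      rw [Ideal.span_le]
      rintro _ ⟨i, rfl⟩
      obtain ⟨j, hj⟩ := Option.ne_none_iff_exists'.mp (h i)
      simp only [hj]
      exact j.2
    exact hzJ' 1 (by
      rw [pow_one]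
      exact Ideal.map_mono h2 (h1 (Ideal.mem_map_of_mem _ hzq)))
  obtain ⟨k, hk⟩ := hk
  have : Finite κ := Module.Finite.finite_basis b
  let ι := {i : κ // i ≠ k}
  let σ : Option ι ≃ κ := Equiv.optionSubtypeNe k
  let c : Option ι → A := fun i ↦ v (e (σ i))
  have hcnone : c none = z := by
    have : σ none = k := Equiv.optionSubtypeNe_none k
    simp only [c, this, hk, v, Option.elim_none]
  have hcsome : ∀ i, c (some i) ∈ J := by
    intro i
    have h1 : e i.1 ≠ none := fun h ↦ i.2 (hinj (h.trans hk.symm))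
    obtain ⟨j, hj⟩ := Option.ne_none_iff_exists'.mp h1
    have h2 : c (some i) = v (e i.1) := by
      have : σ (some i) = i.1 := Equiv.optionSubtypeNe_some k i
      simp only [c, this]
    rw [h2, hj]
    exact j.2
  obtain ⟨het, hgen⟩ := key (Option ι) c (b.reindex σ.symm)
    (fun i ↦ by rw [Module.Basis.reindex_apply, Equiv.symm_symm, hb]) fun i ↦ hvq _
  let _ : Algebra (MvPolynomial (Option ι) ℂ) A :=
    (aeval c : MvPolynomial (Option ι) ℂ →ₐ[ℂ] A).toRingHom.toAlgebra
  have : IsScalarTower ℂ (MvPolynomial (Option ι) ℂ) A :=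
    IsScalarTower.of_algebraMap_eq fun r ↦ ((aeval (R := ℂ) c).commutes r).symm
  have : Algebra.FiniteType (MvPolynomial (Option ι) ℂ) A :=
    Algebra.FiniteType.of_restrictScalars_finiteType ℂ _ A
  have : Algebra.FinitePresentation (MvPolynomial (Option ι) ℂ) A :=
    Algebra.FinitePresentation.of_finiteType.mp inferInstance
  have := het
  obtain ⟨a₁, ha₁, het₁⟩ := Algebra.exists_etale_of_isEtaleAt (R := MvPolynomial (Option ι) ℂ) q
  obtain ⟨a₂, ha₂, ha₂'⟩ := exists_notMem_mul_mem q q _ hgen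
  obtain ⟨a₃, ha₃, ha₃'⟩ := exists_notMem_mul_mem q J (Ideal.span (Set.range fun i ↦ c (some i))) (by
    refine le_of_pow_notMem _ _ (algebraMap A O z) ?_ ?_ hzJ'
    · have h1 : Ideal.span (Set.range c) =
          Ideal.span (Set.range fun i ↦ c (some i)) ⊔ Ideal.span {z} := by
        apply le_antisymm
        · rw [Ideal.span_le]
          rintro _ ⟨_ | i, rfl⟩
          · rw [hcnone]
            exact Ideal.mem_sup_right (Ideal.mem_span_singleton_self z)
          · exact Ideal.mem_sup_left (Ideal.subset_span ⟨i, rfl⟩)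
        · refine sup_le (Ideal.span_mono ?_) ?_
          · rintro _ ⟨i, rfl⟩
            exact ⟨some i, rfl⟩
          · rw [Ideal.span_singleton_le_iff_mem, ← hcnone]
            exact Ideal.subset_span ⟨none, rfl⟩
      rw [← Set.image_singleton, ← Ideal.map_span, ← Ideal.map_sup, ← h1, hmap]
      refine le_antisymm hgen (Ideal.map_mono ?_)
      rw [Ideal.span_le]
      rintro _ ⟨i, rfl⟩
      exact hvq _
    · refine Ideal.map_mono ?_
      rw [Ideal.span_le]
      rintro _ ⟨i, rfl⟩
      exact hcsome i)
  refine ⟨ι, Fintype.ofFinite ι, inferInstance, c, a₁ * (a₂ * a₃), ?_, hcnone, hcsome, ?_, ?_, ?_⟩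
  · have hp : q.IsPrime := inferInstance
    exact fun h ↦ (hp.mem_or_mem h).elim ha₁ fun h ↦ (hp.mem_or_mem h).elim ha₂ ha₃
  · have h1 : Algebra.Etale (MvPolynomial (Option ι) ℂ)
        (Localization.Away (a₁ * (a₂ * a₃))) := by
      rw [← Algebra.basicOpen_subset_etaleLocus_iff_etale] at het₁ ⊢
      rw [PrimeSpectrum.basicOpen_mul]
      exact Set.inter_subset_left.trans het₁
    have h2 := RingHom.etale_algebraMap.mpr h1
    rwa [IsScalarTower.algebraMap_eq (MvPolynomial (Option ι) ℂ) A] at h2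
  · intro j hj
    rw [← mul_assoc, mul_assoc]
    exact Ideal.mul_mem_left _ _ (ha₃' j hj)
  · intro j hj
    have : a₁ * (a₂ * a₃) * j = (a₁ * a₃) * (a₂ * j) := by ring
    rw [this]
    exact Ideal.mul_mem_left _ _ (ha₂' j hj)

end

/-! ### The leading form along the singular curve -/

section

open MvPolynomial

/-- In étale coordinates there are derivations dual to the coordinates, also on the local rings,
and the shifted coordinates generate the maximal ideals. -/
theorem exists_local_frame {ι : Type} [DecidableEq ι] {A : Type} [CommRing A] [Algebra ℂ A]
    [Algebra (MvPolynomial (Option ι) ℂ) A] [IsScalarTower ℂ (MvPolynomial (Option ι) ℂ) A]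
    [Algebra.FormallyEtale (MvPolynomial (Option ι) ℂ) A] [IsNoetherianRing A]
    (c : Option ι → A) (hc : ∀ i, c i = algebraMap (MvPolynomial (Option ι) ℂ) A (X i))
    (q : Ideal A) [q.IsPrime] (θ : A →ₐ[ℂ] ℂ) (hθ : ∀ a, θ a = 0 ↔ a ∈ q)
    (hq : ∀ i, c (some i) ∈ q) (O : Type) [CommRing O] [Algebra A O] [Algebra ℂ O]
    [IsScalarTower ℂ A O] [IsLocalization.AtPrime O q] [IsLocalRing O] :
    ∃ D : ι → Derivation ℂ O O,
      (∀ i j, D i (algebraMap A O (c (some j))) = if i = j then 1 else 0) ∧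
      (∀ i, D i (algebraMap A O (c none - algebraMap ℂ A (θ (c none)))) = 0) ∧
      IsLocalRing.maximalIdeal O = Ideal.span (Set.range fun i ↦ algebraMap A O (c (some i))) ⊔
        Ideal.span {algebraMap A O (c none - algebraMap ℂ A (θ (c none)))} := by
  let P := MvPolynomial (Option ι) ℂ
  let _ : Algebra P O := ((algebraMap A O).comp (algebraMap P A)).toAlgebra
  have : IsScalarTower P A O := IsScalarTower.of_algebraMap_eq fun _ ↦ rfl
  have : IsScalarTower ℂ P O := IsScalarTower.of_algebraMap_eq fun r ↦ by
    rw [IsScalarTower.algebraMap_apply P A O, ← IsScalarTower.algebraMap_apply ℂ P A,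
      ← IsScalarTower.algebraMap_apply ℂ A O]
  have : Algebra.FormallyEtale A O := Algebra.FormallyEtale.of_isLocalization q.primeCompl
  have : Algebra.FormallyEtale P O := Algebra.FormallyEtale.comp P A O
  have : IsNoetherianRing O := IsLocalization.isNoetherianRing q.primeCompl O inferInstance
  have hX : ∀ i, algebraMap A O (c i) = algebraMap P O (X i) := fun i ↦ by
    rw [hc, ← IsScalarTower.algebraMap_apply]
  let θO : O →ₐ[ℂ] ℂ := IsLocalization.liftAlgHom (M := q.primeCompl) (f := θ)
    fun s ↦ isUnit_iff_ne_zero.mpr fun h ↦ s.2 ((hθ _).mp h)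
  have hθO : ∀ a, θO (algebraMap A O a) = θ a := fun a ↦ IsLocalization.lift_eq _ _
  choose D hD using fun i : ι ↦ exists_derivation_extension ℂ P O (pderiv (some i))
  refine ⟨D, ?_, ?_, ?_⟩
  · intro i j
    rw [hX, hD, pderiv_X]
    by_cases h : i = j
    · subst h
      rw [if_pos rfl, Pi.single_eq_same, map_one]
    · rw [if_neg h, Pi.single_eq_of_ne, map_zero]
      exact fun h' ↦ h (Option.some_injective _ h'.symm)
  · intro i
    rw [map_sub, ← IsScalarTower.algebraMap_apply, map_sub, Derivation.map_algebraMap, hX, hD,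
      pderiv_X, Pi.single_eq_of_ne (by simp), map_zero, sub_zero]
  · rw [maximalIdeal_eq_span_of_formallyUnramified (τ := Option ι) θO]
    have hgen : ∀ i, algebraMap P O (X i) - algebraMap ℂ O (θO (algebraMap P O (X i))) =
        algebraMap A O (c i - algebraMap ℂ A (θ (c i))) := fun i ↦ by
      rw [← hX, hθO, map_sub, ← IsScalarTower.algebraMap_apply]
    have hgen' : ∀ i, algebraMap A O (c (some i) - algebraMap ℂ A (θ (c (some i)))) =
        algebraMap A O (c (some i)) := fun i ↦ by
      rw [(hθ _).mpr (hq i), map_zero, sub_zero]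
    have hgen2 := fun i ↦ hgen i
    apply le_antisymm
    · rw [Ideal.span_le]
      rintro _ ⟨_ | i, rfl⟩
      · exact Ideal.mem_sup_right (by
          rw [Ideal.mem_span_singleton]
          exact dvd_of_eq (hgen none).symm)
      · refine Ideal.mem_sup_left (Ideal.subset_span ⟨i, ?_⟩)
        exact ((hgen (some i)).trans (hgen' i)).symm
    · refine sup_le (Ideal.span_le.mpr ?_) ?_
      · rintro _ ⟨i, rfl⟩
        exact Ideal.subset_span ⟨some i, (hgen (some i)).trans (hgen' i)⟩
      · rw [Ideal.span_singleton_le_iff_mem]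
        exact Ideal.subset_span ⟨none, hgen none⟩

set_option maxHeartbeats 800000 in
/-- If the slices transversal to the curve `{c (some i) = 0}` are ordinary `m`-ple points, then
the hypersurface `{f = 0}` has multiplicity `m` along the curve, and its leading form at each point of
the curve is smooth. -/
theorem exists_smoothForm {ι : Type} [Fintype ι] [DecidableEq ι] {A : Type} [CommRing A]
    [Algebra ℂ A] [Algebra (MvPolynomial (Option ι) ℂ) A]
    [IsScalarTower ℂ (MvPolynomial (Option ι) ℂ) A] [Algebra.Etale (MvPolynomial (Option ι) ℂ) A]
    (c : Option ι → A) (hc : ∀ i, c i = algebraMap (MvPolynomial (Option ι) ℂ) A (X i))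
    (f : A) (m : ℕ) (hrad : (Ideal.span (Set.range fun i ↦ c (some i))).IsRadical)
    (hslice : ∀ (q : Ideal A) (_ : q.IsMaximal), Ideal.span (Set.range fun i ↦ c (some i)) ≤ q →
      ∃ (O : Type) (_ : CommRing O) (_ : IsLocalRing O) (_ : Algebra A O),
        IsLocalization.AtPrime O q ∧ ∀ t : O, IsLocalRing.maximalIdeal O =
          (Ideal.span (Set.range fun i ↦ c (some i))).map (algebraMap A O) ⊔ Ideal.span {t} →
            IsOrdinaryMultiplePoint m (O ⧸ Ideal.span {t})
              ((Ideal.span {algebraMap A O f}).map (Ideal.Quotient.mk (Ideal.span {t}))))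
    (θ : A →ₐ[ℂ] ℂ) (hθ : ∀ a, θ a = 0 ↔ a ∈ Ideal.span (Set.range c)) :
    ∃ F : MvPolynomial ι A, F.IsHomogeneous m ∧ f = eval (fun i ↦ c (some i)) F ∧
      IsSmoothForm (MvPolynomial.map (θ : A →+* ℂ) F) := by
  have : Algebra.FiniteType ℂ A := Algebra.FiniteType.trans
    (S := MvPolynomial (Option ι) ℂ) inferInstance inferInstance
  have : IsNoetherianRing A := Algebra.FiniteType.isNoetherianRing ℂ A
  have : IsJacobsonRing A := isJacobsonRing_of_finiteType (A := ℂ)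
  set y : ι → A := fun i ↦ c (some i) with hy
  set J := Ideal.span (Set.range y) with hJ
  have hyJ : ∀ i, y i ∈ J := fun i ↦ Ideal.subset_span ⟨i, rfl⟩
  have hmap : ∀ (O : Type) [CommRing O] [Algebra A O],
      J.map (algebraMap A O) = Ideal.span (Set.range fun i ↦ algebraMap A O (y i)) := by
    intro O _ _
    rw [Ideal.map_span, ← Set.range_comp]
    rfl
  have heval : ∀ (O : Type) [CommRing O] [Algebra A O] (G : MvPolynomial ι A),
      algebraMap A O (eval y G) =
        eval (fun i ↦ algebraMap A O (y i)) (MvPolynomial.map (algebraMap A O) G) := by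
    intro O _ _ G
    rw [MvPolynomial.eval_map, ← eval₂_id G, eval₂_comp_left, RingHom.comp_id]
    rfl
  -- The multiplicity is computed by induction: a form of degree `n < m` that represents `f` has
  -- coefficients vanishing at all closed points of the curve.
  have hpow : ∀ n ≤ m, f ∈ J ^ n := by
    intro n hn
    induction n with
    | zero => simp
    | succ n ih =>
      obtain ⟨G, hG, hGf⟩ := (Ideal.mem_span_pow_iff_exists_isHomogeneous y f).mp (ih (by omega))
      have hcoeff : ∀ α, G.coeff α ∈ J := by
        intro α
        have hjac : J.jacobson = J := IsJacobsonRing.out inferInstance hrad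
        rw [← hjac, Ideal.jacobson, Ideal.mem_sInf]
        rintro q ⟨hJq, hqm⟩
        obtain ⟨θq, hθq⟩ := exists_algHom_ker_eq A q
        obtain ⟨O, _, _, _, hloc, hO⟩ := hslice q hqm hJq
        let _ : Algebra ℂ O := ((algebraMap A O).comp (algebraMap ℂ A)).toAlgebra
        have : IsScalarTower ℂ A O := IsScalarTower.of_algebraMap_eq fun _ ↦ rfl
        obtain ⟨D, hD, hDt, hmax⟩ := exists_local_frame c hc q θq hθq (fun i ↦ hJq (hyJ i)) O
        set t := algebraMap A O (c none - algebraMap ℂ A (θq (c none)))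
        have h1 := mem_pow_sup_of_isOrdinaryMultiplePoint m _ t (hO t (by rw [hmap]; exact hmax))
        rw [← hGf, heval] at h1
        have h2 := coeff_mem_of_eval_mem (fun i ↦ algebraMap A O (y i)) D hD
          (IsLocalRing.maximalIdeal O) (Ideal.span {t}) ?_ ?_ ?_ n _ (hG.map _)
          ((sup_le_sup_right (Ideal.pow_le_pow_right hn) (Ideal.span {t}) :
            IsLocalRing.maximalIdeal O ^ m ⊔ Ideal.span {t} ≤ _) h1) α
        · rw [coeff_map] at h2
          exact (IsLocalization.AtPrime.to_map_mem_maximal_iff O q _).mp h2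
        · intro i s hs
          obtain ⟨u, rfl⟩ := Ideal.mem_span_singleton'.mp hs
          rw [Derivation.leibniz, hDt, smul_zero, zero_add, smul_eq_mul]
          exact Ideal.mul_mem_right _ _ (Ideal.mem_span_singleton_self t)
        · rw [hmax]
          exact le_sup_right
        · intro i
          exact (IsLocalization.AtPrime.to_map_mem_maximal_iff O q _).mpr (hJq (hyJ i))
      rw [← hGf, eval_eq', pow_succ']
      refine Ideal.sum_mem _ fun α hα ↦ Ideal.mul_mem_mul (hcoeff α) ?_
      have h3 : eval y (monomial α (1 : A)) ∈ J ^ n := by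
        refine eval_mem_pow_of_isHomogeneous (isHomogeneous_monomial _ ?_) hyJ
        have := hG (mem_support_iff.mp hα)
        rw [Finsupp.degree_eq_weight_one]
        exact this
      rwa [eval_monomial, one_mul, Finsupp.prod_fintype _ _ (by simp)] at h3
  obtain ⟨F, hF, hFf⟩ := (Ideal.mem_span_pow_iff_exists_isHomogeneous y f).mp (hpow m le_rfl)
  refine ⟨F, hF, hFf.symm, ?_⟩
  let q := RingHom.ker (θ : A →+* ℂ)
  have hθq : ∀ a, θ a = 0 ↔ a ∈ q := fun a ↦ Iff.rfl
  have hqm : q.IsMaximal := RingHom.ker_isMaximal_of_surjective _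
    fun r ↦ ⟨algebraMap ℂ A r, θ.commutes r⟩
  have hcq : ∀ i, c i ∈ q := fun i ↦ (hθ _).mpr (Ideal.subset_span ⟨i, rfl⟩)
  have hJq : J ≤ q := by
    rw [hJ, Ideal.span_le]
    rintro _ ⟨i, rfl⟩
    exact hcq _
  obtain ⟨O, _, _, _, hloc, hO⟩ := hslice q hqm hJq
  let _ : Algebra ℂ O := ((algebraMap A O).comp (algebraMap ℂ A)).toAlgebra
  have : IsScalarTower ℂ A O := IsScalarTower.of_algebraMap_eq fun _ ↦ rfl
  obtain ⟨D, hD, hDt, hmax⟩ := exists_local_frame c hc q θ hθq (fun i ↦ hcq _) O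
  set t := algebraMap A O (c none - algebraMap ℂ A (θ (c none)))
  let θO : O →ₐ[ℂ] ℂ := IsLocalization.liftAlgHom (M := q.primeCompl) (f := θ)
    fun s ↦ isUnit_iff_ne_zero.mpr fun h ↦ s.2 ((hθq _).mp h)
  have h1 := hO t (by rw [hmap]; exact hmax)
  rw [← hFf, heval] at h1
  have h2 := isSmoothForm_of_slice (fun i ↦ algebraMap A O (y i)) t D hD hDt hmax
    (θO : O →+* ℂ) (fun r ↦ ⟨algebraMap ℂ O r, θO.commutes r⟩) m _ (hF.map _) h1
  rw [MvPolynomial.map_map] at h2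
  have h3 : (θO : O →+* ℂ).comp (algebraMap A O) = (θ : A →+* ℂ) :=
    RingHom.ext fun a ↦ IsLocalization.lift_eq _ _
  rwa [h3] at h2

end

/-! ### Ideal sheaves on spectra -/

/-- The ideal sheaf on `Spec B` attached to an ideal of `B`. -/
def specIdeal {B : Type} [CommRing B] (K : Ideal B) :
    (Spec (CommRingCat.of B)).IdealSheafData :=
  Scheme.IdealSheafData.ofIdealTop (K.comap (Scheme.ΓSpecIso (CommRingCat.of B)).hom.hom)

/-- The morphism of spectra induced by a ring homomorphism. -/
abbrev specMap {B C : Type} [CommRing B] [CommRing C] (φ : B →+* C) :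
    Spec (CommRingCat.of C) ⟶ Spec (CommRingCat.of B) :=
  Spec.map (CommRingCat.ofHom φ)

section

variable {B C : Type} [CommRing B] [CommRing C]

theorem specMap_comp {D : Type} [CommRing D] (φ : B →+* C) (ψ : C →+* D) :
    specMap (ψ.comp φ) = specMap ψ ≫ specMap φ := by
  simp [specMap]

theorem specIdeal_ideal_top (K : Ideal B) :
    (specIdeal K).ideal ⟨⊤, isAffineOpen_top _⟩ =
      K.comap (Scheme.ΓSpecIso (CommRingCat.of B)).hom.hom := by
  exact (Scheme.IdealSheafData.equivOfIsAffine (X := Spec (CommRingCat.of B))).apply_symm_apply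
    (K.comap (Scheme.ΓSpecIso (CommRingCat.of B)).hom.hom)

theorem comap_ΓSpecIso_inv_comap_hom (K : Ideal B) :
    (K.comap (Scheme.ΓSpecIso (CommRingCat.of B)).hom.hom).comap
      (Scheme.ΓSpecIso (CommRingCat.of B)).inv.hom = K := by
  rw [Ideal.comap_comap, ← CommRingCat.hom_comp, Iso.inv_hom_id]
  exact Ideal.comap_id K

theorem comap_ΓSpecIso_hom_comap_inv (K : Ideal Γ(Spec (CommRingCat.of B), ⊤)) :
    (K.comap (Scheme.ΓSpecIso (CommRingCat.of B)).inv.hom).comap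
      (Scheme.ΓSpecIso (CommRingCat.of B)).hom.hom = K := by
  rw [Ideal.comap_comap, ← CommRingCat.hom_comp, Iso.hom_inv_id]
  exact Ideal.comap_id K

theorem exists_eq_specIdeal (I : (Spec (CommRingCat.of B)).IdealSheafData) :
    ∃ K, I = specIdeal K := by
  refine ⟨(I.ideal ⟨⊤, isAffineOpen_top _⟩).comap
    (Scheme.ΓSpecIso (CommRingCat.of B)).inv.hom, ?_⟩
  apply Scheme.IdealSheafData.ext_of_isAffine
  rw [specIdeal_ideal_top, comap_ΓSpecIso_hom_comap_inv]

theorem specIdeal_le_specIdeal_iff {K K' : Ideal B} : specIdeal K ≤ specIdeal K' ↔ K ≤ K' := by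
  constructor
  · intro h
    have h1 := Ideal.comap_mono (f := (Scheme.ΓSpecIso (CommRingCat.of B)).inv.hom)
      (h ⟨⊤, isAffineOpen_top _⟩)
    rwa [specIdeal_ideal_top, specIdeal_ideal_top, comap_ΓSpecIso_inv_comap_hom,
      comap_ΓSpecIso_inv_comap_hom] at h1
  · intro h
    apply Scheme.IdealSheafData.le_of_isAffine
    rw [specIdeal_ideal_top, specIdeal_ideal_top]
    exact Ideal.comap_mono h

theorem specIdeal_injective : Function.Injective (specIdeal (B := B)) := fun _ _ h ↦
  le_antisymm (specIdeal_le_specIdeal_iff.mp h.le) (specIdeal_le_specIdeal_iff.mp h.ge)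

theorem ker_specMap (φ : B →+* C) : (specMap φ).ker = specIdeal (RingHom.ker φ) := by
  rw [Scheme.ker_of_isAffine, specIdeal]
  congr 1
  ext x
  rw [RingHom.mem_ker, Ideal.mem_comap, RingHom.mem_ker]
  have := congr($(Scheme.ΓSpecIso_naturality (CommRingCat.ofHom φ)).hom x)
  simp only [CommRingCat.hom_comp, RingHom.comp_apply] at this
  change _ = φ _ at this
  rw [← this]
  exact (map_eq_zero_iff _ (ConcreteCategory.bijective_of_isIso
    (Scheme.ΓSpecIso (CommRingCat.of C)).hom).1).symm

theorem map_specIdeal (φ : B →+* C) (K : Ideal C) :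
    (specIdeal K).map (specMap φ) = specIdeal (K.comap φ) := by
  have h : specIdeal K = (specMap (Ideal.Quotient.mk K)).ker := by
    rw [ker_specMap, Ideal.mk_ker]
  rw [h, Scheme.IdealSheafData.map_ker, ← specMap_comp, ker_specMap, ← RingHom.comap_ker,
    Ideal.mk_ker]

theorem comap_specIdeal (φ : B →+* C) (K : Ideal B) :
    (specIdeal K).comap (specMap φ) = specIdeal (K.map φ) := by
  obtain ⟨K', h'⟩ := exists_eq_specIdeal ((specIdeal K).comap (specMap φ))
  rw [h']
  congr 1
  apply le_antisymm
  · rw [← specIdeal_le_specIdeal_iff, ← h', ← Scheme.IdealSheafData.le_map_iff_comap_le,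
      map_specIdeal, specIdeal_le_specIdeal_iff]
    exact Ideal.le_comap_map
  · rw [Ideal.map_le_iff_le_comap, ← specIdeal_le_specIdeal_iff, ← map_specIdeal,
      Scheme.IdealSheafData.le_map_iff_comap_le, h']

theorem support_specIdeal (K : Ideal B) :
    ((specIdeal K).support : Set (Spec (CommRingCat.of B))) = PrimeSpectrum.zeroLocus K := by
  have h : specIdeal K = (specMap (Ideal.Quotient.mk K)).ker := by
    rw [ker_specMap, Ideal.mk_ker]
  rw [h, Scheme.Hom.support_ker]
  have h2 : Set.range (specMap (Ideal.Quotient.mk K)) = PrimeSpectrum.zeroLocus K :=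
    (range_comap_of_surjective _ _ Ideal.Quotient.mk_surjective).trans
      (by rw [Ideal.mk_ker])
  rw [h2]
  exact (PrimeSpectrum.isClosed_zeroLocus _).closure_eq

theorem ideal_comap_eq_map_appLE {X Y : Scheme.{0}} (I : Y.IdealSheafData) (f : X ⟶ Y)
    [IsOpenImmersion f] (W : X.affineOpens) (U : Y.affineOpens)
    (h : (W : X.Opens) ≤ f ⁻¹ᵁ (U : Y.Opens)) :
    (I.comap f).ideal W = (I.ideal U).map (f.appLE U W h).hom := by
  rw [Scheme.IdealSheafData.ideal_comap_of_isOpenImmersion]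
  have hle : (⟨f ''ᵁ W, W.2.image_of_isOpenImmersion f⟩ : Y.affineOpens) ≤ U := by
    change f ''ᵁ W ≤ (U : Y.Opens)
    exact (f.image_mono h).trans (Set.image_preimage_subset f _)
  rw [← I.map_ideal hle]
  have hr : f.appLE U W h =
      Y.presheaf.map (homOfLE hle).op ≫ (f.appIso W).hom := by
    rw [Scheme.Hom.appIso_hom', Scheme.Hom.map_appLE]
  rw [hr, CommRingCat.hom_comp, ← Ideal.map_map]
  set K := (I.ideal U).map (Y.presheaf.map (homOfLE hle).op).hom
  exact Ideal.comap_symm (f := (f.appIso W).commRingCatIsoToRingEquiv) (I := K)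

/-- The inclusion of an affine open set, as a morphism from the spectrum of its ring of sections. -/
def affineInclusion {X : Scheme.{0}} (U : X.affineOpens) :
    Spec (CommRingCat.of Γ(X, (U : X.Opens))) ⟶ X :=
  U.2.fromSpec

instance {X : Scheme.{0}} (U : X.affineOpens) : IsOpenImmersion (affineInclusion U) :=
  IsAffineOpen.isOpenImmersion_fromSpec U.2

theorem range_affineInclusion {X : Scheme.{0}} (U : X.affineOpens) :
    Set.range (affineInclusion U) = (U : X.Opens) :=
  U.2.range_fromSpec

theorem fromSpec_appLE_top {X : Scheme.{0}} {U : X.Opens} (hU : IsAffineOpen U)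
    (h : ⊤ ≤ hU.fromSpec ⁻¹ᵁ U) :
    hU.fromSpec.appLE U ⊤ h = (Scheme.ΓSpecIso Γ(X, U)).inv := by
  rw [Scheme.Hom.appLE, IsAffineOpen.fromSpec_app_self, Category.assoc, ← Functor.map_comp]
  exact (congrArg _ (CategoryTheory.Functor.map_id _ _)).trans (Category.comp_id _)

theorem comap_affineInclusion {X : Scheme.{0}} (I : X.IdealSheafData) (U : X.affineOpens) :
    I.comap (affineInclusion U) = specIdeal (I.ideal U) := by
  have hle : (⊤ : (Spec (CommRingCat.of Γ(X, (U : X.Opens)))).Opens) ≤ affineInclusion U ⁻¹ᵁ U :=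
    U.2.fromSpec_preimage_self.ge
  apply Scheme.IdealSheafData.ext_of_isAffine
  rw [ideal_comap_eq_map_appLE I (affineInclusion U) ⟨⊤, isAffineOpen_top _⟩ U hle,
    specIdeal_ideal_top]
  have h2 : (affineInclusion U).appLE U ⊤ hle =
      (Scheme.ΓSpecIso (CommRingCat.of Γ(X, (U : X.Opens)))).inv := fromSpec_appLE_top U.2 hle
  rw [h2]
  exact (Ideal.comap_symm
    (f := (Scheme.ΓSpecIso (CommRingCat.of Γ(X, (U : X.Opens)))).symm.commRingCatIsoToRingEquiv)
    (I := I.ideal U)).symm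

/-- The pullback of an ideal sheaf to the spectrum of a ring, computed on an affine open set through
which the morphism factors. -/
theorem comap_eq_specIdeal {X : Scheme.{0}} (I : X.IdealSheafData) (U : X.affineOpens)
    (φ : Γ(X, (U : X.Opens)) →+* B) :
    I.comap (specMap φ ≫ affineInclusion U) = specIdeal ((I.ideal U).map φ) := by
  rw [Scheme.IdealSheafData.comap_comp, comap_affineInclusion]
  exact comap_specIdeal φ _

/-- A morphism from the spectrum of a ring whose range lies in an affine open set factors through
the spectrum of the ring of sections. -/
theorem exists_specMap_comp_affineInclusion {X : Scheme.{0}} (U : X.affineOpens)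
    (r : Spec (CommRingCat.of B) ⟶ X) (h : Set.range r ⊆ (U : X.Opens)) :
    ∃ φ : Γ(X, (U : X.Opens)) →+* B, specMap φ ≫ affineInclusion U = r := by
  have h' : Set.range r ⊆ Set.range (affineInclusion U) := by rwa [range_affineInclusion]
  refine ⟨(Spec.preimage (IsOpenImmersion.lift (affineInclusion U) r h')).hom, ?_⟩
  have : specMap (Spec.preimage (IsOpenImmersion.lift (affineInclusion U) r h')).hom =
      IsOpenImmersion.lift (affineInclusion U) r h' := Spec.map_preimage _
  rw [this, IsOpenImmersion.lift_fac]

theorem bijective_of_isIso_specMap (φ : B →+* C) [h : IsIso (specMap φ)] :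
    Function.Bijective φ := by
  have : IsIso (Scheme.Spec.map (CommRingCat.ofHom φ).op) := h
  have := isIso_of_reflects_iso (CommRingCat.ofHom φ).op Scheme.Spec
  have : IsIso (CommRingCat.ofHom φ) := (isIso_op_iff _).mp this
  exact ConcreteCategory.bijective_of_isIso (CommRingCat.ofHom φ)

/-- An open immersion from a spectrum identifies its ring with the sections over its range. -/
theorem exists_affineOpen_of_isOpenImmersion {X : Scheme.{0}} (r : Spec (CommRingCat.of B) ⟶ X)
    [hr : IsOpenImmersion r] :
    ∃ (U : X.affineOpens) (φ : Γ(X, (U : X.Opens)) →+* B),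
      Set.range r = (U : X.Opens) ∧ Function.Bijective φ ∧ IsIso (specMap φ) ∧
        specMap φ ≫ affineInclusion U = r := by
  let U : X.affineOpens := ⟨r.opensRange, isAffineOpen_opensRange _⟩
  obtain ⟨φ, hφ⟩ := exists_specMap_comp_affineInclusion U r subset_rfl
  have h1 : IsOpenImmersion (specMap φ ≫ affineInclusion U) := hφ ▸ hr
  have h2 : IsOpenImmersion (specMap φ) := IsOpenImmersion.of_comp _ (affineInclusion U)
  have h3 : Epi (specMap φ).base := by
    rw [TopCat.epi_iff_surjective]
    intro y
    have hy : affineInclusion U y ∈ Set.range r := by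
      have := Set.mem_range_self (f := affineInclusion U) y
      rwa [range_affineInclusion] at this
    obtain ⟨z, hz⟩ := hy
    refine ⟨z, (affineInclusion U).isOpenEmbedding.injective ?_⟩
    rw [← hz]
    conv_rhs => rw [← hφ]
    exact (Scheme.Hom.comp_apply _ _ _).symm
  have : IsIso (specMap φ) := IsOpenImmersion.isIso _
  exact ⟨U, φ, rfl, bijective_of_isIso_specMap φ, this, hφ⟩

/-- Ideal sheaves that agree on the members of an open cover are equal. -/
theorem idealSheaf_ext {X : Scheme.{0}} {I J : X.IdealSheafData}
    (h : ∀ x : X, ∃ (B : Type) (_ : CommRing B) (r : Spec (CommRingCat.of B) ⟶ X)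
      (_ : IsOpenImmersion r), x ∈ Set.range r ∧ I.comap r = J.comap r) : I = J := by
  have h' : ∀ x : X, ∃ U : X.affineOpens, x ∈ (U : X.Opens) ∧ I.ideal U = J.ideal U := by
    intro x
    obtain ⟨B, _, r, _, hx, h⟩ := h x
    obtain ⟨U, φ, hU, hb, -, hφ⟩ := exists_affineOpen_of_isOpenImmersion r
    refine ⟨U, hU.le hx, ?_⟩
    rw [← hφ, comap_eq_specIdeal, comap_eq_specIdeal] at h
    have h6 : ∀ K : Ideal Γ(X, (U : X.Opens)), (K.map φ).comap φ = K := fun K ↦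
      Ideal.comap_map_of_bijective φ hb
    rw [← h6 (I.ideal U), ← h6 (J.ideal U), specIdeal_injective h]
  choose U hU h' using h'
  refine Scheme.IdealSheafData.ext_of_iSup_eq_top U ?_ h'
  rw [eq_top_iff]
  intro x _
  exact Opens.mem_iSup.mpr ⟨x, hU x⟩

end

/-! ### Ideal sheaves with local equations -/

section

variable {X : Scheme.{0}}

theorem germ_restrictFun {U V : X.Opens} (hVU : V ≤ U) {x : X} (hx : x ∈ V) (a : Γ(X, U)) :
    (X.presheaf.germ V x hx).hom (restrictFun hVU a) = (X.presheaf.germ U x (hVU hx)).hom a :=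
  X.presheaf.germ_res_apply (homOfLE hVU) x hx a

theorem restrictFun_restrictFun {U V W : X.Opens} (hVU : V ≤ U) (hWV : W ≤ V) (a : Γ(X, U)) :
    restrictFun hWV (restrictFun hVU a) = restrictFun (hWV.trans hVU) a := by
  simp only [restrictFun, ← RingHom.comp_apply, ← CommRingCat.hom_comp, ← Functor.map_comp,
    ← op_comp, homOfLE_comp]

/-- The sections over `U` whose germs lie in prescribed ideals of the stalks. -/
def idealOfGerms (K : ∀ x : X, Ideal (X.presheaf.stalk x)) (U : X.Opens) : Ideal Γ(X, U) :=
  ⨅ (x : X) (hx : x ∈ U), (K x).comap (X.presheaf.germ U x hx).hom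

theorem mem_idealOfGerms {K : ∀ x : X, Ideal (X.presheaf.stalk x)} {U : X.Opens} {b : Γ(X, U)} :
    b ∈ idealOfGerms K U ↔ ∀ (x : X) (hx : x ∈ U), (X.presheaf.germ U x hx).hom b ∈ K x := by
  simp only [idealOfGerms, Ideal.mem_iInf, Ideal.mem_comap]

/-- The ideals on the stalks are generated, near every point, by the germs of one section. -/
def IsLocallyPrincipal (K : ∀ x : X, Ideal (X.presheaf.stalk x)) : Prop :=
  ∀ (V : X.Opens) (x : X), x ∈ V → ∃ (W : X.Opens) (_ : IsAffineOpen W), W ≤ V ∧ x ∈ W ∧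
    ∃ a : Γ(X, W), ∀ (y : X) (hy : y ∈ W), K y = Ideal.span {(X.presheaf.germ W y hy).hom a}

theorem map_idealOfGerms {K : ∀ x : X, Ideal (X.presheaf.stalk x)} (hK : IsLocallyPrincipal K)
    {U : X.Opens} (hU : IsAffineOpen U) (f : Γ(X, U)) :
    (idealOfGerms K U).map (restrictFun (X.basicOpen_le f)) = idealOfGerms K (X.basicOpen f) := by
  have hle : X.basicOpen f ≤ U := X.basicOpen_le f
  apply le_antisymm
  · rw [Ideal.map_le_iff_le_comap]
    intro b hb
    rw [mem_idealOfGerms] at hb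
    rw [Ideal.mem_comap, mem_idealOfGerms]
    intro x hx
    rw [germ_restrictFun]
    exact hb x (hle hx)
  · intro b hb
    rw [mem_idealOfGerms] at hb
    have := hU.isLocalization_basicOpen f
    obtain ⟨⟨b', ⟨_, n, rfl⟩⟩, hb'⟩ := IsLocalization.surj (Submonoid.powers f) b
    have hb'2 : b * restrictFun hle (f ^ n) = restrictFun hle b' := hb'
    -- near each point of `U` some power of `f` times `b'` satisfies the condition
    have key : ∀ x : U, ∃ (W : X.Opens) (N : ℕ), W ≤ U ∧ x.1 ∈ W ∧
        ∀ (y : X) (hy : y ∈ U), y ∈ W →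
          (X.presheaf.germ U y hy).hom (f ^ N * b') ∈ K y := by
      intro x
      obtain ⟨W, hWa, hWU, hxW, a, ha⟩ := hK U x x.2
      have hW := hWa.isLocalization_basicOpen (restrictFun hWU f)
      have hle' : X.basicOpen (restrictFun hWU f) ≤ W := X.basicOpen_le _
      have hle2 : X.basicOpen (restrictFun hWU f) ≤ X.basicOpen f := by
        rw [restrictFun, X.basicOpen_res]
        exact inf_le_right
      have h1 : restrictFun hle' (restrictFun hWU b') ∈
          (Ideal.span {a}).map (restrictFun hle') := by
        rw [(hWa.basicOpen (restrictFun hWU f)).mem_ideal_iff]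
        intro y hy
        have h2 : (X.presheaf.germ _ y hy).hom (restrictFun hle' (restrictFun hWU b')) ∈ K y := by
          rw [germ_restrictFun, germ_restrictFun, ← germ_restrictFun hle (hle2 hy), ← hb'2,
            map_mul]
          exact Ideal.mul_mem_right _ _ (hb y (hle2 hy))
        rw [ha y (hle' hy)] at h2
        rw [Ideal.map_map, Ideal.map_span, Set.image_singleton, RingHom.comp_apply,
          germ_restrictFun]
        exact h2
      obtain ⟨_, ⟨N, rfl⟩, hN⟩ := (IsLocalization.algebraMap_mem_map_algebraMap_iff
        (Submonoid.powers (restrictFun hWU f)) _ _ _).mp h1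
      refine ⟨W, N, hWU, hxW, fun y hy hyW ↦ ?_⟩
      rw [ha y hyW, ← germ_restrictFun hWU hyW, map_mul, map_pow]
      have := Ideal.mem_map_of_mem (X.presheaf.germ W y hyW).hom hN
      rwa [Ideal.map_span, Set.image_singleton] at this
    choose W N hWU hxW hN using key
    classical
    obtain ⟨t, ht⟩ := hU.isCompact.elim_nhds_subcover (fun x ↦ if hx : x ∈ U then
      (W ⟨x, hx⟩ : Set X) else Set.univ) (fun x hx ↦ by
        rw [dif_pos (show x ∈ U from hx)]
        exact (W ⟨x, hx⟩).2.mem_nhds (hxW ⟨x, hx⟩))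
    let M := ∑ x ∈ t.attach, N ⟨x.1, ht.1 x.1 x.2⟩
    have hM : f ^ M * b' ∈ ⨅ (x : X) (hx : x ∈ U),
        (K x).comap (X.presheaf.germ U x hx).hom := by
      simp only [Ideal.mem_iInf, Ideal.mem_comap]
      intro y hy
      obtain ⟨x, hx, hyx⟩ := Set.mem_iUnion₂.mp (ht.2 hy)
      rw [dif_pos (show x ∈ U from ht.1 x hx)] at hyx
      have hle : N ⟨x, ht.1 x hx⟩ ≤ M :=
        Finset.single_le_sum (f := fun x : t ↦ N ⟨x.1, ht.1 x.1 x.2⟩)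
          (fun _ _ ↦ Nat.zero_le _) (Finset.mem_attach t ⟨x, hx⟩)
      rw [← Nat.sub_add_cancel hle, pow_add, mul_assoc, map_mul]
      exact Ideal.mul_mem_left _ _ (hN _ y hy hyx)
    have h3 := Ideal.mem_map_of_mem (restrictFun hle) hM
    have hu : IsUnit (restrictFun hle f) :=
      IsLocalization.map_units (M := Submonoid.powers f) _ ⟨f, 1, pow_one f⟩
    rw [map_mul, ← hb'2, map_pow, map_pow, mul_left_comm, ← pow_add] at h3
    exact (Ideal.mul_unit_mem_iff_mem _ (hu.pow _)).mp h3

/-- Locally principal ideals on the stalks define an ideal sheaf. -/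
def idealOfStalks (K : ∀ x : X, Ideal (X.presheaf.stalk x)) (hK : IsLocallyPrincipal K) :
    X.IdealSheafData where
  ideal U := idealOfGerms K U
  map_ideal_basicOpen U f := map_idealOfGerms hK U.2 f

theorem idealOfGerms_eq_span {K : ∀ x : X, Ideal (X.presheaf.stalk x)} {U : X.Opens}
    (hU : IsAffineOpen U) {a : Γ(X, U)}
    (ha : ∀ (y : X) (hy : y ∈ U), K y = Ideal.span {(X.presheaf.germ U y hy).hom a}) :
    idealOfGerms K U = Ideal.span {a} := by
  ext b
  rw [hU.mem_ideal_iff (I := Ideal.span {a}), mem_idealOfGerms]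
  refine forall₂_congr fun x hx ↦ ?_
  rw [ha x hx, Ideal.map_span, Set.image_singleton]

/-- If the local equations of a family are unique up to units and exist locally, the ideal sheaf
defined by them is generated by the local equations. -/
theorem ideal_ofLocalEquations {E : ∀ W : X.affineOpens, Set Γ(X, W)}
    (hcover : ∀ (V : X.Opens) (x : X), x ∈ V → ∃ W : X.affineOpens,
      (W : X.Opens) ≤ V ∧ x ∈ (W : X.Opens) ∧ (E W).Nonempty)
    (hassoc : ∀ (W W' : X.affineOpens), ∀ a ∈ E W, ∀ a' ∈ E W', ∀ (x : X)
      (hx : x ∈ (W : X.Opens)) (hx' : x ∈ (W' : X.Opens)),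
      (X.presheaf.germ (W : X.Opens) x hx).hom a ∣ (X.presheaf.germ (W' : X.Opens) x hx').hom a')
    (W : X.affineOpens) (a : Γ(X, W)) (ha : a ∈ E W) :
    (ofLocalEquations E).ideal W = Ideal.span {a} := by
  have hc := fun x : X ↦ hcover ⊤ x trivial
  choose W₀ _ hx₀ ha₀ using hc
  choose a₀ ha₀ using ha₀
  let K : ∀ x : X, Ideal (X.presheaf.stalk x) := fun x ↦
    Ideal.span {(X.presheaf.germ (W₀ x : X.Opens) x (hx₀ x)).hom (a₀ x)}
  have hKe : ∀ (W : X.affineOpens) (a : Γ(X, (W : X.Opens))), a ∈ E W →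
      ∀ (y : X) (hy : y ∈ (W : X.Opens)),
        K y = Ideal.span {(X.presheaf.germ (W : X.Opens) y hy).hom a} := by
    intro W a ha y hy
    apply le_antisymm
    · exact Ideal.span_singleton_le_span_singleton.mpr (hassoc _ _ _ ha _ (ha₀ y) y hy (hx₀ y))
    · exact Ideal.span_singleton_le_span_singleton.mpr (hassoc _ _ _ (ha₀ y) _ ha y (hx₀ y) hy)
  have hK : IsLocallyPrincipal K := by
    intro V x hx
    obtain ⟨W, hW, hxW, a, ha⟩ := hcover V x hx
    exact ⟨W, W.2, hW, hxW, a, hKe W a ha⟩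
  have hJ : ∀ (W : X.affineOpens) (a : Γ(X, (W : X.Opens))), a ∈ E W →
      (idealOfStalks K hK).ideal W = Ideal.span {a} := fun W a ha ↦
    idealOfGerms_eq_span W.2 (hKe W a ha)
  apply le_antisymm
  · intro b hb
    have h1 := Scheme.IdealSheafData.ideal_ofIdeals_le _ W hb
    simp only [Ideal.mem_iInf, Ideal.mem_comap] at h1
    have h2 := h1 W le_rfl a ha
    have h3 : restrictFun (le_refl (W : X.Opens)) b = b := congr($(X.presheaf.map_id _).hom b)
    rwa [h3] at h2
  · rw [← hJ W a ha]
    have h : idealOfStalks K hK ≤ ofLocalEquations E := by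
      rw [ofLocalEquations, Scheme.IdealSheafData.le_ofIdeals_iff]
      intro U
      refine le_iInf₂ fun W hWU ↦ le_iInf₂ fun a ha ↦ ?_
      rw [← hJ W a ha]
      exact Scheme.IdealSheafData.ideal_le_comap_ideal _ hWU
    exact h W

end

/-! ### Pulling back sections to spectra -/

section

variable {B C : Type} [CommRing B] [CommRing C] {X Y : Scheme.{0}}

/-- The pullback of sections over `U` along a morphism from a spectrum to `U`. -/
def pullbackSections (r : Spec (CommRingCat.of B) ⟶ X) (U : X.Opens) (h : ⊤ ≤ r ⁻¹ᵁ U) :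
    Γ(X, U) →+* B :=
  (r.appLE U ⊤ h ≫ (Scheme.ΓSpecIso (CommRingCat.of B)).hom).hom

theorem pullbackSections_restrictFun (r : Spec (CommRingCat.of B) ⟶ X) {U V : X.Opens}
    (hVU : V ≤ U) (h : ⊤ ≤ r ⁻¹ᵁ V) (a : Γ(X, U)) :
    pullbackSections r V h (restrictFun hVU a) =
      pullbackSections r U (h.trans (r.preimage_mono hVU)) a := by
  have : X.presheaf.map (homOfLE hVU).op ≫ r.appLE V ⊤ h = r.appLE U ⊤ _ :=
    Scheme.Hom.map_appLE _ _ _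
  simp only [pullbackSections, restrictFun, ← this]
  rfl

theorem pullbackSections_comp (r : Spec (CommRingCat.of B) ⟶ X) (f : X ⟶ Y) {U : Y.Opens}
    {W : X.Opens} (hWU : W ≤ f ⁻¹ᵁ U) (h : ⊤ ≤ r ⁻¹ᵁ W) (h' : ⊤ ≤ (r ≫ f) ⁻¹ᵁ U) (a : Γ(Y, U)) :
    pullbackSections (r ≫ f) U h' a = pullbackSections r W h ((f.appLE U W hWU).hom a) := by
  have : f.appLE U W hWU ≫ r.appLE W ⊤ h = (r ≫ f).appLE U ⊤ h' :=
    Scheme.Hom.appLE_comp_appLE _ _ _ _ _ _ _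
  simp only [pullbackSections, ← this]
  rfl

theorem pullbackSections_specMap (r : Spec (CommRingCat.of B) ⟶ X) (φ : B →+* C) {U : X.Opens}
    (h : ⊤ ≤ r ⁻¹ᵁ U) (h' : ⊤ ≤ (specMap φ ≫ r) ⁻¹ᵁ U) (a : Γ(X, U)) :
    pullbackSections (specMap φ ≫ r) U h' a = φ (pullbackSections r U h a) := by
  have h1 : r.appLE U ⊤ h ≫ (specMap φ).appLE ⊤ ⊤ le_top = (specMap φ ≫ r).appLE U ⊤ h' :=
    Scheme.Hom.appLE_comp_appLE _ _ _ _ _ _ _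
  have h2 : (specMap φ).appLE ⊤ ⊤ le_top ≫ (Scheme.ΓSpecIso (CommRingCat.of C)).hom =
      (Scheme.ΓSpecIso (CommRingCat.of B)).hom ≫ CommRingCat.ofHom φ := by
    rw [← Scheme.ΓSpecIso_naturality]
    congr 1
  simp only [pullbackSections, ← h1, Category.assoc, h2]
  rfl

theorem top_le_preimage_affineInclusion (U : X.affineOpens) :
    ⊤ ≤ affineInclusion U ⁻¹ᵁ (U : X.Opens) :=
  U.2.fromSpec_preimage_self.ge

theorem pullbackSections_affineInclusion (U : X.affineOpens) (a : Γ(X, (U : X.Opens))) :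
    pullbackSections (affineInclusion U) U (top_le_preimage_affineInclusion U) a = a := by
  have h : (affineInclusion U).appLE U ⊤ (top_le_preimage_affineInclusion U) =
    (Scheme.ΓSpecIso (CommRingCat.of Γ(X, (U : X.Opens)))).inv := fromSpec_appLE_top U.2 _
  simp only [pullbackSections, h, Iso.inv_hom_id]
  rfl

theorem specMap_pullbackSections (r : Spec (CommRingCat.of B) ⟶ X) (U : X.affineOpens)
    (h : ⊤ ≤ r ⁻¹ᵁ (U : X.Opens)) :
    specMap (pullbackSections r U h) ≫ affineInclusion U = r := by
  obtain ⟨φ, hφ⟩ := exists_specMap_comp_affineInclusion U r (by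
    rintro _ ⟨x, rfl⟩
    exact h (Set.mem_univ x))
  have : pullbackSections r U h = φ := by
    subst hφ
    ext a
    rw [pullbackSections_specMap _ _ (top_le_preimage_affineInclusion U),
      pullbackSections_affineInclusion]
  rw [this, hφ]

theorem comap_eq_specIdeal_map (I : X.IdealSheafData) (r : Spec (CommRingCat.of B) ⟶ X)
    (U : X.affineOpens) (h : ⊤ ≤ r ⁻¹ᵁ (U : X.Opens)) :
    I.comap r = specIdeal ((I.ideal U).map (pullbackSections r U h)) := by
  rw [← comap_eq_specIdeal, specMap_pullbackSections]

end

/-! ### Generators of invertible sheaves -/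

section

variable {Y : Scheme.{0}} {L : Y.Modules}

theorem restrictSection_restrictSection {U V W : Y.Opens} (hVU : V ≤ U) (hWV : W ≤ V)
    (s : Γ(L, U)) :
    restrictSection L hWV (restrictSection L hVU s) = restrictSection L (hWV.trans hVU) s := by
  simp only [restrictSection, ← ConcreteCategory.comp_apply, ← Functor.map_comp, ← op_comp,
    homOfLE_comp]

theorem restrictSection_smul {U V : Y.Opens} (hVU : V ≤ U) (a : Γ(Y, U)) (s : Γ(L, U)) :
    restrictSection L hVU (a • s) = restrictFun hVU a • restrictSection L hVU s :=
  L.map_smul (homOfLE hVU) a s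

theorem IsLocalGenerator.restrict {U V : Y.Opens} {e : Γ(L, U)} (he : IsLocalGenerator L e)
    (hVU : V ≤ U) : IsLocalGenerator L (restrictSection L hVU e) := by
  intro W hWV
  simp only [restrictSection_restrictSection]
  exact he W (hWV.trans hVU)

theorem IsLocalGenerator.exists_smul_eq {U V : Y.Opens} {e : Γ(L, U)} (he : IsLocalGenerator L e)
    (hVU : V ≤ U) (s : Γ(L, V)) : ∃ a : Γ(Y, V), s = a • restrictSection L hVU e :=
  ((he V hVU).2 s).imp fun _ h ↦ h.symm

/-- Coefficients with respect to two generators differ by a common factor. -/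
theorem exists_transition {V V' : Y.Opens} (e : Γ(L, V)) {e' : Γ(L, V')}
    (he' : IsLocalGenerator L e') :
    ∃ v : Γ(Y, V ⊓ V'), ∀ (f : Γ(L, ⊤)) (a : Γ(Y, V)) (a' : Γ(Y, V')),
      restrictSection L le_top f = a • e → restrictSection L le_top f = a' • e' →
      restrictFun inf_le_right a' = restrictFun inf_le_left a * v := by
  obtain ⟨v, hv⟩ := he'.exists_smul_eq inf_le_right (restrictSection L (inf_le_left : V ⊓ V' ≤ V) e)
  refine ⟨v, fun f a a' h h' ↦ ?_⟩
  apply (he' _ (inf_le_right : V ⊓ V' ≤ V')).1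
  simp only
  rw [← restrictSection_smul, ← h', mul_smul, ← hv, ← restrictSection_smul, ← h,
    restrictSection_restrictSection, restrictSection_restrictSection]

/-- The zero scheme of a section, over an affine open set with a generator. -/
theorem ideal_zeroIdeal (hL : IsInvertible L) (f : Γ(L, ⊤)) (W : Y.affineOpens)
    {e : Γ(L, (W : Y.Opens))} (he : IsLocalGenerator L e) {a : Γ(Y, (W : Y.Opens))}
    (ha : restrictSection L le_top f = a • e) : (zeroIdeal f).ideal W = Ideal.span {a} := by
  refine ideal_ofLocalEquations ?_ ?_ W a ⟨e, he, ha⟩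
  · intro V x hx
    obtain ⟨V', e', hx', he'⟩ := hL x
    obtain ⟨_, ⟨W, hW, rfl⟩, hxW, hWV⟩ := Y.isBasis_affineOpens.exists_subset_of_mem_open
      (show x ∈ ((V ⊓ V' : Y.Opens) : Set Y) from ⟨hx, hx'⟩) (V ⊓ V').2
    have hWV' : W ≤ V ⊓ V' := hWV
    obtain ⟨a', ha'⟩ := he'.exists_smul_eq (hWV'.trans inf_le_right) (restrictSection L le_top f)
    exact ⟨⟨W, hW⟩, hWV'.trans inf_le_left, hxW, a', _, he'.restrict _, ha'⟩
  · rintro W W' a ⟨e, he, ha⟩ a' ⟨e', he', ha'⟩ x hx hx'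
    obtain ⟨v, hv⟩ := exists_transition e he'
    have hx2 : x ∈ (W : Y.Opens) ⊓ W' := ⟨hx, hx'⟩
    rw [← germ_restrictFun inf_le_left hx2, ← germ_restrictFun (U := (W' : Y.Opens)) inf_le_right hx2,
      hv f a a' ha ha', map_mul]
    exact dvd_mul_right _ _

theorem restrictFun_proj_app {V : Y.Opens} {W : (timesLine Y).Opens} (h : W ≤ proj Y ⁻¹ᵁ V)
    (a : Γ(Y, V)) : restrictFun h ((proj Y).app V a) = ((proj Y).appLE V W h).hom a := rfl

theorem restrictFun_appLE_proj {V V' : Y.Opens} {W W' : (timesLine Y).Opens} (h : W ≤ proj Y ⁻¹ᵁ V)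
    (h' : W' ≤ proj Y ⁻¹ᵁ V') (hV : V' ≤ V) (hW : W' ≤ W) (a : Γ(Y, V)) :
    restrictFun hW (((proj Y).appLE V W h).hom a) =
      ((proj Y).appLE V' W' h').hom (restrictFun hV a) := by
  have h1 : (proj Y).appLE V W h ≫ (timesLine Y).presheaf.map (homOfLE hW).op =
    (proj Y).appLE V W' (hW.trans h) := Scheme.Hom.appLE_map _ _ _
  have h2 : Y.presheaf.map (homOfLE hV).op ≫ (proj Y).appLE V' W' h' =
    (proj Y).appLE V W' (hW.trans h) := Scheme.Hom.map_appLE _ _ _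
  have h3 := h1.trans h2.symm
  exact congr($(h3).hom a)

/-- The total space of the pencil, over an affine open set of the product with the line that lies
over an open set with a generator. -/
theorem ideal_pencilIdeal (hL : IsInvertible L) (f g : Γ(L, ⊤)) (W : (timesLine Y).affineOpens)
    {V : Y.Opens} (hWV : (W : (timesLine Y).Opens) ≤ proj Y ⁻¹ᵁ V)
    {e : Γ(L, V)} (he : IsLocalGenerator L e) {a b : Γ(Y, V)}
    (ha : restrictSection L le_top f = a • e) (hb : restrictSection L le_top g = b • e) :
    (pencilIdeal f g).ideal W = Ideal.span {((proj Y).appLE V W hWV).hom a +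
      restrictFun le_top (lineCoord Y) * ((proj Y).appLE V W hWV).hom b} := by
  refine ideal_ofLocalEquations ?_ ?_ W _ ⟨V, hWV, e, a, b, he, ha, hb, rfl⟩
  · intro V₀ x hx
    obtain ⟨V', e', hx', he'⟩ := hL (proj Y x)
    obtain ⟨_, ⟨W, hW, rfl⟩, hxW, hWV⟩ :=
      (timesLine Y).isBasis_affineOpens.exists_subset_of_mem_open
      (show x ∈ ((V₀ ⊓ proj Y ⁻¹ᵁ V' : (timesLine Y).Opens) : Set (timesLine Y)) from ⟨hx, hx'⟩)
        (V₀ ⊓ proj Y ⁻¹ᵁ V').2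
    have hWV' : W ≤ V₀ ⊓ proj Y ⁻¹ᵁ V' := hWV
    obtain ⟨a', ha'⟩ := he'.exists_smul_eq le_rfl (restrictSection L le_top f)
    obtain ⟨b', hb'⟩ := he'.exists_smul_eq le_rfl (restrictSection L le_top g)
    exact ⟨⟨W, hW⟩, hWV'.trans inf_le_left, hxW, _, V', hWV'.trans inf_le_right, _, a', b',
      he'.restrict _, ha', hb', rfl⟩
  · rintro W W' _ ⟨V, hV, e, a, b, he, ha, hb, rfl⟩ _ ⟨V', hV', e', a', b', he', ha', hb', rfl⟩
      x hx hx'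
    obtain ⟨v, hv⟩ := exists_transition e he'
    have hx2 : x ∈ (W : (timesLine Y).Opens) ⊓ W' := ⟨hx, hx'⟩
    have hVV : (W : (timesLine Y).Opens) ⊓ W' ≤ proj Y ⁻¹ᵁ (V ⊓ V') := fun y hy ↦
      ⟨hV hy.1, hV' hy.2⟩
    rw [← germ_restrictFun inf_le_left hx2,
      ← germ_restrictFun (U := (W' : (timesLine Y).Opens)) inf_le_right hx2]
    apply map_dvd
    simp only [restrictFun_proj_app, map_add, map_mul, restrictFun_restrictFun]
    rw [restrictFun_appLE_proj hV hVV inf_le_left inf_le_left,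
      restrictFun_appLE_proj hV hVV inf_le_left inf_le_left,
      restrictFun_appLE_proj hV' hVV inf_le_right inf_le_right,
      restrictFun_appLE_proj hV' hVV inf_le_right inf_le_right, hv f a a' ha ha',
      hv g b b' hb hb', map_mul, map_mul]
    exact ⟨((proj Y).appLE (V ⊓ V') _ hVV).hom v, by ring⟩

end

/-! ### Charts of the product with the affine line -/

section

variable {B C : Type} [CommRing B] [CommRing C] {X Y : Scheme.{0}}

/-- The product of a morphism from `Spec B` with the affine line, as a morphism from the spectrum of
the polynomial ring. -/
def lineChart (r : Spec (CommRingCat.of B) ⟶ X) :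
    Spec (CommRingCat.of (MvPolynomial PUnit.{1} B)) ⟶ timesLine X :=
  (AffineSpace.SpecIso PUnit.{1} (CommRingCat.of B)).inv ≫ AffineSpace.map PUnit.{1} r

theorem lineChart_proj (r : Spec (CommRingCat.of B) ⟶ X) :
    lineChart r ≫ proj X = specMap MvPolynomial.C ≫ r := by
  rw [lineChart, proj, Category.assoc, AffineSpace.map_over, AffineSpace.SpecIso_inv_over_assoc]

theorem lineChart_comp (r : Spec (CommRingCat.of B) ⟶ X) (f : X ⟶ Y) :
    lineChart (r ≫ f) = lineChart r ≫ AffineSpace.map PUnit.{1} f := by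
  rw [lineChart, lineChart, AffineSpace.map_comp, Category.assoc]

theorem pullbackSections_lineChart_lineCoord (r : Spec (CommRingCat.of B) ⟶ X) (h) :
    pullbackSections (lineChart r) ⊤ h (lineCoord X) = MvPolynomial.X PUnit.unit := by
  have h1 : (lineChart r).appLE ⊤ ⊤ h = (lineChart r).appTop :=
    (Scheme.Hom.app_eq_appLE _).symm
  rw [pullbackSections, h1, lineChart, lineCoord, Scheme.Hom.comp_appTop]
  have h2 := AffineSpace.map_appTop_coord (n := PUnit.{1}) r PUnit.unit
  have h3 := AffineSpace.SpecIso_inv_appTop_coord (n := PUnit.{1}) (CommRingCat.of B) PUnit.unit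
  change (Scheme.ΓSpecIso _).hom.hom (((AffineSpace.SpecIso PUnit.{1} (CommRingCat.of B)).inv.appTop)
    ((AffineSpace.map PUnit.{1} r).appTop (AffineSpace.coord X PUnit.unit))) = _
  rw [h2, h3]
  exact congr($((Scheme.ΓSpecIso (CommRingCat.of (MvPolynomial PUnit.{1} B))).inv_hom_id).hom _)

instance (r : Spec (CommRingCat.of B) ⟶ X) [IsOpenImmersion r] : IsOpenImmersion (lineChart r) := by
  have : IsOpenImmersion (AffineSpace.map PUnit.{1} r) :=
    MorphismProperty.of_isPullback (AffineSpace.isPullback_map r).flip inferInstance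
  exact inferInstanceAs (IsOpenImmersion (_ ≫ _))

theorem mem_range_lineChart (r : Spec (CommRingCat.of B) ⟶ X) {y : timesLine X}
    (hy : proj X y ∈ Set.range r) : y ∈ Set.range (lineChart r) := by
  obtain ⟨x, hx⟩ := hy
  obtain ⟨z, hz, -⟩ := Scheme.exists_preimage_of_isPullback
    (AffineSpace.isPullback_map (n := PUnit.{1}) r) y x hx.symm
  refine ⟨(AffineSpace.SpecIso PUnit.{1} (CommRingCat.of B)).hom z, ?_⟩
  rw [← Scheme.Hom.comp_apply, lineChart, Iso.hom_inv_id_assoc, hz]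

theorem comap_zeroIdeal {L : Y.Modules} (hL : IsInvertible L) (f : Γ(L, ⊤)) (W : Y.affineOpens)
    {e : Γ(L, (W : Y.Opens))} (he : IsLocalGenerator L e) {a : Γ(Y, (W : Y.Opens))}
    (ha : restrictSection L le_top f = a • e) (φ : Γ(Y, (W : Y.Opens)) →+* B) :
    (zeroIdeal f).comap (specMap φ ≫ affineInclusion W) = specIdeal (Ideal.span {φ a}) := by
  rw [comap_eq_specIdeal, ideal_zeroIdeal hL f W he ha, Ideal.map_span, Set.image_singleton]

theorem comap_pencilIdeal {L : Y.Modules} (hL : IsInvertible L) (f g : Γ(L, ⊤)) (V : Y.affineOpens)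
    {e : Γ(L, (V : Y.Opens))} (he : IsLocalGenerator L e) {a b : Γ(Y, (V : Y.Opens))}
    (ha : restrictSection L le_top f = a • e) (hb : restrictSection L le_top g = b • e)
    (φ : Γ(Y, (V : Y.Opens)) →+* B) :
    (pencilIdeal f g).comap (lineChart (specMap φ ≫ affineInclusion V)) =
      specIdeal (Ideal.span {MvPolynomial.C (φ a) +
        MvPolynomial.X PUnit.unit * MvPolynomial.C (φ b)}) := by
  let W : (timesLine Y).affineOpens := ⟨proj Y ⁻¹ᵁ V, IsAffineOpen.preimage V.2 (timesLine Y ↘ Y)⟩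
  set r := specMap φ ≫ affineInclusion V with hr
  have hrV : ⊤ ≤ r ⁻¹ᵁ (V : Y.Opens) := fun x _ ↦ top_le_preimage_affineInclusion V (Set.mem_univ _)
  have hW : ⊤ ≤ lineChart r ⁻¹ᵁ (W : (timesLine Y).Opens) := by
    change ⊤ ≤ (lineChart r ≫ proj Y) ⁻¹ᵁ (V : Y.Opens)
    rw [lineChart_proj]
    exact fun x _ ↦ hrV (Set.mem_univ _)
  rw [comap_eq_specIdeal_map _ _ W hW, ideal_pencilIdeal hL f g W le_rfl he ha hb, Ideal.map_span,
    Set.image_singleton, map_add, map_mul, pullbackSections_restrictFun,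
    pullbackSections_lineChart_lineCoord]
  have key : ∀ x : Γ(Y, (V : Y.Opens)), pullbackSections (lineChart r) W hW
      (((proj Y).appLE V W le_rfl).hom x) = MvPolynomial.C (φ x) := by
    intro x
    have hp : ⊤ ≤ (lineChart r ≫ proj Y) ⁻¹ᵁ (V : Y.Opens) := hW
    rw [← pullbackSections_comp _ _ _ _ hp]
    simp only [lineChart_proj, hr]
    rw [pullbackSections_specMap _ _ hrV,
      pullbackSections_specMap _ _ (top_le_preimage_affineInclusion V),
      pullbackSections_affineInclusion]
  rw [key, key]

end

/-! ### Smooth points of closed subschemes -/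

/-- Smooth morphisms, as a property of morphisms of schemes. -/
def smoothMorphisms : MorphismProperty Scheme.{0} := fun _ _ f ↦ Smooth f

instance : HasRingHomProperty smoothMorphisms RingHom.Smooth :=
  inferInstanceAs (HasRingHomProperty @Smooth.{0} RingHom.Smooth)

section

variable {W X S : Scheme.{0}}

/-- The open immersion of closed subschemes over an open immersion. -/
def subschemeRestrict (I : X.IdealSheafData) (j : W ⟶ X) : (I.comap j).subscheme ⟶ I.subscheme :=
  Scheme.IdealSheafData.subschemeMap _ _ j (I.le_map_comap j)

theorem subschemeRestrict_comp (I : X.IdealSheafData) (j : W ⟶ X) :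
    subschemeRestrict I j ≫ I.subschemeι = (I.comap j).subschemeι ≫ j :=
  Scheme.IdealSheafData.subschemeMap_subschemeι _ _ _ _

theorem isPullback_subschemeRestrict (I : X.IdealSheafData) (j : W ⟶ X) :
    IsPullback (I.comap j).subschemeι (subschemeRestrict I j) j I.subschemeι :=
  isPullback_of_isClosedImmersion _ _ _ _ (subschemeRestrict_comp I j).symm
    (by rw [Scheme.IdealSheafData.ker_subschemeι, Scheme.IdealSheafData.ker_subschemeι])

instance (I : X.IdealSheafData) (j : W ⟶ X) [IsOpenImmersion j] :
    IsOpenImmersion (subschemeRestrict I j) :=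
  MorphismProperty.of_isPullback (isPullback_subschemeRestrict I j) inferInstance

theorem formallySmooth_stalkMap_comp_iff {T : Scheme.{0}} (j : W ⟶ T) [IsOpenImmersion j]
    (f : T ⟶ S) (x : W) :
    ((j ≫ f).stalkMap x).hom.FormallySmooth ↔ (f.stalkMap (j x)).hom.FormallySmooth := by
  refine Iff.trans ?_ (RingHom.FormallySmooth.respectsIso.cancel_right_isIso _ (j.stalkMap x))
  rw [← CommRingCat.hom_comp, ← Scheme.Hom.stalkMap_comp]
  rfl

/-- The singular locus is compatible with open immersions. -/
theorem mem_singularLocus_comap_iff (p : X ⟶ S) (I : X.IdealSheafData) (j : W ⟶ X)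
    [IsOpenImmersion j] (w : W) :
    w ∈ singularLocus (j ≫ p) (I.comap j) ↔ j w ∈ singularLocus p I := by
  have h : ∀ y : (I.comap j).subscheme,
      (((I.comap j).subschemeι ≫ j ≫ p).stalkMap y).hom.FormallySmooth ↔
        ((I.subschemeι ≫ p).stalkMap (subschemeRestrict I j y)).hom.FormallySmooth := by
    intro y
    rw [← formallySmooth_stalkMap_comp_iff (subschemeRestrict I j)]
    have : (I.comap j).subschemeι ≫ j ≫ p = subschemeRestrict I j ≫ I.subschemeι ≫ p := by
      rw [← Category.assoc, ← subschemeRestrict_comp, Category.assoc]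
    rw [this]
  constructor
  · rintro ⟨y, hy, hs⟩
    refine ⟨subschemeRestrict I j y, ?_, fun h' ↦ hs ((h y).mpr h')⟩
    rw [← Scheme.Hom.comp_apply, subschemeRestrict_comp, Scheme.Hom.comp_apply, hy]
  · rintro ⟨y, hy, hs⟩
    obtain ⟨z, hz, hz'⟩ := Scheme.exists_preimage_of_isPullback (isPullback_subschemeRestrict I j)
      w y hy.symm
    refine ⟨z, hz, fun h' ↦ hs ?_⟩
    have := (h z).mp h'
    rwa [show subschemeRestrict I j z = y from hz'] at this

theorem singularLocus_subset_support (p : X ⟶ S) (I : X.IdealSheafData) :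
    singularLocus p I ⊆ I.support := by
  rintro x ⟨y, rfl, -⟩
  rw [← I.range_subschemeι]
  exact Set.mem_range_self y

theorem singularLocus_eq_empty (p : X ⟶ S) (I : X.IdealSheafData) [h : Smooth (I.subschemeι ≫ p)] :
    singularLocus p I = ∅ := by
  rw [Set.eq_empty_iff_forall_notMem]
  rintro x ⟨y, -, hs⟩
  refine hs ?_
  have := (I.subschemeι ≫ p).smoothLocus_eq_top
  have h1 : y ∈ (I.subschemeι ≫ p).smoothLocus := this ▸ trivial
  exact h1

theorem isClosed_singularLocus (p : X ⟶ S) (I : X.IdealSheafData)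
    [LocallyOfFinitePresentation (I.subschemeι ≫ p)] : IsClosed (singularLocus p I) := by
  have : singularLocus p I = I.subschemeι '' ((I.subschemeι ≫ p).smoothLocus : Set _)ᶜ := by
    ext x
    constructor
    · rintro ⟨y, hy, hs⟩
      exact ⟨y, hs, hy⟩
    · rintro ⟨y, hs, hy⟩
      exact ⟨y, hy, hs⟩
  rw [this]
  exact I.subschemeι.isClosedEmbedding.isClosedMap _ (Opens.isOpen _).isClosed_compl

theorem smooth_of_singularLocus_eq_empty (p : X ⟶ S) (I : X.IdealSheafData)
    [LocallyOfFinitePresentation (I.subschemeι ≫ p)] (h : singularLocus p I = ∅) :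
    Smooth (I.subschemeι ≫ p) := by
  rw [← Scheme.Hom.smoothLocus_eq_top_iff, eq_top_iff]
  intro y _
  by_contra hs
  exact Set.eq_empty_iff_forall_notMem.mp h (I.subschemeι y) ⟨y, rfl, hs⟩

/-- Smoothness of a closed subscheme can be checked on an open cover of the ambient scheme. -/
theorem smooth_of_forall_exists (p : X ⟶ S) (I : X.IdealSheafData)
    (h : ∀ x ∈ I.support, ∃ (W : Scheme.{0}) (j : W ⟶ X) (_ : IsOpenImmersion j),
      x ∈ Set.range j ∧ Smooth ((I.comap j).subschemeι ≫ j ≫ p)) :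
    Smooth (I.subschemeι ≫ p) := by
  have h' : ∀ y : I.subscheme, ∃ (W : Scheme.{0}) (j : W ⟶ X) (_ : IsOpenImmersion j),
      I.subschemeι y ∈ Set.range j ∧ Smooth ((I.comap j).subschemeι ≫ j ≫ p) := fun y ↦
    h _ (by
      change I.subschemeι y ∈ (I.support : Set X)
      rw [← I.range_subschemeι]
      exact Set.mem_range_self y)
  choose W j hj hx hs using h'
  have hc : ∀ y : I.subscheme, y ∈ Set.range (subschemeRestrict I (j y)) := fun y ↦ by
    obtain ⟨w, hw⟩ := hx y
    obtain ⟨z, -, hz'⟩ := Scheme.exists_preimage_of_isPullback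
      (isPullback_subschemeRestrict I (j y)) w y hw
    exact ⟨z, hz'⟩
  refine IsZariskiLocalAtSource.of_iSup_eq_top (P := smoothMorphisms)
    (fun y ↦ (subschemeRestrict I (j y)).opensRange) ?_ ?_
  · rw [eq_top_iff]
    intro y _
    exact Opens.mem_iSup.mpr ⟨y, hc y⟩
  · intro y
    let e := (subschemeRestrict I (j y)).isoOpensRange
    have he : (subschemeRestrict I (j y)).opensRange.ι ≫ I.subschemeι ≫ p =
        e.inv ≫ (I.comap (j y)).subschemeι ≫ j y ≫ p := by
      rw [Iso.eq_inv_comp, ← Category.assoc, Scheme.Hom.isoOpensRange_hom_ι, ← Category.assoc,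
        subschemeRestrict_comp, Category.assoc]
    rw [he]
    exact (MorphismProperty.cancel_left_of_respectsIso smoothMorphisms e.inv _).mpr (hs y)

end

section

variable {B : Type} [CommRing B] [Algebra ℂ B]

/-- The structure morphism of the spectrum of a complex algebra. -/
abbrev specOver (B : Type) [CommRing B] [Algebra ℂ B] :
    Spec (CommRingCat.of B) ⟶ Spec (CommRingCat.of ℂ) :=
  specMap (algebraMap ℂ B)

theorem smooth_subscheme_specIdeal_iff (K : Ideal B) :
    Smooth ((specIdeal K).subschemeι ≫ specOver B) ↔ Algebra.Smooth ℂ (B ⧸ K) := by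
  have h : specIdeal K = (specMap (Ideal.Quotient.mk K)).ker := by
    rw [ker_specMap, Ideal.mk_ker]
  have hc : IsClosedImmersion (specMap (Ideal.Quotient.mk K)) :=
    IsClosedImmersion.spec_of_surjective _ Ideal.Quotient.mk_surjective
  rw [h]
  have h2 : specMap (algebraMap ℂ (B ⧸ K)) = (specMap (Ideal.Quotient.mk K)).toImage ≫
      (specMap (Ideal.Quotient.mk K)).ker.subschemeι ≫ specOver B := by
    rw [Scheme.Hom.toImage_imageι_assoc, ← specMap_comp]
  change smoothMorphisms _ ↔ _
  rw [← MorphismProperty.cancel_left_of_respectsIso smoothMorphisms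
    (specMap (Ideal.Quotient.mk K)).toImage, ← h2]
  exact HasRingHomProperty.Spec_iff.trans RingHom.smooth_algebraMap

/-- The Jacobian criterion: at a point where some derivation of the equation does not vanish, a
hypersurface in a smooth affine scheme is smooth in a neighbourhood of the point. -/
theorem exists_smooth_of_derivation [Algebra.FormallySmooth ℂ B] [Algebra.FiniteType ℂ B]
    (a : B) (x : Spec (CommRingCat.of B)) (D : Derivation ℂ B B) (hD : D a ∉ x.asIdeal) :
    ∃ (W : Scheme.{0}) (j : W ⟶ Spec (CommRingCat.of B)) (_ : IsOpenImmersion j),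
      x ∈ Set.range j ∧
        Smooth (((specIdeal (Ideal.span {a})).comap j).subschemeι ≫ j ≫ specOver B) := by
  let b := D a
  let R := Localization.Away b
  have : Algebra.FormallySmooth B R := Algebra.FormallySmooth.of_isLocalization (.powers b)
  have : Algebra.FormallyEtale B R := Algebra.FormallyEtale.of_isLocalization (.powers b)
  have : Algebra.FormallySmooth ℂ R := Algebra.FormallySmooth.comp ℂ B R
  have : Algebra.FiniteType B R :=
    inferInstanceAs (Algebra.FiniteType B (Localization.Away b))
  have : Algebra.FiniteType ℂ R := Algebra.FiniteType.trans ‹_› this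
  have : Algebra.FiniteType ℂ (R ⧸ Ideal.span {algebraMap B R a}) :=
    Algebra.FiniteType.trans this inferInstance
  obtain ⟨D', hD'⟩ := exists_derivation_extension ℂ B R D
  obtain ⟨u, hu⟩ := IsLocalization.Away.algebraMap_isUnit (S := R) b
  have hsm : Algebra.FormallySmooth ℂ (R ⧸ Ideal.span {algebraMap B R a}) := by
    refine formallySmooth_quotient_span_singleton _ ((↑u⁻¹ : R) • D') ?_
    have : ((↑u⁻¹ : R) • D') (algebraMap B R a) = 1 := by
      rw [Derivation.smul_apply, hD', ← hu, smul_eq_mul, Units.inv_mul]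
    rw [this, sub_self]
    exact Ideal.zero_mem _
  refine ⟨_, specMap (algebraMap B R), ?_, ?_, ?_⟩
  · exact IsOpenImmersion.of_isLocalization b
  · have h := PrimeSpectrum.localization_away_comap_range R b
    have hx : x ∈ (PrimeSpectrum.basicOpen b : Set (PrimeSpectrum B)) := hD
    rw [← h] at hx
    exact hx
  · rw [comap_specIdeal, Ideal.map_span, Set.image_singleton]
    have h2 : specMap (algebraMap B R) ≫ specOver B = specOver R := by
      rw [← specMap_comp, ← IsScalarTower.algebraMap_eq]
    rw [h2, smooth_subscheme_specIdeal_iff]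
    exact ⟨hsm, Algebra.FinitePresentation.of_finiteType.mp inferInstance⟩

end

/-! ### Proper transforms in charts -/

section

variable {X X' : Scheme.{0}}

/-- Over an affine open set in which the inverse image of the center is the zero set of `e`, the
ideal of the proper transform consists of the functions that a power of `e` moves into the ideal of
the total transform. -/
theorem mem_ideal_properTransform [IsLocallyNoetherian X] (φ : X' ⟶ X) (Z : Set X)
    (I : X.IdealSheafData) (U : X'.affineOpens) (e : Γ(X', (U : X'.Opens)))
    (he : ∀ x ∈ (U : X'.Opens), φ x ∈ closure Z ↔ x ∉ X'.basicOpen e) (b : Γ(X', (U : X'.Opens))) :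
    b ∈ (properTransform φ Z I).ideal U ↔ ∃ n : ℕ, e ^ n * b ∈ (I.comap φ).ideal U := by
  set ι := (I.comap φ).subschemeι with hι
  let O : X.Opens := (Closeds.closure Z).compl
  let V := ι ⁻¹ᵁ φ ⁻¹ᵁ O
  have hO : QuasiCompact O.ι := inferInstance
  have hVqc : QuasiCompact V.ι :=
    MorphismProperty.of_isPullback (isPullback_morphismRestrict (ι ≫ φ) O) hO
  have hqc : QuasiCompact (V.ι ≫ ι) := inferInstance
  have h1 : (properTransform φ Z I).ideal U = RingHom.ker ((V.ι ≫ ι).app U).hom :=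
    Scheme.Hom.ker_apply _ _
  have hW : IsAffineOpen (ι ⁻¹ᵁ (U : X'.Opens)) := IsAffineOpen.preimage U.2 ι
  have hker : ∀ c, (ι.app U).hom c = 0 ↔ c ∈ (I.comap φ).ideal U := fun c ↦ by
    rw [← (I.comap φ).ker_subschemeι_app U]
    rfl
  set e' := (ι.app U).hom e with he'
  have hbasic : V ⊓ ι ⁻¹ᵁ (U : X'.Opens) = (I.comap φ).subscheme.basicOpen e' := by
    have : (I.comap φ).subscheme.basicOpen e' = ι ⁻¹ᵁ X'.basicOpen e :=
      (Scheme.preimage_basicOpen ι e).symm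
    rw [this]
    ext x
    have h2 : x ∈ V ↔ φ (ι x) ∉ closure Z := Iff.rfl
    constructor
    · rintro ⟨hx, hxU⟩
      by_contra h3
      exact h2.mp hx ((he _ hxU).mpr h3)
    · intro hx
      have hxU : ι x ∈ (U : X'.Opens) := X'.basicOpen_le e hx
      exact ⟨h2.mpr fun h3 ↦ (he _ hxU).mp h3 hx, hxU⟩
  have hloc := hW.isLocalization_basicOpen e'
  have h2 : ((V.ι ≫ ι).app U).hom b = 0 ↔
      restrictFun ((I.comap φ).subscheme.basicOpen_le e') ((ι.app U).hom b) = 0 := by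
    have h3 : V.ι ''ᵁ V.ι ⁻¹ᵁ ι ⁻¹ᵁ (U : X'.Opens) = (I.comap φ).subscheme.basicOpen e' := by
      rw [Scheme.Hom.image_preimage_eq_opensRange_inf, Scheme.Opens.opensRange_ι, hbasic]
    have hle : V.ι ''ᵁ V.ι ⁻¹ᵁ ι ⁻¹ᵁ (U : X'.Opens) ≤ ι ⁻¹ᵁ (U : X'.Opens) := by
      rintro _ ⟨x, hx, rfl⟩
      exact hx
    have h4 : ((V.ι ≫ ι).app U).hom b = restrictFun hle
        ((ι.app U).hom b) := rfl
    rw [h4]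
    have h5 : restrictFun h3.ge (restrictFun hle ((ι.app U).hom b)) =
      restrictFun ((I.comap φ).subscheme.basicOpen_le e') ((ι.app U).hom b) :=
        restrictFun_restrictFun _ _ _
    have h6 : restrictFun h3.le (restrictFun ((I.comap φ).subscheme.basicOpen_le e')
        ((ι.app U).hom b)) =
      restrictFun hle ((ι.app U).hom b) :=
        restrictFun_restrictFun _ _ _
    constructor
    · intro h
      rw [← h5]
      exact (congrArg (restrictFun h3.ge) h).trans (map_zero _)
    · intro h
      rw [← h6]
      exact (congrArg (restrictFun h3.le) h).trans (map_zero _)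
  rw [h1, RingHom.mem_ker, h2]
  have h7 : restrictFun ((I.comap φ).subscheme.basicOpen_le e') ((ι.app U).hom b) = 0 ↔
      ∃ s : Submonoid.powers e', (s : Γ((I.comap φ).subscheme, _)) * (ι.app U).hom b = 0 :=
    IsLocalization.map_eq_zero_iff (Submonoid.powers e')
      Γ((I.comap φ).subscheme, (I.comap φ).subscheme.basicOpen e') _
  rw [h7]
  constructor
  · rintro ⟨⟨_, n, rfl⟩, hn⟩
    refine ⟨n, (hker _).mp ?_⟩
    rw [map_mul, map_pow]
    exact hn
  · rintro ⟨n, hn⟩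
    refine ⟨⟨_, n, rfl⟩, ?_⟩
    have := (hker _).mpr hn
    rwa [map_mul, map_pow] at this

/-- If the total transform has equation `e ^ N * F` in a chart, where `e` is an equation of the
inverse image of the center and a non-zero-divisor modulo `F`, then `F` is an equation of the proper
transform. -/
theorem comap_properTransform {B : Type} [CommRing B] [IsLocallyNoetherian X] (φ : X' ⟶ X)
    {Z : Set X} (hZ : IsClosed Z) (I : X.IdealSheafData) (r : Spec (CommRingCat.of B) ⟶ X')
    [IsOpenImmersion r] {e F : B} {N : ℕ}
    (hI : I.comap (r ≫ φ) = specIdeal (Ideal.span {e ^ N * F}))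
    (he : ∀ x, (r ≫ φ) x ∈ Z ↔ e ∈ x.asIdeal)
    (hs : ∀ b, e * b ∈ Ideal.span {F} → b ∈ Ideal.span {F}) :
    (properTransform φ Z I).comap r = specIdeal (Ideal.span {F}) := by
  obtain ⟨U, ψ, hU, hψ, hψi, hr⟩ := exists_affineOpen_of_isOpenImmersion r
  obtain ⟨e₀, he₀⟩ := hψ.2 e
  have hpt : ∀ x : Spec (CommRingCat.of B), r x ∈ X'.basicOpen e₀ ↔ e ∉ x.asIdeal := by
    intro x
    have h1 : affineInclusion U ⁻¹ᵁ X'.basicOpen e₀ = PrimeSpectrum.basicOpen e₀ :=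
      U.2.fromSpec_preimage_basicOpen e₀
    have h2 : r x = affineInclusion U (specMap ψ x) := by
      conv_lhs => rw [← hr]
      exact Scheme.Hom.comp_apply _ _ _
    have h3 : r x ∈ X'.basicOpen e₀ ↔ specMap ψ x ∈ affineInclusion U ⁻¹ᵁ X'.basicOpen e₀ := by
      rw [h2]
      rfl
    rw [h3, h1, ← he₀]
    rfl
  have hmem : ∀ b, b ∈ (properTransform φ Z I).ideal U ↔
      ∃ n : ℕ, e₀ ^ n * b ∈ (I.comap φ).ideal U := by
    refine mem_ideal_properTransform φ Z I U e₀ ?_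
    intro x hx
    obtain ⟨y, rfl⟩ := hU.ge hx
    rw [hZ.closure_eq, hpt, not_not, ← he]
    rfl
  have hI' : ((I.comap φ).ideal U).map ψ = Ideal.span {e ^ N * F} := by
    apply specIdeal_injective
    rw [← hI, ← comap_eq_specIdeal, hr, Scheme.IdealSheafData.comap_comp]
  have hIU : ∀ b, b ∈ (I.comap φ).ideal U ↔ ψ b ∈ Ideal.span {e ^ N * F} := by
    intro b
    rw [← hI', ← Ideal.mem_comap, Ideal.comap_map_of_bijective ψ hψ]
  have hsn : ∀ (n : ℕ) b, e ^ n * b ∈ Ideal.span {F} → b ∈ Ideal.span {F} := by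
    intro n
    induction n with
    | zero => intro b h; rwa [pow_zero, one_mul] at h
    | succ n ih =>
      intro b h
      rw [pow_succ', mul_assoc] at h
      exact ih b (hs _ h)
  rw [← hr, comap_eq_specIdeal]
  congr 1
  apply le_antisymm
  · rw [Ideal.map_le_iff_le_comap]
    intro b hb
    obtain ⟨n, hn⟩ := (hmem b).mp hb
    rw [hIU, map_mul, map_pow, he₀] at hn
    refine hsn n _ (Ideal.span_singleton_le_span_singleton.mpr ?_ hn)
    exact dvd_mul_left _ _
  · rw [Ideal.span_singleton_le_iff_mem]
    obtain ⟨F₀, rfl⟩ := hψ.2 F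
    refine Ideal.mem_map_of_mem ψ ((hmem F₀).mpr ⟨N, ?_⟩)
    rw [hIU, map_mul, map_pow, he₀]
    exact Ideal.mem_span_singleton_self _

end

/-! ### Affine charts of blow-ups -/

section

variable {X X' : Scheme.{0}}

theorem affineCover_hom_ext {f g : X ⟶ X'}
    (h : ∀ (Q : Type) [CommRing Q] (i : Spec (CommRingCat.of Q) ⟶ X) [IsOpenImmersion i],
      i ≫ f = i ≫ g) : f = g :=
  Scheme.Cover.hom_ext X.affineOpenCover.openCover f g fun x ↦
    @h (X.affineOpenCover.X x) _ (X.affineOpenCover.f x) (X.affineOpenCover.map_prop x)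

/-- A morphism is an open immersion as soon as it has an inverse locally on the target. -/
theorem isOpenImmersion_of_forall_exists (r : X ⟶ X')
    (h : ∀ x : X, ∃ (R : Type) (_ : CommRing R) (j : Spec (CommRingCat.of R) ⟶ X')
      (_ : IsOpenImmersion j) (σ : Spec (CommRingCat.of R) ⟶ X), r x ∈ Set.range j ∧ σ ≫ r = j ∧
      ∀ (Q : Type) [CommRing Q] (i : Spec (CommRingCat.of Q) ⟶ X) [IsOpenImmersion i]
        (s : Spec (CommRingCat.of Q) ⟶ Spec (CommRingCat.of R)), s ≫ j = i ≫ r → s ≫ σ = i) :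
    IsOpenImmersion r := by
  refine IsZariskiLocalAtTarget.of_forall_source_exists_preimage r fun x ↦ ?_
  obtain ⟨R, _, j, hj, σ, hx, hσ, hs⟩ := h x
  refine ⟨j.opensRange, hx, ?_⟩
  have h1 : Limits.pullback.snd r j ≫ σ = Limits.pullback.fst r j := by
    apply affineCover_hom_ext
    intro Q _ c _
    rw [← Category.assoc]
    refine hs Q (c ≫ Limits.pullback.fst r j) (c ≫ Limits.pullback.snd r j) ?_
    rw [Category.assoc, Category.assoc, Limits.pullback.condition]
  have h2 : IsIso (Limits.pullback.snd r j) := by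
    refine ⟨Limits.pullback.lift σ (𝟙 _) (by rw [hσ, Category.id_comp]), ?_, ?_⟩
    · apply Limits.pullback.hom_ext
      · rw [Category.assoc, Limits.pullback.lift_fst, h1, Category.id_comp]
      · rw [Category.assoc, Limits.pullback.lift_snd, Category.comp_id, Category.id_comp]
    · rw [Limits.pullback.lift_snd]
  have h3 : IsOpenImmersion (Limits.pullback.fst r j ≫ r) := by
    rw [Limits.pullback.condition]
    infer_instance
  have h4 : Set.range (r ⁻¹ᵁ j.opensRange).ι = Set.range (Limits.pullback.fst r j) := by
    rw [IsOpenImmersion.range_pullbackFst, Scheme.Opens.range_ι]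
  rw [← IsOpenImmersion.isoOfRangeEq_hom_fac _ _ h4, Category.assoc]
  exact inferInstance

end

section

variable {B : Type} [CommRing B]

theorem isEffectiveCartier_specIdeal {b : B} (hb : b ∈ nonZeroDivisors B) :
    IsEffectiveCartier (specIdeal (Ideal.span {b})) := by
  intro x
  refine ⟨⟨⊤, isAffineOpen_top _⟩, trivial, (Scheme.ΓSpecIso (CommRingCat.of B)).inv.hom b, ?_, ?_⟩
  · exact (MulEquivClass.map_nonZeroDivisors
      (Scheme.ΓSpecIso (CommRingCat.of B)).symm.commRingCatIsoToRingEquiv).le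
      (Submonoid.mem_map_of_mem _ hb)
  · rw [specIdeal_ideal_top]
    have := Ideal.comap_symm
      (f := (Scheme.ΓSpecIso (CommRingCat.of B)).symm.commRingCatIsoToRingEquiv)
      (I := Ideal.span {b})
    refine this.trans ?_
    rw [Ideal.map_span, Set.image_singleton]
    rfl

theorem nonZeroDivisors_of_isOpenImmersion {Q : Type} [CommRing Q] (ψ : B →+* Q)
    [IsOpenImmersion (specMap ψ)] {b : B} (hb : b ∈ nonZeroDivisors B) :
    ψ b ∈ nonZeroDivisors Q := by
  have h1 : ψ.Flat := by
    have : Flat (specMap ψ) := inferInstance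
    exact (HasRingHomProperty.Spec_iff (P := @Flat)).mp this
  algebraize [ψ]
  have h2 : IsSMulRegular Q b := Module.Flat.isSMulRegular_of_nonZeroDivisors hb
  rw [mem_nonZeroDivisors_iff_right]
  intro z hz
  have h3 : b • z = b • (0 : Q) := by
    rw [smul_zero, Algebra.smul_def, mul_comm]
    exact hz
  exact h2 h3

/-- An open neighbourhood of a point of a spectrum contains the spectrum of a localization. -/
theorem exists_localization_away_subset (x : Spec (CommRingCat.of B))
    (O : (Spec (CommRingCat.of B)).Opens) (hx : x ∈ O) : ∃ b : B, b ∉ x.asIdeal ∧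
      Set.range (specMap (algebraMap B (Localization.Away b))) ⊆ O := by
  obtain ⟨_, ⟨_, ⟨b, rfl⟩, rfl⟩, hxb, hb⟩ :=
    PrimeSpectrum.isBasis_basic_opens.exists_subset_of_mem_open hx O.2
  refine ⟨b, hxb, ?_⟩
  have : Set.range (specMap (algebraMap B (Localization.Away b))) =
      (PrimeSpectrum.basicOpen b : Set (PrimeSpectrum B)) :=
    PrimeSpectrum.localization_away_comap_range (Localization.Away b) b
  rw [this]
  exact hb

theorem mem_range_specMap_localization_away (x : Spec (CommRingCat.of B)) {b : B}
    (hb : b ∉ x.asIdeal) : x ∈ Set.range (specMap (algebraMap B (Localization.Away b))) := by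
  have : Set.range (specMap (algebraMap B (Localization.Away b))) =
      (PrimeSpectrum.basicOpen b : Set (PrimeSpectrum B)) :=
    PrimeSpectrum.localization_away_comap_range (Localization.Away b) b
  rw [this]
  exact hb

instance isOpenImmersion_specMap_localization_away (b : B) :
    IsOpenImmersion (specMap (algebraMap B (Localization.Away b))) :=
  inferInstanceAs (IsOpenImmersion
    (Spec.map (CommRingCat.ofHom (algebraMap B (Localization.Away b)))))

end

section

variable {X X' : Scheme.{0}} {A : Type} [CommRing A] {τ : Type}

/-- The point `y` has an affine open neighbourhood in the blow-up on which the functions `c i`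
generating the ideal of the center are the multiples `t i * c k` of a non-zero-divisor `c k`. -/
def IsChartPoint (π : X' ⟶ X) (v : Spec (CommRingCat.of A) ⟶ X) (c : τ → A) (k : τ) (y : X') :
    Prop :=
  ∃ (R : Type) (_ : CommRing R) (j : Spec (CommRingCat.of R) ⟶ X') (_ : IsOpenImmersion j)
    (φ : A →+* R) (t : τ → R), y ∈ Set.range j ∧ j ≫ π = specMap φ ≫ v ∧
      (∀ i, φ (c i) = φ (c k) * t i) ∧ t k = 1 ∧ φ (c k) ∈ nonZeroDivisors R

/-- Near a point of the blow-up the ideal of the center is generated by a non-zero-divisor `d`, and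
the coefficients `t i` of the functions `c i` with respect to `d` generate the unit ideal. -/
theorem exists_principal_chart [Fintype τ] {π : X' ⟶ X} {I : X.IdealSheafData}
    (hπ : IsEffectiveCartier (I.comap π)) (v : Spec (CommRingCat.of A) ⟶ X) [IsOpenImmersion v]
    (c : τ → A) (hc : I.comap v = specIdeal (Ideal.span (Set.range c))) (y : X')
    (hy : π y ∈ Set.range v) :
    ∃ (R : Type) (_ : CommRing R) (j : Spec (CommRingCat.of R) ⟶ X') (_ : IsOpenImmersion j)
      (φ : A →+* R) (d : R) (t s : τ → R), y ∈ Set.range j ∧ j ≫ π = specMap φ ≫ v ∧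
      d ∈ nonZeroDivisors R ∧ (∀ i, φ (c i) = d * t i) ∧ ∑ i, s i * t i = 1 := by
  obtain ⟨W, hyW, a, ha, hIW⟩ := hπ y
  obtain ⟨x, rfl⟩ : y ∈ Set.range (affineInclusion W) := by rwa [range_affineInclusion]
  obtain ⟨b, hxb, hb⟩ := exists_localization_away_subset x
    (affineInclusion W ⁻¹ᵁ π ⁻¹ᵁ v.opensRange) hy
  let R := Localization.Away b
  let ψ : Γ(X', (W : X'.Opens)) →+* R := algebraMap _ _
  let j := specMap ψ ≫ affineInclusion W
  have hj : Set.range (j ≫ π) ⊆ Set.range v := by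
    rintro _ ⟨z, rfl⟩
    exact hb (Set.mem_range_self z)
  let φ : A →+* R := (Spec.preimage (IsOpenImmersion.lift v (j ≫ π) hj)).hom
  have hφ : j ≫ π = specMap φ ≫ v := by
    have : specMap φ = IsOpenImmersion.lift v (j ≫ π) hj := Spec.map_preimage _
    rw [this, IsOpenImmersion.lift_fac]
  have hd : ψ a ∈ nonZeroDivisors R := nonZeroDivisors_of_isOpenImmersion ψ ha
  have hspan : Ideal.span (Set.range (φ ∘ c)) = Ideal.span {ψ a} := by
    apply specIdeal_injective
    rw [Set.range_comp, ← Ideal.map_span, ← comap_specIdeal, ← hc,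
      ← Scheme.IdealSheafData.comap_comp, ← hφ, Scheme.IdealSheafData.comap_comp,
      comap_eq_specIdeal, hIW, Ideal.map_span, Set.image_singleton]
  have h1 : ∀ i, ∃ t, φ (c i) = ψ a * t := fun i ↦ by
    have : φ (c i) ∈ Ideal.span {ψ a} := hspan ▸ Ideal.subset_span ⟨i, rfl⟩
    exact Ideal.mem_span_singleton.mp this
  choose t ht using h1
  obtain ⟨s, hs⟩ : ∃ s : τ → R, ∑ i, s i * φ (c i) = ψ a := by
    have : ψ a ∈ Ideal.span (Set.range (φ ∘ c)) := hspan ▸ Ideal.mem_span_singleton_self _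
    exact (Ideal.mem_span_range_iff_exists_fun).mp this
  refine ⟨R, inferInstance, j, inferInstance, φ, ψ a, t, s, ?_, hφ, hd, ht, ?_⟩
  · obtain ⟨z, hz⟩ := mem_range_specMap_localization_away x hxb
    refine ⟨z, ?_⟩
    rw [← hz]
    exact Scheme.Hom.comp_apply _ _ _
  · have h2 : ψ a * (∑ i, s i * t i) = ψ a * 1 := by
      rw [mul_one, Finset.mul_sum]
      conv_rhs => rw [← hs]
      exact Finset.sum_congr rfl fun i _ ↦ by rw [ht]; ring
    exact (mul_cancel_left_mem_nonZeroDivisors hd).mp h2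

theorem isChartPoint_of_notMem {R : Type} [CommRing R] {π : X' ⟶ X}
    (v : Spec (CommRingCat.of A) ⟶ X) (c : τ → A) (j : Spec (CommRingCat.of R) ⟶ X')
    [IsOpenImmersion j] (φ : A →+* R) (d : R) (t : τ → R) (hφ : j ≫ π = specMap φ ≫ v)
    (hd : d ∈ nonZeroDivisors R) (ht : ∀ i, φ (c i) = d * t i) (x : Spec (CommRingCat.of R)) (k : τ)
    (hk : t k ∉ x.asIdeal) : IsChartPoint π v c k (j x) := by
  let R' := Localization.Away (t k)
  let ψ : R →+* R' := algebraMap _ _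
  have hu : IsUnit (ψ (t k)) := IsLocalization.Away.algebraMap_isUnit (t k)
  obtain ⟨u, hu⟩ := hu
  refine ⟨R', inferInstance, specMap ψ ≫ j, inferInstance, ψ.comp φ,
    fun i ↦ ψ (t i) * (↑u⁻¹ : R'), ?_, ?_, ?_, ?_, ?_⟩
  · obtain ⟨z, hz⟩ := mem_range_specMap_localization_away x hk
    refine ⟨z, ?_⟩
    rw [← hz]
    exact Scheme.Hom.comp_apply _ _ _
  · rw [specMap_comp φ ψ, Category.assoc, Category.assoc, hφ]
  · intro i
    rw [RingHom.comp_apply, RingHom.comp_apply, ht, ht, map_mul, map_mul, ← hu]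
    linear_combination (-(ψ d * ψ (t i))) * u.mul_inv
  · change ψ (t k) * (↑u⁻¹ : R') = 1
    rw [← hu]
    exact u.mul_inv
  · rw [RingHom.comp_apply, ht, map_mul]
    exact mul_mem (nonZeroDivisors_of_isOpenImmersion ψ hd) (hu ▸ u.isUnit.mem_nonZeroDivisors)

theorem exists_isChartPoint [Fintype τ] {π : X' ⟶ X} {I : X.IdealSheafData}
    (hπ : IsEffectiveCartier (I.comap π)) (v : Spec (CommRingCat.of A) ⟶ X) [IsOpenImmersion v]
    (c : τ → A) (hc : I.comap v = specIdeal (Ideal.span (Set.range c))) (y : X')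
    (hy : π y ∈ Set.range v) : ∃ k, IsChartPoint π v c k y := by
  obtain ⟨R, _, j, _, φ, d, t, s, ⟨x, rfl⟩, hφ, hd, ht, hst⟩ :=
    exists_principal_chart hπ v c hc y hy
  by_contra! hcon
  have h1 : ∀ k, t k ∈ x.asIdeal := fun k ↦ by
    by_contra hk
    exact hcon k (isChartPoint_of_notMem v c j φ d t hφ hd ht x k hk)
  have h2 : (1 : R) ∈ x.asIdeal := by
    rw [← hst]
    exact sum_mem fun i _ ↦ Ideal.mul_mem_left _ _ (h1 i)
  exact x.2.ne_top ((Ideal.eq_top_iff_one _).mpr h2)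

/-- A ring with the universal property of the `k`-th affine blow-up algebra is the ring of an affine
open subset of the blow-up, which consists of the points near which `c k` generates the ideal of
the center. -/
theorem exists_blowup_openImmersion [Fintype τ] {B : Type} [CommRing B] {π : X' ⟶ X}
    {I : X.IdealSheafData} (hπ : IsBlowup π I) (v : Spec (CommRingCat.of A) ⟶ X)
    [IsOpenImmersion v] (c : τ → A) (hc : I.comap v = specIdeal (Ideal.span (Set.range c))) (k : τ)
    (ρ : A →+* B) (w : τ → B) (hw : ∀ i, ρ (c i) = ρ (c k) * w i)
    (hk : ρ (c k) ∈ nonZeroDivisors B)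
    (huniv : ∀ (R : Type) [CommRing R] (φ : A →+* R) (t : τ → R),
      (∀ i, φ (c i) = φ (c k) * t i) → t k = 1 →
      ∃ φ' : B →+* R, φ'.comp ρ = φ ∧ ∀ i, φ' (w i) = t i)
    (hgen : Function.Surjective (MvPolynomial.eval₂Hom ρ w)) :
    ∃ r : Spec (CommRingCat.of B) ⟶ X', r ≫ π = specMap ρ ≫ v ∧ IsOpenImmersion r ∧
      ∀ y, IsChartPoint π v c k y → y ∈ Set.range r := by
  have hcart : ∀ (R : Type) [CommRing R] (φ : A →+* R) (t : τ → R)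
      (ht : ∀ i, φ (c i) = φ (c k) * t i) (hn : φ (c k) ∈ nonZeroDivisors R),
      IsEffectiveCartier (I.comap (specMap φ ≫ v)) := by
    intro R _ φ t ht hn
    have h1 : (Ideal.span (Set.range c)).map φ = Ideal.span {φ (c k)} := by
      rw [Ideal.map_span]
      apply le_antisymm
      · rw [Ideal.span_le]
        rintro _ ⟨_, ⟨i, rfl⟩, rfl⟩
        exact Ideal.mem_span_singleton.mpr ⟨t i, ht i⟩
      · rw [Ideal.span_singleton_le_iff_mem]
        exact Ideal.subset_span ⟨_, ⟨k, rfl⟩, rfl⟩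
    rw [Scheme.IdealSheafData.comap_comp, hc, comap_specIdeal, h1]
    exact isEffectiveCartier_specIdeal hn
  obtain ⟨r, hr, -⟩ := hπ.2 _ (specMap ρ ≫ v) (hcart B ρ w hw hk)
  have hlift : ∀ y, IsChartPoint π v c k y → ∃ (R : Type) (_ : CommRing R)
      (j : Spec (CommRingCat.of R) ⟶ X') (_ : IsOpenImmersion j) (φ : A →+* R) (t : τ → R)
      (φ' : B →+* R), y ∈ Set.range j ∧ j ≫ π = specMap φ ≫ v ∧ (∀ i, φ (c i) = φ (c k) * t i) ∧
      φ'.comp ρ = φ ∧ specMap φ' ≫ r = j := by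
    rintro y ⟨R, _, j, hj, φ, t, hy, hφ, ht, htk, hn⟩
    obtain ⟨φ', h1, h2⟩ := huniv R φ t ht htk
    refine ⟨R, _, j, hj, φ, t, φ', hy, hφ, ht, h1, ?_⟩
    obtain ⟨_, -, huniq⟩ := hπ.2 _ (specMap φ ≫ v) (hcart R φ t ht hn)
    rw [huniq j hφ]
    apply huniq
    rw [Category.assoc, hr, ← Category.assoc, ← specMap_comp, h1]
  refine ⟨r, hr, ?_, ?_⟩
  · apply isOpenImmersion_of_forall_exists
    intro x
    have hpt : IsChartPoint π v c k (r x) := by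
      have hπr : π (r x) ∈ Set.range v := by
        rw [← Scheme.Hom.comp_apply, hr, Scheme.Hom.comp_apply]
        exact Set.mem_range_self _
      obtain ⟨R, _, j, _, φ, d, t, s, ⟨x', hx'⟩, hφ, hd, ht, hst⟩ :=
        exists_principal_chart hπ.1 v c hc (r x) hπr
      rw [← hx']
      refine isChartPoint_of_notMem v c j φ d t hφ hd ht x' k fun hmem ↦ ?_
      -- On a neighbourhood of `x` mapped into the chart `j`, the function `c k` is a multiple of
      -- `d` and divides all `c i`, so that `t k` is invertible there.
      obtain ⟨b, hxb, hb⟩ := exists_localization_away_subset x (r ⁻¹ᵁ j.opensRange) ⟨x', hx'⟩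
      let Q := Localization.Away b
      let α : B →+* Q := algebraMap _ _
      have hα : Set.range (specMap α ≫ r) ⊆ Set.range j := by
        rintro _ ⟨z, rfl⟩
        exact hb (Set.mem_range_self z)
      let β : R →+* Q := (Spec.preimage (IsOpenImmersion.lift j (specMap α ≫ r) hα)).hom
      have hβ : specMap β ≫ j = specMap α ≫ r := by
        have : specMap β = IsOpenImmersion.lift j (specMap α ≫ r) hα := Spec.map_preimage _
        rw [this, IsOpenImmersion.lift_fac]
      have hβφ : β.comp φ = α.comp ρ := by
        have h1 : specMap (β.comp φ) ≫ v = specMap (α.comp ρ) ≫ v := by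
          rw [specMap_comp φ β, Category.assoc, ← hφ, ← Category.assoc, hβ, Category.assoc, hr,
            specMap_comp ρ α, Category.assoc]
        have h2 := (cancel_mono v).mp h1
        exact congrArg CommRingCat.Hom.hom (Spec.map_injective h2)
      have hβφ' : ∀ a, β (φ a) = α (ρ a) := fun a ↦ RingHom.congr_fun hβφ a
      have hn : α (ρ (c k)) ∈ nonZeroDivisors Q := nonZeroDivisors_of_isOpenImmersion α hk
      have hunit : β (t k) * ∑ i, β (s i) * α (w i) = 1 := by
        have h3 : β d = α (ρ (c k)) * ∑ i, β (s i) * α (w i) := by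
          have h4 : d = ∑ i, s i * φ (c i) := by
            calc d = d * ∑ i, s i * t i := by rw [hst, mul_one]
              _ = _ := by
                rw [Finset.mul_sum]
                exact Finset.sum_congr rfl fun i _ ↦ by rw [ht]; ring
          rw [h4, map_sum, Finset.mul_sum]
          refine Finset.sum_congr rfl fun i _ ↦ ?_
          rw [map_mul, hβφ', hw, map_mul]
          ring
        have h5 : α (ρ (c k)) = β d * β (t k) := by rw [← hβφ', ht, map_mul]
        have h6 : α (ρ (c k)) * (β (t k) * ∑ i, β (s i) * α (w i)) = α (ρ (c k)) * 1 := by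
          rw [mul_one]
          conv_rhs => rw [h5, h3]
          ring
        exact (mul_cancel_left_mem_nonZeroDivisors hn).mp h6
      obtain ⟨z, hz⟩ := mem_range_specMap_localization_away x hxb
      have hzx : specMap β z = x' := by
        apply j.isOpenEmbedding.injective
        rw [hx', ← hz, ← Scheme.Hom.comp_apply, hβ, Scheme.Hom.comp_apply]
      rw [← hzx] at hmem
      have h7 : β (t k) ∈ z.asIdeal := hmem
      have h8 : (1 : Q) ∈ z.asIdeal := hunit ▸ Ideal.mul_mem_right _ _ h7
      exact z.2.ne_top ((Ideal.eq_top_iff_one _).mpr h8)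
    obtain ⟨R, _, j, hj, φ, t, φ', hy, hφ, ht, h1, h2⟩ := hlift _ hpt
    refine ⟨R, _, j, hj, specMap φ', hy, h2, ?_⟩
    intro Q _ i _ s hs
    obtain ⟨α, rfl⟩ : ∃ α : B →+* Q, specMap α = i :=
      ⟨(Spec.preimage i).hom, Spec.map_preimage i⟩
    obtain ⟨β, rfl⟩ : ∃ β : R →+* Q, specMap β = s :=
      ⟨(Spec.preimage s).hom, Spec.map_preimage s⟩
    have h3 : (β.comp φ').comp ρ = α.comp ρ := by
      have h4 : specMap ((β.comp φ').comp ρ) ≫ v = specMap (α.comp ρ) ≫ v := by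
        rw [RingHom.comp_assoc, h1, specMap_comp, Category.assoc, ← hφ, ← Category.assoc, hs,
          Category.assoc, hr, specMap_comp, Category.assoc]
      exact congrArg CommRingCat.Hom.hom (Spec.map_injective ((cancel_mono v).mp h4))
    have hn : α (ρ (c k)) ∈ nonZeroDivisors Q := nonZeroDivisors_of_isOpenImmersion α hk
    have h5 : ∀ i, β (φ' (w i)) = α (w i) := by
      intro i
      have h6 : α (ρ (c k)) * β (φ' (w i)) = α (ρ (c k)) * α (w i) := by
        rw [← map_mul, ← hw]
        have e1 := RingHom.congr_fun h3 (c k)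
        have e2 := RingHom.congr_fun h3 (c i)
        simp only [RingHom.comp_apply] at e1 e2
        rw [← e1, ← e2, ← map_mul, ← map_mul, ← hw i]
      exact (mul_cancel_left_mem_nonZeroDivisors hn).mp h6
    rw [← specMap_comp]
    congr 1
    ext b
    obtain ⟨P, rfl⟩ := hgen b
    have h7 : (β.comp φ').comp (MvPolynomial.eval₂Hom ρ w) =
        α.comp (MvPolynomial.eval₂Hom ρ w) := by
      apply MvPolynomial.ringHom_ext
      · intro a
        have e1 := RingHom.congr_fun h3 a
        simpa using e1
      · intro i
        simpa using h5 i
    exact RingHom.congr_fun h7 P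
  · intro y hy
    obtain ⟨R, _, j, hj, φ, t, φ', ⟨x, rfl⟩, hφ, ht, h1, h2⟩ := hlift _ hy
    rw [← h2]
    exact ⟨specMap φ' x, (Scheme.Hom.comp_apply _ _ _).symm⟩

/-- The blow-up is an isomorphism over an open set where the ideal of the center is trivial. -/
theorem exists_openImmersion_of_comap_eq_top {π : X' ⟶ X} {I : X.IdealSheafData}
    (hπ : IsBlowup π I) (v : Spec (CommRingCat.of A) ⟶ X) [IsOpenImmersion v]
    (hv : I.comap v = specIdeal ⊤) :
    ∃ r : Spec (CommRingCat.of A) ⟶ X', r ≫ π = v ∧ IsOpenImmersion r ∧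
      ∀ y, π y ∈ Set.range v → y ∈ Set.range r := by
  have hc : I.comap v = specIdeal (Ideal.span (Set.range fun _ : Unit ↦ (1 : A))) := by
    rw [hv, Set.range_const, Ideal.span_singleton_one]
  obtain ⟨r, h1, h2, h3⟩ := exists_blowup_openImmersion hπ v (fun _ : Unit ↦ (1 : A)) hc ()
    (RingHom.id A) (fun _ ↦ 1) (by simp) (by simp)
    (fun R _ φ t _ ht ↦ ⟨φ, RingHom.comp_id φ, fun i ↦ by rw [map_one, ← ht]⟩)
    (fun a ↦ ⟨MvPolynomial.C a, by simp⟩)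
  refine ⟨r, ?_, h2, fun y hy ↦ ?_⟩
  · rw [h1]
    simp [specMap]
  · obtain ⟨k, hk⟩ := exists_isChartPoint hπ.1 v _ hc y hy
    exact h3 y hk

end

/-! ### Stalks of ideal sheaves and transversal slices under open immersions -/

section

variable {X W S : Scheme.{0}}

theorem map_ideal_germ_eq (I : X.IdealSheafData) (x : X) {U V : X.affineOpens}
    (hVU : (V : X.Opens) ≤ U) (hx : x ∈ (V : X.Opens)) :
    (I.ideal V).map (X.presheaf.germ (V : X.Opens) x hx).hom =
      (I.ideal U).map (X.presheaf.germ (U : X.Opens) x (hVU hx)).hom := by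
  rw [← I.map_ideal hVU, Ideal.map_map, ← CommRingCat.hom_comp]
  congr 2
  exact X.presheaf.germ_res (homOfLE hVU) x hx

theorem exists_affineOpen_le {U V : X.Opens} {x : X} (hU : x ∈ U) (hV : x ∈ V) :
    ∃ W : X.affineOpens, x ∈ (W : X.Opens) ∧ (W : X.Opens) ≤ U ∧ (W : X.Opens) ≤ V := by
  obtain ⟨_, ⟨W, hW, rfl⟩, hxW, hWU⟩ :=
    X.isBasis_affineOpens.exists_subset_of_mem_open (show x ∈ U ⊓ V from ⟨hU, hV⟩) (U ⊓ V).2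
  exact ⟨⟨W, hW⟩, hxW, fun y hy ↦ (hWU hy).1, fun y hy ↦ (hWU hy).2⟩

theorem stalkIdeal_eq (I : X.IdealSheafData) (U : X.affineOpens) {x : X}
    (hx : x ∈ (U : X.Opens)) :
    stalkIdeal I x = (I.ideal U).map (X.presheaf.germ (U : X.Opens) x hx).hom := by
  apply le_antisymm
  · refine iSup₂_le fun V hV ↦ ?_
    obtain ⟨W, hW, hWU, hWV⟩ := exists_affineOpen_le hx hV
    rw [← map_ideal_germ_eq I x hWU hW, ← map_ideal_germ_eq I x hWV hW]
  · exact le_iSup₂_of_le U hx le_rfl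

theorem stalkIdeal_comap (I : X.IdealSheafData) (j : W ⟶ X) [IsOpenImmersion j] (w : W) :
    stalkIdeal (I.comap j) w = (stalkIdeal I (j w)).map (j.stalkMap w).hom := by
  obtain ⟨U, hU, -, -⟩ := exists_affineOpen_le (X := X) (U := ⊤) (V := ⊤) (x := j w) trivial trivial
  obtain ⟨V, hV, hVU, -⟩ := exists_affineOpen_le (X := W) (U := j ⁻¹ᵁ U) (V := ⊤) (x := w) hU trivial
  rw [stalkIdeal_eq _ V hV, stalkIdeal_eq _ U hU, ideal_comap_eq_map_appLE I j V U hVU,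
    Ideal.map_map, Ideal.map_map, ← CommRingCat.hom_comp, ← CommRingCat.hom_comp]
  congr 2
  rw [Scheme.Hom.germ_stalkMap, Scheme.Hom.appLE, Category.assoc]
  congr 1
  exact W.presheaf.germ_res (homOfLE hVU) w hV

theorem comap_reducedIdeal_spec {A : Type} [CommRing A] (Z : Set X)
    (v : Spec (CommRingCat.of A) ⟶ X) [IsOpenImmersion v] :
    (reducedIdeal Z).comap v = specIdeal (PrimeSpectrum.vanishingIdeal (v ⁻¹' closure Z)) := by
  obtain ⟨U, φ, hU, hφ, hi, hv⟩ := exists_affineOpen_of_isOpenImmersion v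
  have hpt : ∀ x : Spec (CommRingCat.of A), v x = affineInclusion U (specMap φ x) := fun x ↦ by
    conv_lhs => rw [← hv]
    exact Scheme.Hom.comp_apply _ _ _
  have h1 : (reducedIdeal Z).comap v = specIdeal (((reducedIdeal Z).ideal U).map φ) := by
    rw [← comap_eq_specIdeal, hv]
  rw [h1]
  congr 1
  have h2 : (reducedIdeal Z).ideal U =
      PrimeSpectrum.vanishingIdeal (affineInclusion U ⁻¹' closure Z) := rfl
  rw [h2]
  ext a
  obtain ⟨b, rfl⟩ := hφ.2 a
  rw [← Ideal.mem_comap, Ideal.comap_map_of_bijective φ hφ, PrimeSpectrum.mem_vanishingIdeal,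
    PrimeSpectrum.mem_vanishingIdeal]
  constructor
  · intro h x hx
    exact h (specMap φ x) ((congrArg (· ∈ closure Z) (hpt x)).mp hx)
  · intro h y hy
    obtain ⟨x, rfl⟩ := (specMap φ).surjective y
    exact h x ((congrArg (· ∈ closure Z) (hpt x)).mpr hy)

theorem comap_reducedIdeal (Z : Set X) (j : W ⟶ X) [IsOpenImmersion j] :
    (reducedIdeal Z).comap j = reducedIdeal (j ⁻¹' Z) := by
  apply idealSheaf_ext
  intro x
  obtain ⟨U, hU, -, -⟩ := exists_affineOpen_le (X := W) (U := ⊤) (V := ⊤) (x := x) trivial trivial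
  refine ⟨_, _, affineInclusion U, inferInstance, by rwa [range_affineInclusion], ?_⟩
  rw [← Scheme.IdealSheafData.comap_comp, comap_reducedIdeal_spec, comap_reducedIdeal_spec,
    ← j.isOpenEmbedding.isOpenMap.preimage_closure_eq_closure_preimage j.continuous]
  congr 2

theorem IsOrdinaryMultiplePoint.map_equiv {m : ℕ} {R R' : Type} [CommRing R] [CommRing R']
    (e : R ≃+* R') {K : Ideal R} (h : IsOrdinaryMultiplePoint m R K) :
    IsOrdinaryMultiplePoint m R' (K.map (e : R →+* R')) := by
  obtain ⟨hreg, d, x, P, hd, hx, hP, hK, hP0, hs⟩ := h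
  have hreg' : IsRegularLocalRing R' := IsRegularLocalRing.of_ringEquiv e
  let k := IsLocalRing.ResidueField.mapEquiv e
  have hk : (k : IsLocalRing.ResidueField R →+* IsLocalRing.ResidueField R').comp
      (IsLocalRing.residue R) = (IsLocalRing.residue R').comp (e : R →+* R') := RingHom.ext fun _ ↦ rfl
  have hmap : MvPolynomial.map (IsLocalRing.residue R') (MvPolynomial.map (e : R →+* R') P) =
      MvPolynomial.map (k : IsLocalRing.ResidueField R →+* IsLocalRing.ResidueField R')
        (MvPolynomial.map (IsLocalRing.residue R) P) := by
    rw [MvPolynomial.map_map, MvPolynomial.map_map, hk]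
  have heval : ∀ (Q : MvPolynomial (Fin d) (IsLocalRing.ResidueField R))
      (y : Fin d → IsLocalRing.ResidueField R'),
      MvPolynomial.eval y (MvPolynomial.map
        (k : IsLocalRing.ResidueField R →+* IsLocalRing.ResidueField R') Q) =
      k (MvPolynomial.eval (fun i ↦ k.symm (y i)) Q) := by
    intro Q y
    rw [MvPolynomial.eval_map]
    have := MvPolynomial.eval₂_comp_left
      (k : IsLocalRing.ResidueField R →+* IsLocalRing.ResidueField R') (RingHom.id _)
      (fun i ↦ k.symm (y i)) Q
    rw [RingHom.comp_id] at this
    refine Eq.trans ?_ this.symm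
    congr 1
    funext i
    exact (k.apply_symm_apply (y i)).symm
  refine ⟨hreg', d, e ∘ x, MvPolynomial.map (e : R →+* R') P, ?_, ?_, hP.map _, ?_, ?_, ?_⟩
  · rw [← hd, ringKrullDim_eq_of_ringEquiv e]
  · rw [Set.range_comp]
    have h1 : Ideal.map (e : R →+* R') (Ideal.span (Set.range x)) =
      Ideal.span (e '' Set.range x) := Ideal.map_span _ _
    rw [← h1, hx]
    exact IsLocalRing.map_maximalIdeal_of_surjective (e : R →+* R') e.surjective
  · rw [hK, Ideal.map_span, Set.image_singleton]
    congr 2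
    have := MvPolynomial.eval₂_comp_left (e : R →+* R') (RingHom.id _) x P
    rw [RingHom.comp_id] at this
    refine Eq.trans this ?_
    rw [MvPolynomial.eval_map]
    rfl
  · rw [hmap]
    intro h0
    exact hP0 (MvPolynomial.map_injective _ k.injective (h0.trans (map_zero _).symm))
  · intro y hy h0
    rw [hmap] at h0 ⊢
    rw [heval, map_eq_zero_iff k k.injective] at h0
    obtain ⟨i, hi⟩ := hs (fun i ↦ k.symm (y i)) (fun hz ↦ hy (funext fun i ↦ by
      have := congr_fun hz i
      exact (map_eq_zero_iff k.symm k.symm.injective).mp this)) h0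
    refine ⟨i, ?_⟩
    rw [MvPolynomial.pderiv_map, heval]
    exact (map_ne_zero_iff k k.injective).mpr hi

theorem preimage_singularLocus (p : X ⟶ S) (I : X.IdealSheafData) (j : W ⟶ X)
    [IsOpenImmersion j] : j ⁻¹' singularLocus p I = singularLocus (j ≫ p) (I.comap j) :=
  Set.ext fun w ↦ (mem_singularLocus_comap_iff p I j w).symm

theorem ordinarySlices_map_equiv {m : ℕ} {R R' : Type} [CommRing R] [CommRing R'] [IsLocalRing R]
    [IsLocalRing R'] (e : R ≃+* R') {C K : Ideal R} {C' K' : Ideal R'}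
    (hC : C' = C.map (e : R →+* R')) (hK : K' = K.map (e : R →+* R'))
    (h : IsRegularLocalRing (R ⧸ C) ∧ ringKrullDim (R ⧸ C) = 1 ∧
      ∀ t : R, IsLocalRing.maximalIdeal R = C ⊔ Ideal.span {t} →
        IsOrdinaryMultiplePoint m (R ⧸ Ideal.span {t})
          (K.map (Ideal.Quotient.mk (Ideal.span {t})))) :
    IsRegularLocalRing (R' ⧸ C') ∧ ringKrullDim (R' ⧸ C') = 1 ∧
      ∀ t : R', IsLocalRing.maximalIdeal R' = C' ⊔ Ideal.span {t} →
        IsOrdinaryMultiplePoint m (R' ⧸ Ideal.span {t})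
          (K'.map (Ideal.Quotient.mk (Ideal.span {t}))) := by
  obtain ⟨h1, h2, h3⟩ := h
  have eC := Ideal.quotientEquiv C C' e hC
  refine ⟨IsRegularLocalRing.of_ringEquiv eC, by rw [← ringKrullDim_eq_of_ringEquiv eC, h2], ?_⟩
  intro t' ht'
  obtain ⟨t, rfl⟩ := e.surjective t'
  have ht : Ideal.span {e t} = (Ideal.span {t}).map (e : R →+* R') := by
    rw [Ideal.map_span, Set.image_singleton]
    rfl
  have hmax : (IsLocalRing.maximalIdeal R).map (e : R →+* R') = IsLocalRing.maximalIdeal R' :=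
    IsLocalRing.map_maximalIdeal_of_surjective (e : R →+* R') e.surjective
  have h4 : IsLocalRing.maximalIdeal R = C ⊔ Ideal.span {t} := by
    rw [← Ideal.comap_map_of_bijective (e : R →+* R') e.bijective (I := C ⊔ Ideal.span {t}),
      Ideal.map_sup, ← hC, ← ht, ← ht', ← hmax,
      Ideal.comap_map_of_bijective (e : R →+* R') e.bijective]
  let E := Ideal.quotientEquiv (Ideal.span {t}) (Ideal.span {e t}) e ht
  have hE : (K.map (Ideal.Quotient.mk (Ideal.span {t}))).map (E : _ →+* _) =
      K'.map (Ideal.Quotient.mk (Ideal.span {e t})) := by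
    rw [hK, Ideal.map_map, Ideal.map_map]
    congr 1
  rw [← hE]
  exact (h3 t h4).map_equiv E

/-- The condition on the transversal slices is compatible with open immersions. -/
theorem hasOrdinarySlicesAt_comap_iff (p : X ⟶ S) (I : X.IdealSheafData) (m : ℕ) (j : W ⟶ X)
    [IsOpenImmersion j] (w : W) :
    HasOrdinarySlicesAt (j ≫ p) (I.comap j) m w ↔ HasOrdinarySlicesAt p I m (j w) := by
  let e : X.presheaf.stalk (j w) ≃+* W.presheaf.stalk w :=
    (asIso (j.stalkMap w)).commRingCatIsoToRingEquiv
  have he : ∀ (K : Ideal (X.presheaf.stalk (j w))) (K' : Ideal (W.presheaf.stalk w)),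
      K' = K.map (e : _ →+* W.presheaf.stalk w) → K = K'.map (e.symm : _ →+* _) := by
    rintro K _ rfl
    have hid : (e.symm : _ →+* X.presheaf.stalk (j w)).comp (e : _ →+* W.presheaf.stalk w) =
        RingHom.id _ := RingHom.ext fun x ↦ e.symm_apply_apply x
    rw [Ideal.map_map, hid, Ideal.map_id]
  have hC : stalkIdeal (reducedIdeal (singularLocus (j ≫ p) (I.comap j))) w =
      (stalkIdeal (reducedIdeal (singularLocus p I)) (j w)).map
        (e : _ →+* W.presheaf.stalk w) := by
    rw [← preimage_singularLocus, ← comap_reducedIdeal, stalkIdeal_comap]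
    rfl
  have hK : stalkIdeal (I.comap j) w = (stalkIdeal I (j w)).map (e : _ →+* W.presheaf.stalk w) :=
    stalkIdeal_comap I j w
  exact ⟨ordinarySlices_map_equiv e.symm (he _ _ hC) (he _ _ hK), ordinarySlices_map_equiv e hC hK⟩

end

/-! ### Generators of tensor powers -/

section

variable {Y : Scheme.{0}} {L L' : Y.Modules}

/-- A generator of an invertible sheaf and its `m`-th power generate the sheaf and its tensor power
on small affine open sets; the power of `z • e` is `z ^ m` times the generator. -/
theorem exists_local_equations {m : ℕ} (hL : IsInvertible L) (hL' : IsInvertible L')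
    (T : TensorPowerIso m L' L) (f : Γ(L, ⊤)) (h : Γ(L', ⊤)) {x : Y} {O : Y.Opens} (hx : x ∈ O) :
    ∃ (V : Y.affineOpens) (e' : Γ(L', (V : Y.Opens))) (e : Γ(L, (V : Y.Opens)))
      (z a : Γ(Y, (V : Y.Opens))), x ∈ (V : Y.Opens) ∧ (V : Y.Opens) ≤ O ∧
      IsLocalGenerator L' e' ∧ IsLocalGenerator L e ∧
      restrictSection L' le_top h = z • e' ∧ restrictSection L le_top f = a • e ∧
      restrictSection L le_top (T.pow h) = z ^ m • e := by
  obtain ⟨V₁, e₁, hx₁, he₁⟩ := hL x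
  obtain ⟨V₂, e₂, hx₂, he₂⟩ := hL' x
  obtain ⟨V₃, hV₃, hx₃, hb⟩ := T.bijective (V₁ ⊓ V₂ ⊓ O) x ⟨⟨hx₁, hx₂⟩, hx⟩
  have h₁ : V₃ ≤ V₁ := fun y hy ↦ (hV₃ hy).1.1
  have h₂ : V₃ ≤ V₂ := fun y hy ↦ (hV₃ hy).1.2
  have h₃ : V₃ ≤ O := fun y hy ↦ (hV₃ hy).2
  set e' := restrictSection L' h₂ e₂ with he'
  have hge' : IsLocalGenerator L' e' := he₂.restrict h₂
  set ℓ := restrictSection L h₁ e₁ with hℓ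
  have hgℓ : IsLocalGenerator L ℓ := he₁.restrict h₁
  set ε := T.mul V₃ (fun _ ↦ e') with hε
  have hself : ∀ {M : Y.Modules} {U : Y.Opens} (s : Γ(M, U)),
      restrictSection M (le_refl U) s = s := by
    intro M U s
    have : M.presheaf.map (homOfLE (le_refl U)).op = 𝟙 _ :=
      CategoryTheory.Functor.map_id M.presheaf (Opposite.op U)
    unfold restrictSection
    rw [this]
    rfl
  have hmulpow : ∀ s : Fin m → Γ(L', V₃), ∃ c : Γ(Y, V₃), T.mul V₃ s = c • ε := by
    intro s
    have : ∀ i, ∃ c : Γ(Y, V₃), s i = c • e' := fun i ↦ by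
      obtain ⟨c, hc⟩ := hge'.exists_smul_eq le_rfl (s i)
      rw [hself] at hc
      exact ⟨c, hc⟩
    choose c hc using this
    refine ⟨∏ i, c i, ?_⟩
    rw [show s = fun i ↦ c i • e' from funext hc, MultilinearMap.map_smul_univ]
  have hspan : ∀ t, ∃ c : Γ(Y, V₃), PiTensorProduct.lift (T.mul V₃) t = c • ε := by
    intro t
    induction t using PiTensorProduct.induction_on with
    | smul_tprod r s =>
      obtain ⟨c, hc⟩ := hmulpow s
      refine ⟨r * c, ?_⟩
      rw [map_smul, PiTensorProduct.lift.tprod, hc, mul_smul]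
    | add t t' ht ht' =>
      obtain ⟨c, hc⟩ := ht
      obtain ⟨c', hc'⟩ := ht'
      exact ⟨c + c', by rw [map_add, hc, hc', add_smul]⟩
  obtain ⟨t, ht⟩ := hb.2 ℓ
  obtain ⟨c, hc⟩ := hspan t
  rw [ht] at hc
  obtain ⟨d, hd⟩ := hgℓ.exists_smul_eq le_rfl ε
  rw [hself] at hd
  have hcd : c * d = 1 := by
    apply (hgℓ V₃ le_rfl).1
    change (c * d) • restrictSection L _ ℓ = (1 : Γ(Y, V₃)) • restrictSection L _ ℓ
    rw [hself, one_smul, mul_smul, ← hd, ← hc]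
  have hgε : IsLocalGenerator L ε := by
    intro W hW
    have hr : restrictSection L hW ε = restrictFun hW d • restrictSection L hW ℓ := by
      rw [hd, restrictSection_smul]
    have hu : restrictFun hW c * restrictFun hW d = 1 := by rw [← map_mul, hcd, map_one]
    constructor
    · intro a b hab
      dsimp only at hab
      rw [hr, smul_smul, smul_smul] at hab
      have := (hgℓ W hW).1 hab
      calc a = a * restrictFun hW d * restrictFun hW c := by
            rw [mul_assoc, mul_comm (restrictFun hW d), hu, mul_one]
        _ = b * restrictFun hW d * restrictFun hW c := by rw [this]
        _ = b := by rw [mul_assoc, mul_comm (restrictFun hW d), hu, mul_one]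
    · intro s
      obtain ⟨a, ha⟩ := (hgℓ W hW).2 s
      refine ⟨a * restrictFun hW c, ?_⟩
      dsimp only at ha ⊢
      rw [hr, smul_smul, mul_assoc, hu, mul_one, ha]
  obtain ⟨V, hxV, hV, -⟩ := exists_affineOpen_le hx₃ hx₃
  obtain ⟨z, hz⟩ := hge'.exists_smul_eq hV (restrictSection L' le_top h)
  obtain ⟨a, ha⟩ := hgε.exists_smul_eq hV (restrictSection L le_top f)
  refine ⟨V, restrictSection L' hV e', restrictSection L hV ε, z, a, hxV, hV.trans h₃,
    hge'.restrict hV, hgε.restrict hV, hz, ha, ?_⟩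
  rw [TensorPowerIso.pow, T.restrict_mul, T.restrict_mul, hz, MultilinearMap.map_smul_univ,
    Finset.prod_const, Finset.card_univ, Fintype.card_fin]

end

/-! ### Local equations of the proper transforms -/

section

variable {Y Y' : Scheme.{0}}

/-- An affine chart `r : Spec B ⟶ Y'` of the modification `π : Y' ⟶ Y` with local equations of the
proper transforms: the inverse image of the center `Z` is the zero set of `e`, the pullbacks of
`V_f` and `V_{f + s g}` have the equations `e ^ N F` and `e ^ N (F + s G)`, and `e` is a
non-zero-divisor modulo `F` and modulo `F + s G`. -/
structure IsEquationChart (p : Y ⟶ Spec (CommRingCat.of ℂ)) (π : Y' ⟶ Y) (Z : Set Y)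
    {L : Y.Modules} (f g : Γ(L, ⊤)) {B : Type} [CommRing B] [Algebra ℂ B]
    (r : Spec (CommRingCat.of B) ⟶ Y') (e F G : B) : Prop where
  isOpenImmersion : IsOpenImmersion r
  over_eq : r ≫ π ≫ p = specOver B
  formallySmooth : Algebra.FormallySmooth ℂ B
  finiteType : Algebra.FiniteType ℂ B
  equations : ∃ N : ℕ, (zeroIdeal f).comap (r ≫ π) = specIdeal (Ideal.span {e ^ N * F}) ∧
    (pencilIdeal f g).comap (lineChart (r ≫ π)) =
      specIdeal (Ideal.span {MvPolynomial.C e ^ N *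
        (MvPolynomial.C F + MvPolynomial.X PUnit.unit * MvPolynomial.C G)})
  mem_center_iff : ∀ x, (r ≫ π) x ∈ Z ↔ e ∈ x.asIdeal
  saturated : ∀ b, e * b ∈ Ideal.span {F} → b ∈ Ideal.span {F}
  saturated_pencil : ∀ b : MvPolynomial PUnit.{1} B,
    MvPolynomial.C e * b ∈
        Ideal.span {MvPolynomial.C F + MvPolynomial.X PUnit.unit * MvPolynomial.C G} →
      b ∈ Ideal.span {MvPolynomial.C F + MvPolynomial.X PUnit.unit * MvPolynomial.C G}

variable {p : Y ⟶ Spec (CommRingCat.of ℂ)} {π : Y' ⟶ Y} {Z : Set Y} {L : Y.Modules}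
  {f g : Γ(L, ⊤)} {B : Type} [CommRing B] [Algebra ℂ B] {r : Spec (CommRingCat.of B) ⟶ Y'}
  {e F G : B}

theorem IsEquationChart.comap_fiberTransform [IsLocallyNoetherian Y]
    (h : IsEquationChart p π Z f g r e F G) (hZ : IsClosed Z) :
    (fiberTransform π Z f).comap r = specIdeal (Ideal.span {F}) := by
  have := h.isOpenImmersion
  obtain ⟨N, h1, -⟩ := h.equations
  exact comap_properTransform π hZ (zeroIdeal f) r h1 h.mem_center_iff h.saturated

theorem IsEquationChart.comap_pencilTransform [IsLocallyNoetherian Y]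
    (h : IsEquationChart p π Z f g r e F G) (hZ : IsClosed Z) :
    (pencilTransform π Z f g).comap (lineChart r) = specIdeal
      (Ideal.span {MvPolynomial.C F + MvPolynomial.X PUnit.unit * MvPolynomial.C G}) := by
  have := h.isOpenImmersion
  obtain ⟨N, -, h1⟩ := h.equations
  have : LocallyOfFiniteType (proj Y) :=
    inferInstanceAs (LocallyOfFiniteType (AffineSpace PUnit.{1} Y ↘ Y))
  have : IsLocallyNoetherian (timesLine Y) := LocallyOfFiniteType.isLocallyNoetherian (proj Y)
  refine comap_properTransform (AffineSpace.map PUnit.{1} π) (hZ.preimage (proj Y).continuous)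
    (pencilIdeal f g) (lineChart r) (e := MvPolynomial.C e) (N := N) ?_ ?_ h.saturated_pencil
  · rw [← lineChart_comp, h1]
  · intro x
    rw [← lineChart_comp, Set.mem_preimage, ← Scheme.Hom.comp_apply, lineChart_proj,
      Scheme.Hom.comp_apply, h.mem_center_iff]
    rfl

theorem specMap_eval_lineChart {B : Type} [CommRing B] {X : Scheme.{0}}
    (r : Spec (CommRingCat.of B) ⟶ X) :
    specMap (MvPolynomial.eval₂Hom (RingHom.id B) fun _ : PUnit.{1} ↦ 0) ≫ lineChart r =
      r ≫ zeroSection X := by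
  have h1 : (MvPolynomial.eval₂Hom (RingHom.id B) fun _ : PUnit.{1} ↦ (0 : B)).comp
      MvPolynomial.C = RingHom.id B := RingHom.ext fun b ↦ MvPolynomial.eval₂_C _ _ b
  apply AffineSpace.hom_ext
  · have h2 : zeroSection X ≫ proj X = 𝟙 X := AffineSpace.homOfVector_over _ _
    change _ ≫ proj X = _ ≫ proj X
    rw [Category.assoc, lineChart_proj, ← Category.assoc, ← specMap_comp, h1, Category.assoc, h2]
    simp [specMap]
  · rintro ⟨⟩
    have h3 : (zeroSection X).appTop (AffineSpace.coord X PUnit.unit) = 0 :=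
      AffineSpace.homOfVector_appTop_coord _ _ _
    rw [Scheme.Hom.comp_appTop, Scheme.Hom.comp_appTop, CommRingCat.comp_apply,
      CommRingCat.comp_apply, h3, map_zero]
    have h4 := pullbackSections_lineChart_lineCoord r (fun x _ ↦ trivial)
    have h5 : (Scheme.ΓSpecIso _).hom.hom
        ((lineChart r).appTop (AffineSpace.coord X PUnit.unit)) = MvPolynomial.X PUnit.unit := by
      rw [← h4]
      have h1 : (lineChart r).appLE ⊤ ⊤ (fun x _ ↦ trivial) = (lineChart r).appTop :=
        (Scheme.Hom.app_eq_appLE _).symm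
      exact congr((Scheme.ΓSpecIso _).hom.hom ($(h1.symm).hom _))
    have h6 := (map_eq_zero_iff _ (ConcreteCategory.bijective_of_isIso
      (Scheme.ΓSpecIso (CommRingCat.of B)).hom).1 (x := (specMap (MvPolynomial.eval₂Hom
        (RingHom.id B) fun _ : PUnit.{1} ↦ 0)).appTop
        ((lineChart r).appTop (AffineSpace.coord X PUnit.unit)))).mp
    apply h6
    have h7 := congr($(Scheme.ΓSpecIso_naturality (CommRingCat.ofHom (MvPolynomial.eval₂Hom
        (RingHom.id B) fun _ : PUnit.{1} ↦ 0))).hom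
        ((lineChart r).appTop (AffineSpace.coord X PUnit.unit)))
    refine h7.trans ?_
    change (MvPolynomial.eval₂Hom (RingHom.id B) fun _ : PUnit.{1} ↦ 0)
      ((Scheme.ΓSpecIso _).hom.hom
        ((lineChart r).appTop (AffineSpace.coord X PUnit.unit))) = 0
    rw [h5]
    exact MvPolynomial.eval₂_X _ _ _

/-- The proper transform of `V_f` is the fibre at `s = 0` of the proper transform of
`V_{f + s g}`. -/
theorem comap_zeroSection_pencilTransform [IsLocallyNoetherian Y] (hZ : IsClosed Z)
    (h : ∀ y : Y', ∃ (B : Type) (_ : CommRing B) (_ : Algebra ℂ B)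
      (r : Spec (CommRingCat.of B) ⟶ Y') (e F G : B),
      IsEquationChart p π Z f g r e F G ∧ y ∈ Set.range r) :
    (pencilTransform π Z f g).comap (zeroSection Y') = fiberTransform π Z f := by
  apply idealSheaf_ext
  intro y
  obtain ⟨B, _, _, r, e, F, G, hr, hy⟩ := h y
  refine ⟨B, _, r, hr.isOpenImmersion, hy, ?_⟩
  rw [hr.comap_fiberTransform hZ, ← Scheme.IdealSheafData.comap_comp, ← specMap_eval_lineChart,
    Scheme.IdealSheafData.comap_comp, hr.comap_pencilTransform hZ, comap_specIdeal,
    Ideal.map_span, Set.image_singleton]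
  congr 3
  simp

/-- Smoothness of the proper transform of `V_{f + s g}` by the Jacobian criterion in charts. -/
theorem smooth_pencilTransform [IsLocallyNoetherian Y] (hZ : IsClosed Z)
    (h : ∀ y : Y', ∃ (B : Type) (_ : CommRing B) (_ : Algebra ℂ B)
      (r : Spec (CommRingCat.of B) ⟶ Y') (e F G : B) (x : Spec (CommRingCat.of B)),
      IsEquationChart p π Z f g r e F G ∧ r x = y ∧
      ∀ q : Ideal (MvPolynomial PUnit.{1} B), q.IsPrime → q.comap MvPolynomial.C = x.asIdeal →
        MvPolynomial.C F + MvPolynomial.X PUnit.unit * MvPolynomial.C G ∈ q →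
        ∃ D : Derivation ℂ (MvPolynomial PUnit.{1} B) (MvPolynomial PUnit.{1} B),
          D (MvPolynomial.C F + MvPolynomial.X PUnit.unit * MvPolynomial.C G) ∉ q) :
    Smooth ((pencilTransform π Z f g).subschemeι ≫ proj Y' ≫ π ≫ p) := by
  apply smooth_of_forall_exists
  intro P hP
  obtain ⟨B, _, _, r, e, F, G, x, hr, hx, hD⟩ := h (proj Y' P)
  have := hr.isOpenImmersion
  have := hr.formallySmooth
  have := hr.finiteType
  obtain ⟨Q, rfl⟩ := mem_range_lineChart r ⟨x, hx⟩
  have hQx : specMap MvPolynomial.C Q = x := by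
    apply r.isOpenEmbedding.injective
    rw [hx, ← Scheme.Hom.comp_apply, ← lineChart_proj, Scheme.Hom.comp_apply]
  have hQ : Q ∈ ((pencilTransform π Z f g).comap (lineChart r)).support := by
    rw [Scheme.IdealSheafData.support_comap]
    exact hP
  rw [hr.comap_pencilTransform hZ] at hQ
  have hQ' : Q ∈ PrimeSpectrum.zeroLocus (Ideal.span
      {MvPolynomial.C F + MvPolynomial.X PUnit.unit * MvPolynomial.C G} :
        Set (MvPolynomial PUnit.{1} B)) := by
    have h := support_specIdeal (Ideal.span
      {MvPolynomial.C F + MvPolynomial.X PUnit.unit * MvPolynomial.C G} :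
        Ideal (MvPolynomial PUnit.{1} B))
    exact h.le hQ
  have hmem : MvPolynomial.C F + MvPolynomial.X PUnit.unit * MvPolynomial.C G ∈ Q.asIdeal :=
    hQ' (Ideal.subset_span rfl)
  obtain ⟨D, hD⟩ := hD Q.asIdeal Q.2 (by rw [← hQx]; rfl) hmem
  have : Algebra.FormallySmooth ℂ (MvPolynomial PUnit.{1} B) :=
    Algebra.FormallySmooth.comp ℂ B _
  have : Algebra.FiniteType ℂ (MvPolynomial PUnit.{1} B) :=
    Algebra.FiniteType.trans (S := B) inferInstance inferInstance
  obtain ⟨W, j, hj, hQj, hs⟩ := exists_smooth_of_derivation _ Q D hD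
  refine ⟨W, j ≫ lineChart r, inferInstance, ?_, ?_⟩
  · obtain ⟨w, hw⟩ := hQj
    exact ⟨w, by rw [Scheme.Hom.comp_apply, hw]⟩
  · have h1 : (j ≫ lineChart r) ≫ proj Y' ≫ π ≫ p = j ≫ specOver (MvPolynomial PUnit.{1} B) := by
      rw [Category.assoc, ← Category.assoc (lineChart r), lineChart_proj, Category.assoc, hr.over_eq,
        ← specMap_comp]
      rfl
    rw [h1, Scheme.IdealSheafData.comap_comp, hr.comap_pencilTransform hZ]
    exact hs

end

/-! ### Hypersurfaces in smooth varieties -/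

theorem isLocallyNoetherian_of_smooth {Y : Scheme.{0}} (p : Y ⟶ Spec (CommRingCat.of ℂ))
    [Smooth p] : IsLocallyNoetherian Y :=
  LocallyOfFiniteType.isLocallyNoetherian p

theorem jacobsonSpace_of_smooth {Y : Scheme.{0}} (p : Y ⟶ Spec (CommRingCat.of ℂ)) [Smooth p] :
    JacobsonSpace Y :=
  LocallyOfFiniteType.jacobsonSpace p

section

variable {Y : Scheme.{0}} (p : Y ⟶ Spec (CommRingCat.of ℂ)) [Smooth p]

theorem locallyOfFinitePresentation_subscheme (I : Y.IdealSheafData) :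
    LocallyOfFinitePresentation (I.subschemeι ≫ p) := by
  infer_instance

/-- The ring of an affine open subset of a smooth complex variety is a smooth complex algebra. -/
theorem exists_smooth_algebra (V : Y.affineOpens) :
    ∃ _ : Algebra ℂ Γ(Y, (V : Y.Opens)), affineInclusion V ≫ p = specOver Γ(Y, (V : Y.Opens)) ∧
      Algebra.Smooth ℂ Γ(Y, (V : Y.Opens)) := by
  let φ : ℂ →+* Γ(Y, (V : Y.Opens)) := (Spec.preimage (affineInclusion V ≫ p)).hom
  have hφ : specMap φ = affineInclusion V ≫ p := Spec.map_preimage _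
  algebraize [φ]
  have hs : Smooth (specMap φ) := by
    rw [hφ]
    infer_instance
  refine ⟨inferInstance, hφ.symm, ?_⟩
  have : RingHom.Smooth φ := (HasRingHomProperty.Spec_iff (P := @Smooth)).mp hs
  exact RingHom.smooth_algebraMap.mp this

variable {L : Y.Modules}

theorem mem_support_zeroIdeal_iff (hL : IsInvertible L) (f : Γ(L, ⊤)) (V : Y.affineOpens)
    {e : Γ(L, (V : Y.Opens))} (he : IsLocalGenerator L e) {a : Γ(Y, (V : Y.Opens))}
    (ha : restrictSection L le_top f = a • e)
    (x : Spec (CommRingCat.of Γ(Y, (V : Y.Opens)))) :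
    affineInclusion V x ∈ (zeroIdeal f).support ↔ a ∈ x.asIdeal := by
  have h1 := comap_affineInclusion (zeroIdeal f) V
  rw [ideal_zeroIdeal hL f V he ha] at h1
  have h2 : affineInclusion V x ∈ (zeroIdeal f).support ↔
      x ∈ ((zeroIdeal f).comap (affineInclusion V)).support := by
    rw [Scheme.IdealSheafData.support_comap]
    rfl
  rw [h2, h1]
  have h3 := support_specIdeal (Ideal.span {a})
  refine (Set.ext_iff.mp h3 x).trans ?_
  exact (Ideal.span_singleton_le_iff_mem x.asIdeal)

/-- A point outside the singular locus has a neighbourhood in which a derivation detects the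
hypersurface. -/
theorem exists_derivation_of_disjoint_singularLocus [IsIntegral Y] (hL : IsInvertible L)
    (f : Γ(L, ⊤)) (V : Y.affineOpens) [Algebra ℂ Γ(Y, (V : Y.Opens))]
    [Algebra.FormallySmooth ℂ Γ(Y, (V : Y.Opens))]
    (hp : affineInclusion V ≫ p = specOver Γ(Y, (V : Y.Opens)))
    {e : Γ(L, (V : Y.Opens))} (he : IsLocalGenerator L e) {a : Γ(Y, (V : Y.Opens))}
    (ha : restrictSection L le_top f = a • e) (ha0 : a ≠ 0)
    (hV : ∀ x, affineInclusion V x ∉ singularLocus p (zeroIdeal f)) :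
    ∃ D : Derivation ℂ Γ(Y, (V : Y.Opens)) Γ(Y, (V : Y.Opens)), D a - 1 ∈ Ideal.span {a} := by
  have hnt : Nontrivial Γ(Y, (V : Y.Opens)) := ⟨a, 0, ha0⟩
  have hne : Nonempty (V : Y.Opens) := by
    by_contra hcon
    have hbot : (V : Y.Opens) = ⊥ := by
      ext y
      exact ⟨fun hy ↦ (hcon ⟨y, hy⟩).elim, fun hy ↦ hy.elim⟩
    have hsub : Subsingleton Γ(Y, (V : Y.Opens)) := by
      rw [hbot]
      infer_instance
    exact not_subsingleton _ hsub
  have hdom : IsDomain Γ(Y, (V : Y.Opens)) := inferInstance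
  have h1 : (zeroIdeal f).comap (affineInclusion V) = specIdeal (Ideal.span {a}) := by
    rw [comap_affineInclusion, ideal_zeroIdeal hL f V he ha]
  have h2 : singularLocus (affineInclusion V ≫ p) ((zeroIdeal f).comap (affineInclusion V)) = ∅ := by
    rw [← preimage_singularLocus, Set.eq_empty_iff_forall_notMem]
    exact hV
  have h3 := locallyOfFinitePresentation_subscheme (affineInclusion V ≫ p)
    ((zeroIdeal f).comap (affineInclusion V))
  have h4 := smooth_of_singularLocus_eq_empty _ _ h2
  rw [h1, hp, smooth_subscheme_specIdeal_iff] at h4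
  exact exists_derivation_of_formallySmooth a (mem_nonZeroDivisors_of_ne_zero ha0) inferInstance

/-- A section whose zero scheme has a singular point does not vanish on an open set. -/
theorem local_equation_ne_zero [IsIntegral Y] (hL : IsInvertible L)
    (f : Γ(L, ⊤)) (hne : (singularLocus p (zeroIdeal f)).Nonempty) (V : Y.affineOpens)
    (hV : ((V : Y.Opens) : Set Y).Nonempty)
    {e : Γ(L, (V : Y.Opens))} (he : IsLocalGenerator L e) {a : Γ(Y, (V : Y.Opens))}
    (ha : restrictSection L le_top f = a • e) : a ≠ 0 := by
  rintro rfl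
  have h1 : ((V : Y.Opens) : Set Y) ⊆ (zeroIdeal f).support := by
    intro y hy
    rw [← range_affineInclusion] at hy
    obtain ⟨x, rfl⟩ := hy
    exact (mem_support_zeroIdeal_iff hL f V he ha x).mpr (Ideal.zero_mem _)
  have h2 : Dense ((V : Y.Opens) : Set Y) := (V : Y.Opens).2.dense hV
  have h3 : ∀ y, y ∈ (zeroIdeal f).support := fun y ↦ by
    have := (zeroIdeal f).support.isClosed.closure_subset_iff.mpr h1
    exact this (h2 y)
  obtain ⟨y, hy⟩ := hne
  obtain ⟨O, e₀, hyO, he₀⟩ := hL y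
  obtain ⟨W, hyW, hWO, -⟩ := exists_affineOpen_le hyO hyO
  have he₁ := he₀.restrict hWO
  obtain ⟨b, hb⟩ := he₁.exists_smul_eq le_rfl (restrictSection L le_top f)
  rw [restrictSection_restrictSection] at hb
  obtain ⟨_, hpW, hs⟩ := exists_smooth_algebra p W
  have hb0 : b = 0 := by
    have hnil : b ∈ nilradical Γ(Y, (W : Y.Opens)) := by
      rw [nilradical_eq_sInf, Ideal.mem_sInf]
      intro q hq
      exact (mem_support_zeroIdeal_iff hL f W he₁ hb ⟨q, hq⟩).mp (h3 _)
    exact (mem_nilradical.mp hnil).eq_zero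
  have h4 : (zeroIdeal f).comap (affineInclusion W) = specIdeal (Ideal.span {0}) := by
    rw [comap_affineInclusion, ideal_zeroIdeal hL f W he₁ hb, hb0]
  obtain ⟨x, rfl⟩ : y ∈ Set.range (affineInclusion W) := by rwa [range_affineInclusion]
  have hx : x ∈ singularLocus (affineInclusion W ≫ p) ((zeroIdeal f).comap (affineInclusion W)) :=
    (mem_singularLocus_comap_iff p (zeroIdeal f) (affineInclusion W) x).mpr hy
  rw [h4, hpW] at hx
  have h5 : Smooth ((specIdeal (Ideal.span {(0 : Γ(Y, (W : Y.Opens)))})).subschemeι ≫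
      specOver Γ(Y, (W : Y.Opens))) := by
    rw [smooth_subscheme_specIdeal_iff, Ideal.span_singleton_eq_bot.mpr rfl]
    exact Algebra.Smooth.of_equiv (AlgEquiv.quotientBot ℂ Γ(Y, (W : Y.Opens))).symm
  rw [singularLocus_eq_empty] at hx
  exact hx

end

/-! ### Charts outside the exceptional divisor -/

/-- The Jacobian criterion for `a + s z ^ m`: a derivation not killing `a` modulo the prime, or
the derivative with respect to `s`. -/
theorem exists_derivation_pencil {A : Type} [CommRing A] [Algebra ℂ A] {m : ℕ} (hm : 2 ≤ m)
    (a z : A) (x : Ideal A) [x.IsPrime]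
    (hD : z ∈ x → a ∈ x → ∃ D : Derivation ℂ A A, D a ∉ x)
    (q : Ideal (MvPolynomial PUnit.{1} A)) (hqx : q.comap MvPolynomial.C = x)
    (hq : MvPolynomial.C a + MvPolynomial.X PUnit.unit * MvPolynomial.C (z ^ m) ∈ q) :
    ∃ D : Derivation ℂ (MvPolynomial PUnit.{1} A) (MvPolynomial PUnit.{1} A),
      D (MvPolynomial.C a + MvPolynomial.X PUnit.unit * MvPolynomial.C (z ^ m)) ∉ q := by
  have hC : ∀ b, MvPolynomial.C b ∈ q ↔ b ∈ x := fun b ↦ by rw [← hqx, Ideal.mem_comap]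
  by_cases hz : z ∈ x
  · have hzm : ∀ n : ℕ, n ≠ 0 → z ^ n ∈ x := fun n hn ↦ Ideal.pow_mem_of_mem x hz n (by omega)
    have h1 : MvPolynomial.X PUnit.unit * MvPolynomial.C (z ^ m) ∈ q :=
      Ideal.mul_mem_left _ _ ((hC _).mpr (hzm m (by omega)))
    have ha : a ∈ x := (hC _).mp ((Ideal.add_mem_iff_left q h1).mp hq)
    obtain ⟨D, hD⟩ := hD hz ha
    obtain ⟨D', hD', hX⟩ := exists_derivation_coeff (σ := PUnit.{1}) D
    refine ⟨D', fun hmem ↦ hD ?_⟩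
    have h2 : D (z ^ m) ∈ x := by
      rw [Derivation.leibniz_pow]
      exact x.smul_of_tower_mem _ (Ideal.mul_mem_right _ _ (hzm (m - 1) (by omega)))
    rw [map_add, Derivation.leibniz, hD', hD', hX, smul_zero, add_zero, smul_eq_mul] at hmem
    exact (hC _).mp ((Ideal.add_mem_iff_left q
      (Ideal.mul_mem_left _ _ ((hC _).mpr h2))).mp hmem)
  · refine ⟨(MvPolynomial.pderiv PUnit.unit).restrictScalars ℂ, fun hmem ↦ hz ?_⟩
    have h3 : (MvPolynomial.pderiv PUnit.unit).restrictScalars ℂ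
        (MvPolynomial.C a + MvPolynomial.X PUnit.unit * MvPolynomial.C (z ^ m)) =
        MvPolynomial.C (z ^ m) := by
      simp [Derivation.restrictScalars_apply]
    rw [h3, hC] at hmem
    exact Ideal.IsPrime.mem_of_pow_mem inferInstance m hmem

section

variable {Y Y' : Scheme.{0}} (p : Y ⟶ Spec (CommRingCat.of ℂ)) [IsIntegral Y] [Smooth p]
  {L L' : Y.Modules}

/-- Outside the exceptional divisor the blow-up is an isomorphism, and the pencil is smooth there:
at the points of the hypersurface off its singular locus because `g` vanishes to order `m ≥ 2` where
it vanishes, and at the singular points because `g` does not vanish. -/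
theorem exists_equationChart_off_center (hL : IsInvertible L) (hL' : IsInvertible L') {m : ℕ}
    (hm : 2 ≤ m) (T : TensorPowerIso m L' L) (f : Γ(L, ⊤)) (h : Γ(L', ⊤))
    (hne : (singularLocus p (zeroIdeal f)).Nonempty) (hZ : IsClosed (center p f h))
    {π : Y' ⟶ Y} (hπ : IsBlowup π (reducedIdeal (center p f h))) (y : Y')
    (hy : π y ∉ center p f h) :
    ∃ (B : Type) (_ : CommRing B) (_ : Algebra ℂ B)
      (r : Spec (CommRingCat.of B) ⟶ Y') (e F G : B) (x : Spec (CommRingCat.of B)),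
      IsEquationChart p π (center p f h) f (T.pow h) r e F G ∧ r x = y ∧
      (∀ q : Ideal (MvPolynomial PUnit.{1} B), q.IsPrime → q.comap MvPolynomial.C = x.asIdeal →
        MvPolynomial.C F + MvPolynomial.X PUnit.unit * MvPolynomial.C G ∈ q →
        ∃ D : Derivation ℂ (MvPolynomial PUnit.{1} B) (MvPolynomial PUnit.{1} B),
          D (MvPolynomial.C F + MvPolynomial.X PUnit.unit * MvPolynomial.C G) ∉ q) ∧
      IsOpenImmersion (r ≫ π) ∧ (zeroIdeal f).comap (r ≫ π) = specIdeal (Ideal.span {F}) := by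
  have hLFP := locallyOfFinitePresentation_subscheme p (zeroIdeal f)
  have hC := isClosed_singularLocus p (zeroIdeal f)
  obtain ⟨O, hyO, hOZ, hOC⟩ : ∃ O : Y.Opens, π y ∈ O ∧ (∀ o ∈ O, o ∉ center p f h) ∧
      (π y ∉ singularLocus p (zeroIdeal f) → ∀ o ∈ O, o ∉ singularLocus p (zeroIdeal f)) := by
    by_cases hyC : π y ∈ singularLocus p (zeroIdeal f)
    · exact ⟨⟨_, hZ.isOpen_compl⟩, hy, fun o ho ↦ ho, fun h' ↦ (h' hyC).elim⟩
    · exact ⟨⟨_, hC.isOpen_compl⟩, hyC, fun o ho h' ↦ ho h'.2, fun _ o ho ↦ ho⟩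
  obtain ⟨V, e', e, z, a, hyV, hVO, he', he, hz, ha, hg⟩ :=
    exists_local_equations hL hL' T f h hyO
  obtain ⟨_, hp, hs⟩ := exists_smooth_algebra p V
  have hv : ∀ x, affineInclusion V x ∈ O := fun x ↦
    hVO ((range_affineInclusion V).le (Set.mem_range_self x))
  have htop : (reducedIdeal (center p f h)).comap (affineInclusion V) = specIdeal ⊤ := by
    rw [comap_reducedIdeal_spec, hZ.closure_eq]
    congr 1
    have : affineInclusion V ⁻¹' center p f h = ∅ := by
      rw [Set.eq_empty_iff_forall_notMem]
      exact fun x hx ↦ hOZ _ (hv x) hx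
    exact (congrArg PrimeSpectrum.vanishingIdeal this).trans PrimeSpectrum.vanishingIdeal_empty
  obtain ⟨r, hr, hri, hrange⟩ := exists_openImmersion_of_comap_eq_top hπ (affineInclusion V) htop
  obtain ⟨x, hx⟩ := hrange y ((range_affineInclusion V).ge hyV)
  have hvx : affineInclusion V x = π y := by rw [← hx, ← Scheme.Hom.comp_apply, hr]
  have hid : specMap (RingHom.id Γ(Y, (V : Y.Opens))) ≫ affineInclusion V = affineInclusion V := by
    simp [specMap]
  have h1 : (zeroIdeal f).comap (affineInclusion V) = specIdeal (Ideal.span {a}) := by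
    have := comap_zeroIdeal hL f V he ha (RingHom.id _)
    rwa [hid, RingHom.id_apply] at this
  have h2 := comap_pencilIdeal hL f (T.pow h) V he ha hg (RingHom.id _)
  rw [hid, RingHom.id_apply, RingHom.id_apply] at h2
  refine ⟨Γ(Y, (V : Y.Opens)), inferInstance, inferInstance, r, 1, a, z ^ m, x, ?_, hx, ?_, ?_, ?_⟩
  · refine ⟨hri, ?_, inferInstance, inferInstance, ⟨0, ?_, ?_⟩, ?_, ?_, ?_⟩
    · rw [← Category.assoc, hr, hp]
    · rw [hr, h1, pow_zero, one_mul]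
    · rw [hr, h2, pow_zero, one_mul]
    · intro w
      rw [hr]
      exact ⟨fun hw ↦ (hOZ _ (hv w) hw).elim,
        fun hw ↦ (w.2.ne_top ((Ideal.eq_top_iff_one _).mpr hw)).elim⟩
    · intro b hb
      rwa [one_mul] at hb
    · intro b hb
      rwa [map_one, one_mul] at hb
  · intro q hq hqx hmem
    have := x.2
    refine exists_derivation_pencil hm a z x.asIdeal (fun hzx hax ↦ ?_) q hqx hmem
    have hnC : π y ∉ singularLocus p (zeroIdeal f) := fun hyC ↦ by
      refine hy ⟨?_, hyC⟩
      rw [← hvx]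
      exact (mem_support_zeroIdeal_iff hL' h V he' hz x).mpr hzx
    obtain ⟨D, hD⟩ := exists_derivation_of_disjoint_singularLocus p hL f V hp he ha
      (local_equation_ne_zero p hL f hne V ⟨_, hyV⟩ he ha) (fun w ↦ hOC hnC _ (hv w))
    refine ⟨D, fun hDa ↦ x.2.ne_top ((Ideal.eq_top_iff_one _).mpr ?_)⟩
    have h3 : D a - 1 ∈ x.asIdeal := (Ideal.span_singleton_le_iff_mem _).mpr hax hD
    simpa using sub_mem hDa h3
  · rw [hr]
    infer_instance
  · rw [hr, h1]

end

/-! ### Affine neighbourhoods of the points of the center -/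

section

variable {Y : Scheme.{0}}

theorem isMaximal_of_isClosed_singleton (V : Y.affineOpens)
    (x : Spec (CommRingCat.of Γ(Y, (V : Y.Opens)))) (hx : IsClosed {affineInclusion V x}) :
    x.asIdeal.IsMaximal := by
  have h1 : IsClosed (affineInclusion V ⁻¹' {affineInclusion V x}) :=
    hx.preimage (affineInclusion V).continuous
  have h2 : affineInclusion V ⁻¹' {affineInclusion V x} = {x} := by
    ext w
    exact (affineInclusion V).isOpenEmbedding.injective.eq_iff
  rw [h2] at h1
  exact (PrimeSpectrum.isClosed_singleton_iff_isMaximal x).mp h1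

theorem isClosed_singleton_of_isMaximal [JacobsonSpace Y] (V : Y.affineOpens)
    (x : Spec (CommRingCat.of Γ(Y, (V : Y.Opens)))) (hx : x.asIdeal.IsMaximal) :
    IsClosed {affineInclusion V x} := by
  apply isClosed_singleton_of_isLocallyClosed_singleton
  have h1 : IsClosed {x} := (PrimeSpectrum.isClosed_singleton_iff_isMaximal x).mpr hx
  have h2 := h1.isLocallyClosed.image (affineInclusion V).isOpenEmbedding.isInducing
    (affineInclusion V).isOpenEmbedding.isOpen_range.isLocallyClosed
  rwa [Set.image_singleton] at h2

/-- The stalk at a point of an affine open set is a localization of the ring of sections. -/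
theorem exists_stalk_algebra (V : Y.affineOpens)
    (x : Spec (CommRingCat.of Γ(Y, (V : Y.Opens)))) [x.asIdeal.IsPrime] :
    ∃ _ : Algebra Γ(Y, (V : Y.Opens)) (Y.presheaf.stalk (affineInclusion V x)),
      IsLocalization.AtPrime (Y.presheaf.stalk (affineInclusion V x)) x.asIdeal ∧
      ∀ I : Y.IdealSheafData, stalkIdeal I (affineInclusion V x) = (I.ideal V).map (algebraMap
        Γ(Y, (V : Y.Opens)) (Y.presheaf.stalk (affineInclusion V x))) := by
  have hx : affineInclusion V x ∈ (V : Y.Opens) :=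
    (range_affineInclusion V).le (Set.mem_range_self x)
  exact ⟨TopCat.Presheaf.algebra_section_stalk Y.presheaf ⟨affineInclusion V x, hx⟩,
    V.2.isLocalization_stalk' x hx, fun I ↦ stalkIdeal_eq I V hx⟩

theorem exists_mul_mem_sup_of_meetsTransversallyAt {I J : Y.IdealSheafData} (V : Y.affineOpens)
    (x : Spec (CommRingCat.of Γ(Y, (V : Y.Opens))))
    (h : MeetsTransversallyAt I J (affineInclusion V x)) (a : Γ(Y, (V : Y.Opens)))
    (ha : a ∈ x.asIdeal) : ∃ s ∉ x.asIdeal, s * a ∈ I.ideal V ⊔ J.ideal V := by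
  have := x.2
  obtain ⟨_, hloc, hst⟩ := exists_stalk_algebra V x
  have h1 : algebraMap Γ(Y, (V : Y.Opens)) (Y.presheaf.stalk (affineInclusion V x)) a ∈
      (I.ideal V ⊔ J.ideal V).map (algebraMap _ _) := by
    rw [Ideal.map_sup, ← hst, ← hst, ← h]
    exact (IsLocalization.AtPrime.to_map_mem_maximal_iff _ x.asIdeal a).mpr ha
  obtain ⟨⟨b, s⟩, hbs⟩ := (IsLocalization.mem_map_algebraMap_iff x.asIdeal.primeCompl _).mp h1
  dsimp only at hbs
  rw [← map_mul] at hbs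
  obtain ⟨t, ht⟩ := (IsLocalization.eq_iff_exists x.asIdeal.primeCompl _).mp hbs
  refine ⟨t * s, (t * s).2, ?_⟩
  rw [show (t : Γ(Y, (V : Y.Opens))) * s * a = t * (a * s) by ring, ht]
  exact Ideal.mul_mem_left _ _ b.2

/-- A function that generates the maximal ideal of a one-dimensional local ring of a curve is not
nilpotent on the curve near the point. -/
theorem mul_pow_notMem_of_ringKrullDim_eq_one {I J : Y.IdealSheafData} (V : Y.affineOpens)
    (x : Spec (CommRingCat.of Γ(Y, (V : Y.Opens))))
    (h : MeetsTransversallyAt I J (affineInclusion V x)) {z : Γ(Y, (V : Y.Opens))}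
    (hz : J.ideal V = Ideal.span {z})
    (hdim : ringKrullDim (Y.presheaf.stalk (affineInclusion V x) ⧸
      stalkIdeal I (affineInclusion V x)) = 1)
    (s : Γ(Y, (V : Y.Opens))) (hs : s ∉ x.asIdeal) (N : ℕ) : s * z ^ N ∉ I.ideal V := by
  intro hmem
  have := x.2
  obtain ⟨_, hloc, hst⟩ := exists_stalk_algebra V x
  let O := Y.presheaf.stalk (affineInclusion V x)
  let ψ : Γ(Y, (V : Y.Opens)) →+* O := algebraMap _ _
  have hu : IsUnit (ψ s) := IsLocalization.map_units _ (⟨s, hs⟩ : x.asIdeal.primeCompl)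
  have h1 : ψ z ^ N ∈ stalkIdeal I (affineInclusion V x) := by
    have h2 : ψ (s * z ^ N) ∈ stalkIdeal I (affineInclusion V x) := by
      rw [hst]
      exact Ideal.mem_map_of_mem _ hmem
    rw [map_mul, map_pow] at h2
    exact (Ideal.unit_mul_mem_iff_mem _ hu).mp h2
  have hJ : stalkIdeal J (affineInclusion V x) = Ideal.span {ψ z} := by
    rw [hst, hz, Ideal.map_span, Set.image_singleton]
  have h3 : Ring.KrullDimLE 0 (O ⧸ stalkIdeal I (affineInclusion V x)) := by
    refine Ring.KrullDimLE.mk₀ fun P hP ↦ ?_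
    have hP' := hP.comap (Ideal.Quotient.mk (stalkIdeal I (affineInclusion V x)))
    have hI : stalkIdeal I (affineInclusion V x) ≤
        P.comap (Ideal.Quotient.mk (stalkIdeal I (affineInclusion V x))) := fun a ha ↦ by
      rw [Ideal.mem_comap, Ideal.Quotient.eq_zero_iff_mem.mpr ha]
      exact P.zero_mem
    have hmax : IsLocalRing.maximalIdeal O ≤
        P.comap (Ideal.Quotient.mk (stalkIdeal I (affineInclusion V x))) := by
      have h4 : IsLocalRing.maximalIdeal O = _ := h
      rw [h4, hJ]
      refine sup_le hI ((Ideal.span_singleton_le_iff_mem _).mpr ?_)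
      exact hP'.mem_of_pow_mem N (hI h1)
    have h5 : (P.comap (Ideal.Quotient.mk (stalkIdeal I (affineInclusion V x)))).IsMaximal := by
      have := IsLocalRing.maximalIdeal.isMaximal O
      rwa [← this.eq_of_le hP'.ne_top hmax]
    have h6 := Ideal.map_eq_top_or_isMaximal_of_surjective
      (Ideal.Quotient.mk (stalkIdeal I (affineInclusion V x))) Ideal.Quotient.mk_surjective h5
    rw [Ideal.map_comap_of_surjective _ Ideal.Quotient.mk_surjective] at h6
    exact h6.resolve_left hP.ne_top
  have h7 := (Ring.krullDimLE_iff.mp h3).trans (by norm_num : ((0 : ℕ) : WithBot ℕ∞) ≤ 0)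
  rw [hdim] at h7
  exact absurd h7 (by norm_num)

theorem mem_support_reducedIdeal_iff {Z : Set Y} (hZ : IsClosed Z) (V : Y.affineOpens)
    (x : Spec (CommRingCat.of Γ(Y, (V : Y.Opens)))) :
    affineInclusion V x ∈ Z ↔ (reducedIdeal Z).ideal V ≤ x.asIdeal := by
  have h2 : (reducedIdeal Z).ideal V =
      PrimeSpectrum.vanishingIdeal (affineInclusion V ⁻¹' closure Z) := rfl
  rw [h2, hZ.closure_eq]
  have h3 : IsClosed (affineInclusion V ⁻¹' Z) := hZ.preimage (affineInclusion V).continuous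
  have h4 := PrimeSpectrum.zeroLocus_vanishingIdeal_eq_closure (R := Γ(Y, (V : Y.Opens)))
    (affineInclusion V ⁻¹' Z)
  have h5 := h4.trans h3.closure_eq
  exact (Set.ext_iff.mp h5 x).symm

theorem isRadical_reducedIdeal_ideal (Z : Set Y) (V : Y.affineOpens) :
    ((reducedIdeal Z).ideal V).IsRadical :=
  PrimeSpectrum.isRadical_vanishingIdeal (R := Γ(Y, (V : Y.Opens)))
    (affineInclusion V ⁻¹' closure Z)

variable (p : Y ⟶ Spec (CommRingCat.of ℂ)) [Smooth p] {L L' : Y.Modules}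

theorem isClosed_center (f : Γ(L, ⊤)) (h : Γ(L', ⊤)) : IsClosed (center p f h) :=
  have := locallyOfFinitePresentation_subscheme p (zeroIdeal f)
  (zeroIdeal h).support.isClosed.inter (isClosed_singularLocus p (zeroIdeal f))

/-- The transversality at the closed points shows that the center consists of closed points. -/
theorem isClosed_singleton_of_mem_center (f : Γ(L, ⊤)) (h : Γ(L', ⊤)) (hL' : IsInvertible L')
    (htr : ∀ x ∈ center p f h, IsClosed {x} →
      MeetsTransversallyAt (reducedIdeal (singularLocus p (zeroIdeal f))) (zeroIdeal h) x)
    {x : Y} (hx : x ∈ center p f h) : IsClosed {x} := by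
  have := jacobsonSpace_of_smooth p
  have := locallyOfFinitePresentation_subscheme p (zeroIdeal f)
  have hC := isClosed_singularLocus p (zeroIdeal f)
  obtain ⟨x₁, hx₁, hcl⟩ := nonempty_inter_closedPoints (Z := closure {x})
    ⟨x, subset_closure rfl⟩ isClosed_closure.isLocallyClosed
  have hx₁Z : x₁ ∈ center p f h :=
    (isClosed_center p f h).closure_subset_iff.mpr (Set.singleton_subset_iff.mpr hx) hx₁
  have hspec : x ⤳ x₁ := specializes_iff_mem_closure.mpr hx₁
  obtain ⟨O, e₀, hO, he₀⟩ := hL' x₁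
  obtain ⟨V, hV, hVO, -⟩ := exists_affineOpen_le hO hO
  have he := he₀.restrict hVO
  obtain ⟨z, hz⟩ := he.exists_smul_eq le_rfl (restrictSection L' le_top h)
  rw [restrictSection_restrictSection] at hz
  have hxV : x ∈ (V : Y.Opens) := hspec.mem_open (V : Y.Opens).2 hV
  rw [← SetLike.mem_coe, ← range_affineInclusion] at hxV hV
  obtain ⟨w₁, rfl⟩ := hV
  obtain ⟨w, rfl⟩ := hxV
  have hw : w ⤳ w₁ := (affineInclusion V).isOpenEmbedding.isInducing.specializes_iff.mp hspec
  have hle : w.asIdeal ≤ w₁.asIdeal := (PrimeSpectrum.le_iff_specializes w w₁).mpr hw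
  have heq : w₁ = w := by
    apply PrimeSpectrum.ext
    refine le_antisymm (fun a ha ↦ ?_) hle
    obtain ⟨s, hs, hsa⟩ := exists_mul_mem_sup_of_meetsTransversallyAt V w₁ (htr _ hx₁Z hcl) a ha
    have h1 : (reducedIdeal (singularLocus p (zeroIdeal f))).ideal V ⊔ (zeroIdeal h).ideal V ≤
        w.asIdeal := by
      refine sup_le ((mem_support_reducedIdeal_iff hC V w).mp hx.2) ?_
      rw [ideal_zeroIdeal hL' h V he hz, Ideal.span_singleton_le_iff_mem]
      exact (mem_support_zeroIdeal_iff hL' h V he hz w).mp hx.1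
    exact (w.2.mem_or_mem (h1 hsa)).resolve_left fun h2 ↦ hs (hle h2)
  rw [← heq]
  exact hcl

end

section

variable {Y : Scheme.{0}}

theorem specMap_restrictFun {V W : Y.affineOpens} (hWV : (W : Y.Opens) ≤ V) :
    specMap (restrictFun hWV) ≫ affineInclusion V = affineInclusion W :=
  V.2.map_fromSpec W.2 (homOfLE hWV).op

theorem map_mem_span_range {A A' ι : Type} [CommRing A] [CommRing A'] (ψ : A →+* A') {a j : A}
    (c : ι → A) (ha : IsUnit (ψ a)) (h : a * j ∈ Ideal.span (Set.range c)) :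
    ψ j ∈ Ideal.span (Set.range fun i ↦ ψ (c i)) := by
  have h1 := Ideal.mem_map_of_mem ψ h
  rw [Ideal.map_span, ← Set.range_comp, map_mul] at h1
  exact (Ideal.unit_mul_mem_iff_mem _ ha).mp h1

variable (p : Y ⟶ Spec (CommRingCat.of ℂ)) [Smooth p] {L L' : Y.Modules}

/-- Étale coordinates near a point of the center: the curve of singularities is the vanishing locus
of the coordinates `c (some i)`, the section `h` is the coordinate `c none`, and `f` is a form of
degree `m` in the `c (some i)` whose reduction at the point is smooth. -/
theorem exists_center_chart (hL : IsInvertible L) (hL' : IsInvertible L') {m : ℕ}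
    (T : TensorPowerIso m L' L) (f : Γ(L, ⊤)) (h : Γ(L', ⊤)) (U : Y.Opens)
    (hU : OrdinarySlicesOn p (zeroIdeal f) m U) (hgen : center p f h ⊆ (U : Set Y))
    (htr : ∀ x ∈ center p f h, IsClosed {x} →
      MeetsTransversallyAt (reducedIdeal (singularLocus p (zeroIdeal f))) (zeroIdeal h) x)
    {x₀ : Y} (hx₀ : x₀ ∈ center p f h) :
    ∃ (V : Y.affineOpens) (_ : Algebra ℂ Γ(Y, (V : Y.Opens))) (ι : Type) (_ : Fintype ι)
      (_ : DecidableEq ι) (c : Option ι → Γ(Y, (V : Y.Opens)))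
      (θ : Γ(Y, (V : Y.Opens)) →ₐ[ℂ] ℂ) (F : MvPolynomial ι Γ(Y, (V : Y.Opens)))
      (e : Γ(L, (V : Y.Opens))), x₀ ∈ (V : Y.Opens) ∧
      affineInclusion V ≫ p = specOver Γ(Y, (V : Y.Opens)) ∧
      (MvPolynomial.aeval c : MvPolynomial (Option ι) ℂ →ₐ[ℂ] _).toRingHom.Etale ∧
      (∀ a, θ a = 0 ↔ a ∈ Ideal.span (Set.range c)) ∧ F.IsHomogeneous m ∧
      IsSmoothForm (MvPolynomial.map (θ : Γ(Y, (V : Y.Opens)) →+* ℂ) F) ∧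
      (∀ a, θ a ≠ 0 → ∀ N : ℕ, a * c none ^ N ∉ Ideal.span (Set.range fun i ↦ c (some i))) ∧
      IsLocalGenerator L e ∧
      restrictSection L le_top f = MvPolynomial.eval (fun i ↦ c (some i)) F • e ∧
      restrictSection L le_top (T.pow h) = c none ^ m • e ∧
      (reducedIdeal (center p f h)).ideal V = Ideal.span (Set.range c) ∧
      (reducedIdeal (singularLocus p (zeroIdeal f))).ideal V =
        Ideal.span (Set.range fun i ↦ c (some i)) := by
  have hjac := jacobsonSpace_of_smooth p
  have hLFP := locallyOfFinitePresentation_subscheme p (zeroIdeal f)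
  have hC := isClosed_singularLocus p (zeroIdeal f)
  set C := singularLocus p (zeroIdeal f) with hCdef
  have hZ := isClosed_center p f h
  have hcl := isClosed_singleton_of_mem_center p f h hL' htr hx₀
  have hmeet := htr x₀ hx₀ hcl
  have hdim : ringKrullDim (Y.presheaf.stalk x₀ ⧸ stalkIdeal (reducedIdeal C) x₀) = 1 :=
    (hU.2 x₀ ⟨hx₀.2, hgen hx₀⟩ hcl).2.1
  obtain ⟨V, e', e, z, a₀, hxV, hVU, he', he, hz, ha₀, hg⟩ :=
    exists_local_equations hL hL' T f h (hgen hx₀ : x₀ ∈ U)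
  obtain ⟨_, hp, hs⟩ := exists_smooth_algebra p V
  obtain ⟨x, hx⟩ := (range_affineInclusion V).ge hxV
  have hxp := x.2
  have hxmax : x.asIdeal.IsMaximal := isMaximal_of_isClosed_singleton V x (hx ▸ hcl)
  obtain ⟨θ₀, hθ₀⟩ := exists_algHom_ker_eq Γ(Y, (V : Y.Opens)) x.asIdeal
  have hzI : (zeroIdeal h).ideal V = Ideal.span {z} := ideal_zeroIdeal hL' h V he' hz
  have hJx : (reducedIdeal C).ideal V ≤ x.asIdeal :=
    (mem_support_reducedIdeal_iff hC V x).mp (hx ▸ hx₀.2)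
  have hzx : z ∈ x.asIdeal := (mem_support_zeroIdeal_iff hL' h V he' hz x).mp (hx ▸ hx₀.1)
  obtain ⟨ι, _, _, c₀, a, hax, hc₀z, hc₀J, het, hJspan, hqspan⟩ :=
    exists_etale_coordinates Γ(Y, (V : Y.Opens)) x.asIdeal θ₀ hθ₀ ((reducedIdeal C).ideal V) hJx z hzx
      (fun b hb ↦ hzI ▸ exists_mul_mem_sup_of_meetsTransversallyAt V x (hx ▸ hmeet) b hb)
      (mul_pow_notMem_of_ringKrullDim_eq_one V x (hx ▸ hmeet) hzI (by rw [hx]; exact hdim))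
  -- Pass to the open set where the function `a` is invertible.
  let W : Y.affineOpens := Y.affineBasicOpen a
  have hWV : (W : Y.Opens) ≤ V := Y.basicOpen_le a
  let ψ : Γ(Y, (V : Y.Opens)) →+* Γ(Y, (W : Y.Opens)) := restrictFun hWV
  obtain ⟨_, hpW, hsW⟩ := exists_smooth_algebra p W
  have hψalg : ∀ t : ℂ, ψ (algebraMap ℂ _ t) = algebraMap ℂ _ t := by
    have h1 : specMap (ψ.comp (algebraMap ℂ Γ(Y, (V : Y.Opens)))) =
        specMap (algebraMap ℂ Γ(Y, (W : Y.Opens))) := by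
      rw [specMap_comp]
      change specMap ψ ≫ specOver _ = specOver _
      rw [← hp, ← hpW, ← Category.assoc, specMap_restrictFun]
    exact fun t ↦ RingHom.congr_fun (congrArg CommRingCat.Hom.hom (Spec.map_injective h1)) t
  let : Algebra Γ(Y, (V : Y.Opens)) Γ(Y, (W : Y.Opens)) := ψ.toAlgebra
  have hloc : IsLocalization.Away a Γ(Y, (W : Y.Opens)) := V.2.isLocalization_basicOpen a
  have hua : IsUnit (ψ a) := IsLocalization.Away.algebraMap_isUnit a
  let c : Option ι → Γ(Y, (W : Y.Opens)) := fun i ↦ ψ (c₀ i)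
  have hrx : affineInclusion V x ∈ Set.range (affineInclusion W) := by
    rw [range_affineInclusion]
    have h1 : affineInclusion V ⁻¹ᵁ Y.basicOpen a = PrimeSpectrum.basicOpen a :=
      V.2.fromSpec_preimage_basicOpen a
    have h2 : x ∈ affineInclusion V ⁻¹ᵁ Y.basicOpen a := by
      rw [h1]
      exact hax
    exact h2
  obtain ⟨w, hw⟩ := hrx
  have hwp := w.2
  have hwx : specMap ψ w = x := by
    apply (affineInclusion V).isOpenEmbedding.injective
    rw [← hw, ← specMap_restrictFun hWV, Scheme.Hom.comp_apply]
  have hwx' : w.asIdeal.comap ψ = x.asIdeal := congrArg PrimeSpectrum.asIdeal hwx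
  have hwmax : w.asIdeal.IsMaximal := isMaximal_of_isClosed_singleton W w (by rw [hw, hx]; exact hcl)
  obtain ⟨θ, hθ⟩ := exists_algHom_ker_eq Γ(Y, (W : Y.Opens)) w.asIdeal
  have hc₀x : ∀ i, c₀ i ∈ x.asIdeal := by
    rintro (_ | i)
    · rwa [hc₀z]
    · exact hJx (hc₀J i)
  have hspan : Ideal.span (Set.range c) = w.asIdeal := by
    apply le_antisymm
    · rw [Ideal.span_le]
      rintro _ ⟨i, rfl⟩
      have := hc₀x i
      rwa [← hwx'] at this
    · intro b hb
      obtain ⟨⟨b₀, s⟩, hbs⟩ := IsLocalization.surj (Submonoid.powers a) b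
      have hus : IsUnit (ψ s) := IsLocalization.map_units _ s
      have hbs' : b * ψ s = ψ b₀ := hbs
      have h1 : b₀ ∈ x.asIdeal := by
        rw [← hwx', Ideal.mem_comap, ← hbs']
        exact Ideal.mul_mem_right _ _ hb
      have h2 := map_mem_span_range ψ c₀ hua (hqspan b₀ h1)
      rw [← hbs', mul_comm] at h2
      exact (Ideal.unit_mul_mem_iff_mem _ hus).mp h2
  have hJW : (reducedIdeal C).ideal W = Ideal.span (Set.range fun i ↦ c (some i)) := by
    rw [← (reducedIdeal C).map_ideal hWV]
    apply le_antisymm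
    · rw [Ideal.map_le_iff_le_comap]
      exact fun j hj ↦ map_mem_span_range ψ (fun i ↦ c₀ (some i)) hua (hJspan j hj)
    · rw [Ideal.span_le]
      rintro _ ⟨i, rfl⟩
      exact Ideal.mem_map_of_mem ψ (hc₀J i)
  have hetW : (MvPolynomial.aeval c : MvPolynomial (Option ι) ℂ →ₐ[ℂ]
      Γ(Y, (W : Y.Opens))).toRingHom.Etale := by
    let E := IsLocalization.algEquiv (Submonoid.powers a) (Localization.Away a) Γ(Y, (W : Y.Opens))
    have h1 := RingHom.Etale.respectsIso.1 _ E.toRingEquiv het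
    refine (congrArg RingHom.Etale ?_).mp h1
    apply MvPolynomial.ringHom_ext
    · intro t
      have h2 : (MvPolynomial.aeval c₀ : MvPolynomial (Option ι) ℂ →ₐ[ℂ] _) (MvPolynomial.C t) =
          algebraMap ℂ _ t := MvPolynomial.aeval_C _ _
      have h3 : (MvPolynomial.aeval c : MvPolynomial (Option ι) ℂ →ₐ[ℂ] _) (MvPolynomial.C t) =
          algebraMap ℂ _ t := MvPolynomial.aeval_C _ _
      change E (algebraMap _ _ ((MvPolynomial.aeval c₀ : MvPolynomial (Option ι) ℂ →ₐ[ℂ] _)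
        (MvPolynomial.C t))) = (MvPolynomial.aeval c : MvPolynomial (Option ι) ℂ →ₐ[ℂ] _)
        (MvPolynomial.C t)
      rw [h2, h3, ← hψalg]
      exact E.commutes _
    · intro i
      have h2 : (MvPolynomial.aeval c₀ : MvPolynomial (Option ι) ℂ →ₐ[ℂ] _) (MvPolynomial.X i) =
          c₀ i := MvPolynomial.aeval_X _ _
      have h3 : (MvPolynomial.aeval c : MvPolynomial (Option ι) ℂ →ₐ[ℂ] _) (MvPolynomial.X i) =
          c i := MvPolynomial.aeval_X _ _
      change E (algebraMap _ _ ((MvPolynomial.aeval c₀ : MvPolynomial (Option ι) ℂ →ₐ[ℂ] _)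
        (MvPolynomial.X i))) = (MvPolynomial.aeval c : MvPolynomial (Option ι) ℂ →ₐ[ℂ] _)
        (MvPolynomial.X i)
      rw [h2, h3]
      exact E.commutes _
  have hθ' : ∀ b, θ b = 0 ↔ b ∈ Ideal.span (Set.range c) := fun b ↦ by rw [hspan]; exact hθ b
  have heW := he.restrict hWV
  have he'W := he'.restrict hWV
  have haW : restrictSection L le_top f = ψ a₀ • restrictSection L hWV e := by
    rw [← restrictSection_smul, ← ha₀, restrictSection_restrictSection]
  have hzW : restrictSection L' le_top h = c none • restrictSection L' hWV e' := by
    change _ = ψ (c₀ none) • _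
    rw [hc₀z, ← restrictSection_smul, ← hz, restrictSection_restrictSection]
  have hgW : restrictSection L le_top (T.pow h) = c none ^ m • restrictSection L hWV e := by
    change _ = ψ (c₀ none) ^ m • _
    rw [hc₀z, ← map_pow, ← restrictSection_smul, ← hg, restrictSection_restrictSection]
  have hzIW : (zeroIdeal h).ideal W = Ideal.span {c none} := ideal_zeroIdeal hL' h W he'W hzW
  have hJ : ∀ b, θ b ≠ 0 → ∀ N : ℕ, b * c none ^ N ∉ Ideal.span (Set.range fun i ↦ c (some i)) := by
    intro b hb N
    rw [← hJW]
    refine mul_pow_notMem_of_ringKrullDim_eq_one W w ?_ hzIW ?_ b (fun h' ↦ hb ((hθ b).mpr h')) N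
    · rw [hw, hx]
      exact hmeet
    · rw [hw, hx]
      exact hdim
  have hcenter : (reducedIdeal (center p f h)).ideal W = Ideal.span (Set.range c) := by
    rw [hspan]
    have h1 : affineInclusion W ⁻¹' center p f h = {w} := by
      apply Set.eq_singleton_iff_unique_mem.mpr
      refine ⟨by rw [Set.mem_preimage, hw, hx]; exact hx₀, fun w' hw' ↦ ?_⟩
      have h2 : w.asIdeal ≤ w'.asIdeal := by
        rw [← hspan, Ideal.span_le]
        rintro _ ⟨_ | i, rfl⟩
        · exact (mem_support_zeroIdeal_iff hL' h W he'W hzW w').mp hw'.1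
        · apply (mem_support_reducedIdeal_iff hC W w').mp hw'.2
          rw [hJW]
          exact Ideal.subset_span ⟨i, rfl⟩
      exact PrimeSpectrum.ext (hwmax.eq_of_le w'.2.ne_top h2).symm
    have h3 : (reducedIdeal (center p f h)).ideal W =
        PrimeSpectrum.vanishingIdeal (affineInclusion W ⁻¹' closure (center p f h)) := rfl
    rw [h3, hZ.closure_eq]
    exact (congrArg PrimeSpectrum.vanishingIdeal h1).trans (PrimeSpectrum.vanishingIdeal_singleton w)
  have htower : ∃ _ : Algebra (MvPolynomial (Option ι) ℂ) Γ(Y, (W : Y.Opens)),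
      algebraMap (MvPolynomial (Option ι) ℂ) Γ(Y, (W : Y.Opens)) =
        (MvPolynomial.aeval c : MvPolynomial (Option ι) ℂ →ₐ[ℂ] _).toRingHom :=
    ⟨(MvPolynomial.aeval c : MvPolynomial (Option ι) ℂ →ₐ[ℂ] _).toRingHom.toAlgebra, rfl⟩
  obtain ⟨_, halg⟩ := htower
  have : IsScalarTower ℂ (MvPolynomial (Option ι) ℂ) Γ(Y, (W : Y.Opens)) := by
    apply IsScalarTower.of_algebraMap_eq
    intro t
    rw [halg]
    exact (MvPolynomial.aeval_C c t).symm
  have : Algebra.Etale (MvPolynomial (Option ι) ℂ) Γ(Y, (W : Y.Opens)) := by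
    rw [← RingHom.etale_algebraMap, halg]
    exact hetW
  obtain ⟨F, hF, hfF, hFs⟩ := exists_smoothForm c (fun i ↦ by
      rw [halg]
      exact (MvPolynomial.aeval_X c i).symm) (ψ a₀) m
    (by rw [← hJW]; exact isRadical_reducedIdeal_ideal C W) (by
      intro q hq hJq
      let y : Spec (CommRingCat.of Γ(Y, (W : Y.Opens))) := ⟨q, hq.isPrime⟩
      have hyp : y.asIdeal.IsPrime := y.2
      have hyC : affineInclusion W y ∈ C := by
        rw [mem_support_reducedIdeal_iff hC W y, hJW]
        exact hJq
      have hyU : affineInclusion W y ∈ U :=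
        hVU (hWV ((range_affineInclusion W).le (Set.mem_range_self y)))
      obtain ⟨alg, hlocy, hst⟩ := exists_stalk_algebra W y
      obtain ⟨-, -, h3⟩ := hU.2 _ ⟨hyC, hyU⟩ (isClosed_singleton_of_isMaximal W y hq)
      refine ⟨Y.presheaf.stalk (affineInclusion W y), inferInstance, inferInstance, alg, hlocy, ?_⟩
      intro t ht
      have h4 : (stalkIdeal (zeroIdeal f) (affineInclusion W y)) =
          Ideal.span {algebraMap _ _ (ψ a₀)} := by
        rw [hst, ideal_zeroIdeal hL f W heW haW, Ideal.map_span, Set.image_singleton]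
      rw [← h4]
      refine h3 t ?_
      rw [← hCdef, hst, hJW]
      exact ht) θ hθ'
  exact ⟨W, inferInstance, ι, inferInstance, inferInstance, c, θ, F, restrictSection L hWV e,
    (range_affineInclusion W).le ⟨w, hw.trans hx⟩, hpW, hetW, hθ', hF, hFs, hJ, heW, hfF ▸ haW, hgW,
    hcenter, hJW⟩

end

/-! ### Charts along the exceptional divisor -/

section

variable {Y Y' : Scheme.{0}} (p : Y ⟶ Spec (CommRingCat.of ℂ)) [Smooth p] {L L' : Y.Modules}

/-- Near a point of the exceptional divisor the transform of the pencil is smooth, and a singular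
point of the transform of `V_f` is a limit of points of the curve of singularities of `V_f`. -/
theorem exists_equationChart_center (hL : IsInvertible L) (hL' : IsInvertible L') {m : ℕ}
    (T : TensorPowerIso m L' L) (f : Γ(L, ⊤)) (h : Γ(L', ⊤)) (U : Y.Opens)
    (hU : OrdinarySlicesOn p (zeroIdeal f) m U) (hgen : center p f h ⊆ (U : Set Y))
    (htr : ∀ x ∈ center p f h, IsClosed {x} →
      MeetsTransversallyAt (reducedIdeal (singularLocus p (zeroIdeal f))) (zeroIdeal h) x)
    {π : Y' ⟶ Y} (hπ : IsBlowup π (reducedIdeal (center p f h))) (y : Y')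
    (hy : π y ∈ center p f h) :
    ∃ (B : Type) (_ : CommRing B) (_ : Algebra ℂ B)
      (r : Spec (CommRingCat.of B) ⟶ Y') (e F G : B) (x : Spec (CommRingCat.of B)),
      IsEquationChart p π (center p f h) f (T.pow h) r e F G ∧ r x = y ∧
      (∀ q : Ideal (MvPolynomial PUnit.{1} B), q.IsPrime → q.comap MvPolynomial.C = x.asIdeal →
        MvPolynomial.C F + MvPolynomial.X PUnit.unit * MvPolynomial.C G ∈ q →
        ∃ D : Derivation ℂ (MvPolynomial PUnit.{1} B) (MvPolynomial PUnit.{1} B),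
          D (MvPolynomial.C F + MvPolynomial.X PUnit.unit * MvPolynomial.C G) ∉ q) ∧
      (F ∈ x.asIdeal → (∀ D : Derivation ℂ B B, D F ∈ x.asIdeal) → ∀ b ∉ x.asIdeal,
        ∃ x' : Spec (CommRingCat.of B), b ∉ x'.asIdeal ∧ e ∉ x'.asIdeal ∧
          (r ≫ π) x' ∈ singularLocus p (zeroIdeal f)) := by
  have hLFP := locallyOfFinitePresentation_subscheme p (zeroIdeal f)
  have hC := isClosed_singularLocus p (zeroIdeal f)
  have hZ := isClosed_center p f h
  obtain ⟨V, _, ι, _, _, c, θ, P, ε, hyV, hp, het, hθ, hP, hPs, hJ, hε, hf, hg, hcenter, hcurve⟩ :=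
    exists_center_chart p hL hL' T f h U hU hgen htr hy
  obtain ⟨_, halg⟩ : ∃ _ : Algebra (MvPolynomial (Option ι) ℂ) Γ(Y, (V : Y.Opens)),
      algebraMap (MvPolynomial (Option ι) ℂ) Γ(Y, (V : Y.Opens)) =
        (MvPolynomial.aeval c : MvPolynomial (Option ι) ℂ →ₐ[ℂ] _).toRingHom :=
    ⟨(MvPolynomial.aeval c : MvPolynomial (Option ι) ℂ →ₐ[ℂ] _).toRingHom.toAlgebra, rfl⟩
  have : IsScalarTower ℂ (MvPolynomial (Option ι) ℂ) Γ(Y, (V : Y.Opens)) := by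
    apply IsScalarTower.of_algebraMap_eq
    intro t
    rw [halg]
    exact (MvPolynomial.aeval_C c t).symm
  have : Algebra.Etale (MvPolynomial (Option ι) ℂ) Γ(Y, (V : Y.Opens)) := by
    rw [← RingHom.etale_algebraMap, halg]
    exact het
  have hc : ∀ i, c i = algebraMap (MvPolynomial (Option ι) ℂ) _ (MvPolynomial.X i) := fun i ↦ by
    rw [halg]
    exact (MvPolynomial.aeval_X c i).symm
  have hcomap : (reducedIdeal (center p f h)).comap (affineInclusion V) =
      specIdeal (Ideal.span (Set.range c)) := by
    rw [comap_affineInclusion, hcenter]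
  obtain ⟨k, hk⟩ := exists_isChartPoint hπ.1 (affineInclusion V) c hcomap y
    ((range_affineInclusion V).ge hyV)
  obtain ⟨B, _, _, ρ, w, F, hfs, hfp, hwk, hw, hnz, huniv, hgenB, hF, hchart, hlim⟩ :=
    exists_transformChart c hc θ hθ P hP hPs hJ k
  obtain ⟨r, hr, hri, hrange⟩ := exists_blowup_openImmersion hπ (affineInclusion V) c hcomap k
    (ρ : Γ(Y, (V : Y.Opens)) →+* B) w hw hnz huniv hgenB
  obtain ⟨x, hx⟩ := hrange y hk
  have hπr : ∀ x', (r ≫ π) x' = affineInclusion V (specMap (ρ : Γ(Y, (V : Y.Opens)) →+* B) x') :=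
    fun x' ↦ by rw [hr, Scheme.Hom.comp_apply]
  have hmem : ∀ x', (r ≫ π) x' ∈ center p f h ↔ ρ (c k) ∈ x'.asIdeal := by
    intro x'
    rw [hπr, mem_support_reducedIdeal_iff hZ V, hcenter, Ideal.span_le]
    constructor
    · intro h1
      exact h1 ⟨k, rfl⟩
    · rintro h1 _ ⟨i, rfl⟩
      change ρ (c i) ∈ x'.asIdeal
      rw [hw]
      exact Ideal.mul_mem_right _ _ h1
  refine ⟨B, inferInstance, inferInstance, r, ρ (c k), F, w none ^ m, x, ?_, hx, ?_, ?_⟩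
  · refine ⟨hri, ?_, hfs, inferInstance, ⟨m, ?_, ?_⟩, hmem, hchart.saturated,
      hchart.saturated_pencil⟩
    · rw [← Category.assoc, hr, Category.assoc, hp, ← specMap_comp]
      congr 2
      exact ρ.comp_algebraMap
    · rw [hr, comap_zeroIdeal hL f V hε hf, ← hF]
      rfl
    · rw [hr, comap_pencilIdeal hL f (T.pow h) V hε hf hg]
      congr 2
      have h1 : (ρ : Γ(Y, (V : Y.Opens)) →+* B) (MvPolynomial.eval (fun i ↦ c (some i)) P) =
        ρ (c k) ^ m * F := hF
      have h2 : (ρ : Γ(Y, (V : Y.Opens)) →+* B) (c none ^ m) = ρ (c k) ^ m * w none ^ m := by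
        rw [map_pow, ← mul_pow]
        exact congrArg (· ^ m) (hw none)
      rw [h1, h2, map_mul, map_mul, map_pow]
      congr 1
      ring
  · intro q hq hqx hFq
    refine hchart.smooth q hq ?_ hFq
    have h1 : ρ (c k) ∈ x.asIdeal := by
      rw [← hmem, Scheme.Hom.comp_apply, hx]
      exact hy
    rwa [← hqx] at h1
  · intro hFx hDx b hb
    have h1 : ρ (c k) ∈ x.asIdeal := by
      rw [← hmem, Scheme.Hom.comp_apply, hx]
      exact hy
    obtain ⟨q', hq', hbq, heq, hcq⟩ := hlim x.asIdeal x.2 h1 hFx hDx b hb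
    let x' : Spec (CommRingCat.of B) := ⟨q', hq'⟩
    refine ⟨x', hbq, heq, ?_⟩
    rw [hπr, mem_support_reducedIdeal_iff hC V, hcurve, Ideal.span_le]
    rintro _ ⟨i, rfl⟩
    exact hcq i

end

/-! ### Singularities of the proper transform -/

section

variable {Y Y' : Scheme.{0}} (p : Y ⟶ Spec (CommRingCat.of ℂ)) [IsIntegral Y] [Smooth p]
  {L L' : Y.Modules}

/-- Outside the exceptional divisor the blow-up identifies the proper transform with `V_f`. -/
theorem exists_openImmersions_off_center (hL : IsInvertible L) (hL' : IsInvertible L') {m : ℕ}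
    (hm : 2 ≤ m) (T : TensorPowerIso m L' L) (f : Γ(L, ⊤)) (h : Γ(L', ⊤))
    (hne : (singularLocus p (zeroIdeal f)).Nonempty)
    {π : Y' ⟶ Y} (hπ : IsBlowup π (reducedIdeal (center p f h))) (y : Y')
    (hy : π y ∉ center p f h) :
    ∃ (W : Scheme.{0}) (j : W ⟶ Y') (w : W), IsOpenImmersion j ∧ IsOpenImmersion (j ≫ π) ∧
      j w = y ∧ (fiberTransform π (center p f h) f).comap j = (zeroIdeal f).comap (j ≫ π) := by
  have := isLocallyNoetherian_of_smooth p
  have hZ := isClosed_center p f h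
  obtain ⟨B, _, _, r, e, F, G, x, hr, hx, -, hri, hF⟩ :=
    exists_equationChart_off_center p hL hL' hm T f h hne hZ hπ y hy
  exact ⟨_, r, x, hr.isOpenImmersion, hri, hx, by rw [hr.comap_fiberTransform hZ, hF]⟩

/-- The singular points of the proper transform outside the exceptional divisor are dense in its
singular locus, and the transversal slices there are those of `V_f`. -/
theorem ordinarySlicesOn_fiberTransform (hL : IsInvertible L) (hL' : IsInvertible L') {m : ℕ}
    (hm : 2 ≤ m) (T : TensorPowerIso m L' L) (f : Γ(L, ⊤)) (h : Γ(L', ⊤))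
    (hne : (singularLocus p (zeroIdeal f)).Nonempty) (U : Y.Opens)
    (hU : OrdinarySlicesOn p (zeroIdeal f) m U) (hgen : center p f h ⊆ (U : Set Y))
    (htr : ∀ x ∈ center p f h, IsClosed {x} →
      MeetsTransversallyAt (reducedIdeal (singularLocus p (zeroIdeal f))) (zeroIdeal h) x)
    {π : Y' ⟶ Y} (hπ : IsBlowup π (reducedIdeal (center p f h))) :
    ∃ U' : Y'.Opens, OrdinarySlicesOn (π ≫ p) (fiberTransform π (center p f h) f) m U' := by
  have hjac := jacobsonSpace_of_smooth p
  have := isLocallyNoetherian_of_smooth p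
  have hZ := isClosed_center p f h
  set I' := fiberTransform π (center p f h) f with hI'
  set S' := singularLocus (π ≫ p) I' with hS'
  let U' : Y'.Opens := π ⁻¹ᵁ (U ⊓ ⟨_, hZ.isOpen_compl⟩)
  have hsing : ∀ (W : Scheme.{0}) (j : W ⟶ Y') [IsOpenImmersion j] [IsOpenImmersion (j ≫ π)],
      I'.comap j = (zeroIdeal f).comap (j ≫ π) →
      ∀ w, j w ∈ S' ↔ π (j w) ∈ singularLocus p (zeroIdeal f) := by
    intro W j _ _ hj w
    rw [← Scheme.Hom.comp_apply, ← mem_singularLocus_comap_iff p _ (j ≫ π),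
      ← mem_singularLocus_comap_iff (π ≫ p) _ j, hj, Category.assoc]
  have hoff : ∀ y, π y ∉ center p f h →
      (y ∈ S' ↔ π y ∈ singularLocus p (zeroIdeal f)) ∧ (y ∈ S' → y ∈ closure (S' ∩ U')) := by
    intro y hy
    obtain ⟨W, j, w, hj, hjπ, rfl, hjI⟩ :=
      exists_openImmersions_off_center p hL hL' hm T f h hne hπ y hy
    refine ⟨hsing W j hjI w, fun hyS ↦ ?_⟩
    have h1 : π (j w) ∈ closure (singularLocus p (zeroIdeal f) ∩ U) :=
      hU.1 ((hsing W j hjI w).mp hyS)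
    have h2 : w ∈ closure ((j ≫ π) ⁻¹' (singularLocus p (zeroIdeal f) ∩ U)) := by
      rw [← (j ≫ π).isOpenEmbedding.isOpenMap.preimage_closure_eq_closure_preimage
        (j ≫ π).continuous]
      rw [Set.mem_preimage, Scheme.Hom.comp_apply]
      exact h1
    have hopen : IsOpen (j ⁻¹' (π ⁻¹' (center p f h)ᶜ)) :=
      ((hZ.isOpen_compl.preimage π.continuous).preimage j.continuous)
    have h3 := hopen.inter_closure ⟨(show w ∈ j ⁻¹' (π ⁻¹' (center p f h)ᶜ) from hy), h2⟩
    refine closure_mono ?_ (image_closure_subset_closure_image j.continuous ⟨w, h3, rfl⟩)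
    rintro _ ⟨w', ⟨hw'Z, hw'⟩, rfl⟩
    rw [Set.mem_preimage, Scheme.Hom.comp_apply] at hw'
    exact ⟨(hsing W j hjI w').mpr hw'.1, hw'.2, hw'Z⟩
  refine ⟨U', fun y hy ↦ ?_, ?_⟩
  · by_cases hyZ : π y ∈ center p f h
    · obtain ⟨B, _, _, r, e, F, G, x, hr, rfl, -, hlim⟩ :=
        exists_equationChart_center p hL hL' T f h U hU hgen htr hπ y hyZ
      have := hr.isOpenImmersion
      have := hr.formallySmooth
      have := hr.finiteType
      have hFI := hr.comap_fiberTransform hZ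
      have hxS : x ∈ singularLocus (specOver B) (specIdeal (Ideal.span {F})) := by
        rw [← hFI, ← hr.over_eq]
        exact (mem_singularLocus_comap_iff (π ≫ p) I' r x).mpr hy
      have hFx : F ∈ x.asIdeal := by
        have h1 := singularLocus_subset_support _ _ hxS
        rw [support_specIdeal] at h1
        exact h1 (Ideal.subset_span rfl)
      have hDx : ∀ D : Derivation ℂ B B, D F ∈ x.asIdeal := by
        intro D
        by_contra hD
        obtain ⟨W, j, _, ⟨w, rfl⟩, hs⟩ := exists_smooth_of_derivation F x D hD
        have h1 := (mem_singularLocus_comap_iff (specOver B) _ j w).mpr hxS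
        rw [singularLocus_eq_empty] at h1
        exact h1
      rw [← closure_closure, mem_closure_iff]
      intro O hO hxO
      obtain ⟨_, ⟨_, ⟨b, rfl⟩, rfl⟩, hxb, hb⟩ :=
        PrimeSpectrum.isBasis_basic_opens.exists_subset_of_mem_open
          (show x ∈ r ⁻¹' O from hxO) (hO.preimage r.continuous)
      obtain ⟨x', hbx', hex', hx'⟩ := hlim hFx hDx b hxb
      rw [← hr.mem_center_iff, Scheme.Hom.comp_apply] at hex'
      rw [Scheme.Hom.comp_apply] at hx'
      exact ⟨r x', hb hbx', (hoff _ hex').2 ((hoff _ hex').1.mpr hx')⟩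
    · exact (hoff y hyZ).2 hy
  · rintro y ⟨hyS, hyU, hyZ⟩ hcl
    obtain ⟨W, j, w, hj, hjπ, rfl, hjI⟩ :=
      exists_openImmersions_off_center p hL hL' hm T f h hne hπ y hyZ
    have hwcl : IsClosed {w} := by
      have h1 := hcl.preimage j.continuous
      have h2 : j ⁻¹' {j w} = {w} := Set.ext fun _ ↦ j.isOpenEmbedding.injective.eq_iff
      rwa [h2] at h1
    have hπcl : IsClosed {π (j w)} := by
      apply isClosed_singleton_of_isLocallyClosed_singleton
      have h2 := hwcl.isLocallyClosed.image (j ≫ π).isOpenEmbedding.isInducing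
        (j ≫ π).isOpenEmbedding.isOpen_range.isLocallyClosed
      rwa [Set.image_singleton, Scheme.Hom.comp_apply] at h2
    have h3 := hU.2 _ ⟨(hsing W j hjI w).mp hyS, hyU⟩ hπcl
    rw [← Scheme.Hom.comp_apply, ← hasOrdinarySlicesAt_comap_iff p _ m (j ≫ π) w] at h3
    rw [← hasOrdinarySlicesAt_comap_iff (π ≫ p) _ m j w, hjI, ← Category.assoc]
    exact h3

end

end

end PencilBlowup

open PencilBlowup

theorem proposition1p3
    (Y : Scheme.{0}) (p : Y ⟶ Spec (CommRingCat.of ℂ)) [IsIntegral Y] [Smooth p]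
    (hY : IsProjective p)
    (L : Y.Modules) (hL : IsInvertible L) (hLva : IsVeryAmple p L)
    (f : Γ(L, ⊤)) (m : ℕ) (hm : 2 ≤ m)
    (hcurve : IsCurve (singularLocus p (zeroIdeal f)))
    (U : Y.Opens) (hU : OrdinarySlicesOn p (zeroIdeal f) m U)
    (L' : Y.Modules) (hL' : IsInvertible L') (hL'a : IsAmple L')
    (T : TensorPowerIso m L' L)
    (h : Γ(L', ⊤)) (hred : IsReduced (zeroIdeal h).subscheme)
    (hsm : Smooth ((zeroIdeal h).subschemeι ≫ p))
    (hgen : center p f h ⊆ (U : Set Y))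
    (htr : ∀ x ∈ center p f h, IsClosed {x} →
      MeetsTransversallyAt (reducedIdeal (singularLocus p (zeroIdeal f))) (zeroIdeal h) x)
    (g : Γ(L, ⊤)) (hg : g = T.pow h)
    (Y' : Scheme.{0}) (π : Y' ⟶ Y) (hπ : IsBlowup π (reducedIdeal (center p f h))) :
    Smooth ((pencilTransform π (center p f h) f g).subschemeι ≫ proj Y' ≫ π ≫ p) ∧
    (pencilTransform π (center p f h) f g).comap (zeroSection Y') =
      fiberTransform π (center p f h) f ∧
    ∃ U' : Y'.Opens, OrdinarySlicesOn (π ≫ p) (fiberTransform π (center p f h) f) m U' := by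
  subst hg
  have := isLocallyNoetherian_of_smooth p
  have hZ := isClosed_center p f h
  have hchart : ∀ y : Y', ∃ (B : Type) (_ : CommRing B) (_ : Algebra ℂ B)
      (r : Spec (CommRingCat.of B) ⟶ Y') (e F G : B) (x : Spec (CommRingCat.of B)),
      IsEquationChart p π (center p f h) f (T.pow h) r e F G ∧ r x = y ∧
      ∀ q : Ideal (MvPolynomial PUnit.{1} B), q.IsPrime → q.comap MvPolynomial.C = x.asIdeal →
        MvPolynomial.C F + MvPolynomial.X PUnit.unit * MvPolynomial.C G ∈ q →
        ∃ D : Derivation ℂ (MvPolynomial PUnit.{1} B) (MvPolynomial PUnit.{1} B),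
          D (MvPolynomial.C F + MvPolynomial.X PUnit.unit * MvPolynomial.C G) ∉ q := by
    intro y
    by_cases hy : π y ∈ center p f h
    · obtain ⟨B, _, _, r, e, F, G, x, hr, hx, hD, -⟩ :=
        exists_equationChart_center p hL hL' T f h U hU hgen htr hπ y hy
      exact ⟨B, _, _, r, e, F, G, x, hr, hx, hD⟩
    · obtain ⟨B, _, _, r, e, F, G, x, hr, hx, hD, -⟩ :=
        exists_equationChart_off_center p hL hL' hm T f h hcurve.1 hZ hπ y hy
      exact ⟨B, _, _, r, e, F, G, x, hr, hx, hD⟩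
  refine ⟨smooth_pencilTransform hZ hchart, comap_zeroSection_pencilTransform (p := p) hZ fun y ↦ ?_,
    ordinarySlicesOn_fiberTransform p hL hL' hm T f h hcurve.1 U hU hgen htr hπ⟩
  obtain ⟨B, _, _, r, e, F, G, x, hr, hx, -⟩ := hchart y
  exact ⟨B, _, _, r, e, F, G, hr, x, hx⟩
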